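/- Consider a binary pairwise Markov random field with variables $X_1,\dots,X_n\in\{0,1\}$, $n\ge 1$, a simple undirected graph with $m$ edges, and energy $E(x)=-\sum_i\theta_i x_i-\sum_{(i,j)\in\mathcal E}W_{ij}x_ix_j$. Let $d_i$ be the degree of $i$ and $W=\max_{(i,j)\in\mathcal E}|W_{ij}|$ ($W=0$ if $m=0$). Assume that the model is fully attractive, i.e. $W_{ij}>0$ for all edges; there is no restriction on degree or topology. For a locally consistent pseudo-marginal, i.e. numbers $q_i=q(X_i=1)\in[0,1]$ and probability tables $\mu_{ij}$ on $\{0,1\}^2$ with marginals $q_i,q_j$, the Bethe free energy is $\mathbb E_q(E)-\sum_{(i,j)\in\mathcal E}S(\mu_{ij})-\sum_i(1-d_i)S(q_i)$, with $S$ the Shannon entropy, and $-\log Z_B$ is its minimum over all such pseudo-marginals. For $q\in[0,1]^n$ let $$\mathcal F(q)=\sum_{(i,j)\in\mathcal E}f_{ij}(q_i,q_j)+\sum_i\big(-\theta_iq_i+(d_i-1)S(q_i)\big),\qquad f_{ij}=-W_{ij}\xi_{ij}-S(\mu_{ij}),$$ where $\mu_{ij}$ is the table with marginals $q_i,q_j$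 and $\mu_{ij}(1,1)=\xi_{ij}$, and $\xi_{ij}$ is the lower root of $\alpha\xi^2-[1+\alpha(q_i+q_j)]\xi+(1+\alpha)q_iq_j=0$, $\alpha=e^{W_{ij}}-1$. Let $\epsilon>0$, $D_i=\sum_{j\sim i}W_{ij}$, $\gamma_i=\epsilon/(nD_i)$, and let $\mathcal M_i$ consist of $1-B_i=\sigma(\theta_i+D_i)$ and of the points $A_i,A_i+2\gamma_i,A_i+4\gamma_i,\dots$ below $1-B_i$, where $A_i=\sigma(\theta_i)$ and $\sigma(x)=1/(1+e^{-x})$ (if $D_i=0$ then $\mathcal M_i=\{A_i\}$). Put $N=\sum_i|\mathcal M_i|$. Then: 1. For every choice of finite meshes in $[0,1]$, in particular for $\mathcal M=\prod_i\mathcal M_i$, the discretized problem is submodular: $f_{ij}(u\wedge v)+f_{ij}(u\vee v)\le f_{ij}(u)+f_{ij}(v)$ for every edge $(i,j)$ and all pairs $u,v$ of mesh values for $(q_i,q_j)$. 2. $\mathcal M$ is sufficient, i.e. some $q^*\in\mathcal M$ satisfies $\mathcal F(q^*)-\mathcal F(q)\le\epsilon$ for all $q\in[0,1]^n$; and $N\le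 2n+\frac n\epsilon\sum_{(i,j)\in\mathcal E}|W_{ij}|$. 3. Minimizing $\mathcal F$ over $\mathcal M$ is a graph cut problem: there is a network with at most $N+2$ nodes and non-negative capacities in which the points $q\in\mathcal M$ are encoded injectively by $s$-$t$ cuts of capacity $\mathcal F(q)+\mathrm{const}$, and every minimum cut encodes a point of $\mathcal M$ (hence a minimizer). 4. There is a single real-RAM algorithm (unit-cost $+,-,\times,/,\exp,\log$ and comparisons on reals; addition, subtraction, comparison and indexing on natural numbers) and a constant $C$ such that, for every such model and every $\epsilon>0$, on input of the model and $\epsilon$ it outputs an exact minimizer $q^*$ of $\mathcal F$ over $\mathcal M$ together with the number $-\mathcal F(q^*)$, for which $|-\mathcal F(q^*)-\log Z_B|\le\epsilon$, after at most $C N^3$ steps and at most $C\,(n+nmW/\epsilon)^3$ steps. In particular, whenever $\epsilon\le mW$, it takes at most $C\,\epsilon^{-3}n^3m^3W^3$ steps. -/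

import Mathlib

noncomputable section

/-! ### Binary pairwise Markov random fields and the Bethe approximation -/

/-- A binary pairwise Markov random field with `n` variables and `m` edges. The energy of
`x ∈ {0,1}ⁿ` is `E(x) = - ∑ i, θ i * x i - ∑ e, W e * x (src e) * x (tgt e)`. The undirected edges
are listed once each, as pairs of distinct vertices `src e < tgt e`. -/
structure BinaryMRF (n m : ℕ) where
  src : Fin m → Fin n
  tgt : Fin m → Fin n
  src_lt_tgt : ∀ e, src e < tgt e
  edge_injective : Function.Injective fun e => (src e, tgt e)
  θ : Fin n → ℝ
  W : Fin m → ℝ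

namespace BinaryMRF

variable {n m : ℕ} (M : BinaryMRF n m)

/-- All edges are attractive. -/
def Attractive : Prop := ∀ e, 0 < M.W e

/-- The edges at the vertex `i`. -/
def incident (i : Fin n) : Finset (Fin m) :=
  Finset.univ.filter fun e => M.src e = i ∨ M.tgt e = i

/-- The degree of the vertex `i`. -/
def degree (i : Fin n) : ℕ := (M.incident i).card

/-- The maximum of `|W e|` over the edges (`0` if there are none). -/
def maxWeight : ℝ := ⨆ e, |M.W e|

/-- The local polytope: singleton pseudo-marginals `q i = q(X_i = 1)` and pairwise pseudo-marginals
`μ e a b = q(X_{src e} = a, X_{tgt e} = b)` that are locally consistent. -/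
def localPolytope : Set ((Fin n → ℝ) × (Fin m → Fin 2 → Fin 2 → ℝ)) :=
  {p | (∀ i, p.1 i ∈ Set.Icc (0 : ℝ) 1) ∧
    ∀ e, (∀ a b, 0 ≤ p.2 e a b) ∧ (∑ a, ∑ b, p.2 e a b = 1) ∧
      (∑ b, p.2 e 1 b = p.1 (M.src e)) ∧ (∑ a, p.2 e a 1 = p.1 (M.tgt e))}

/-- The entropy of a `2 × 2` table (with `0 log 0 = 0`). -/
def pairEntropy (μ : Fin 2 → Fin 2 → ℝ) : ℝ := ∑ a, ∑ b, Real.negMulLog (μ a b)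

/-- The Bethe free energy `𝔼_q(E) - S_B(q)` of a pseudo-marginal, where the Bethe entropy is
`S_B = ∑ e, S_e + ∑ i, (1 - d_i) S_i`. -/
def betheFreeEnergy (p : (Fin n → ℝ) × (Fin m → Fin 2 → Fin 2 → ℝ)) : ℝ :=
  (-(∑ i, M.θ i * p.1 i) - ∑ e, M.W e * p.2 e 1 1) -
    ((∑ e, pairEntropy (p.2 e)) + ∑ i, (1 - (M.degree i : ℝ)) * Real.binEntropy (p.1 i))

/-- `log Z_B`: minus the minimum of the Bethe free energy over the (compact, non-empty) local
polytope. -/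
def logZB : ℝ := -sInf (M.betheFreeEnergy '' M.localPolytope)

/-- The optimal `ξ = q(X_i = 1, X_j = 1)` given `q_i = x`, `q_j = y`, for an edge weight `w ≠ 0`: with
`α = exp w - 1`, the lower root (if `α > 0`; the higher root if `α < 0`) of
`α ξ² - (1 + α (x + y)) ξ + (1 + α) x y = 0`. -/
def xi (w x y : ℝ) : ℝ :=
  let α := Real.exp w - 1
  (1 + α * (x + y) - √((1 + α * (x + y)) ^ 2 - 4 * α * ((1 + α) * (x * y)))) / (2 * α)

/-- The pairwise pseudo-marginal determined by `q_i = x`, `q_j = y` and `ξ`. -/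
def pairMarginal (x y ξ : ℝ) : Fin 2 → Fin 2 → ℝ :=
  !![1 + ξ - x - y, y - ξ; x - ξ, ξ]

/-- The cost function `f_ij (q_i, q_j) = - W_ij ξ_ij - S_ij` of an edge of weight `w`. -/
def edgeCost (w x y : ℝ) : ℝ :=
  -(w * xi w x y) - pairEntropy (pairMarginal x y (xi w x y))

/-- The Bethe free energy as a function `𝓕 (q)` of the singleton pseudo-marginals `q ∈ [0,1]ⁿ`. -/
def freeEnergy (q : Fin n → ℝ) : ℝ :=
  (∑ e, edgeCost (M.W e) (q (M.src e)) (q (M.tgt e))) +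
    ∑ i, (-(M.θ i * q i) + ((M.degree i : ℝ) - 1) * Real.binEntropy (q i))

/-! ### Meshes -/

/-- The points of the product of the one-dimensional meshes `𝓜 i`. -/
def meshPoints (𝓜 : Fin n → Finset ℝ) : Set (Fin n → ℝ) := {q | ∀ i, q i ∈ 𝓜 i}

/-- A mesh is sufficient (for the accuracy `ε`) if it consists of points of `[0,1]` and some mesh
point has free energy within `ε` of the global minimum over `[0,1]ⁿ`. -/
def SufficientMesh (𝓜 : Fin n → Finset ℝ) (ε : ℝ) : Prop :=
  (∀ i, ∀ x ∈ 𝓜 i, x ∈ Set.Icc (0 : ℝ) 1) ∧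
    ∃ q ∈ meshPoints 𝓜, ∀ q' : Fin n → ℝ, (∀ i, q' i ∈ Set.Icc (0 : ℝ) 1) →
      M.freeEnergy q - M.freeEnergy q' ≤ ε

/-- A function of two ordered labels is submodular on `A × B`. -/
def SubmodularOn (f : ℝ → ℝ → ℝ) (A B : Finset ℝ) : Prop :=
  ∀ x ∈ A, ∀ x' ∈ A, ∀ y ∈ B, ∀ y' ∈ B,
    f (min x x') (min y y') + f (max x x') (max y y') ≤ f x y + f x' y'

/-- The discretized problem on the mesh `𝓜` is submodular: all its pairwise cost functions are. -/
def SubmodularMesh (𝓜 : Fin n → Finset ℝ) : Prop :=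
  ∀ e, SubmodularOn (edgeCost (M.W e)) (𝓜 (M.src e)) (𝓜 (M.tgt e))

/-- `q` solves the discretized problem on the mesh `𝓜` exactly. -/
def IsMeshMinimizer (𝓜 : Fin n → Finset ℝ) (q : Fin n → ℝ) : Prop :=
  q ∈ meshPoints 𝓜 ∧ ∀ q' ∈ meshPoints 𝓜, M.freeEnergy q ≤ M.freeEnergy q'

/-- `W_i`, the total weight of the attractive edges at `i`. -/
def posWeight (i : Fin n) : ℝ := ∑ e ∈ M.incident i, max (M.W e) 0

/-- `V_i`, the total absolute weight of the repulsive edges at `i`. -/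
def negWeight (i : Fin n) : ℝ := ∑ e ∈ M.incident i, max (-M.W e) 0

/-- The lower end `A_i = σ(θ_i - V_i)` of the Bethe box in dimension `i`. -/
def boxLower (i : Fin n) : ℝ := Real.sigmoid (M.θ i - M.negWeight i)

/-- The upper end `1 - B_i = σ(θ_i + W_i)` of the Bethe box in dimension `i`. -/
def boxUpper (i : Fin n) : ℝ := Real.sigmoid (M.θ i + M.posWeight i)

/-- The bound `D_i = V_i + W_i` on `|∂𝓕/∂q_i|` in the Bethe box. -/
def derivBound (i : Fin n) : ℝ := M.negWeight i + M.posWeight i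

/-- `γ_i = ε / (n D_i)`; the mesh width is `2 γ_i`. If `D_i = 0`, then `A_i = 1 - B_i` and the value of
`γ_i` does not matter. -/
def meshRadius (ε : ℝ) (i : Fin n) : ℝ := ε / (n * M.derivBound i)

/-- The simple mesh: in dimension `i` the points `A_i, A_i + 2 γ_i, A_i + 4 γ_i, …` below `1 - B_i`,
and the point `1 - B_i`. -/
def simpleMesh (ε : ℝ) (i : Fin n) : Finset ℝ :=
  (Finset.range (1 + ⌈(M.boxUpper i - M.boxLower i) / (2 * M.meshRadius ε i)⌉₊)).image
    fun k : ℕ => min (M.boxLower i + 2 * M.meshRadius ε i * k) (M.boxUpper i)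

/-- `N = ∑ i, N_i`, the sum of the numbers of points in the dimensions of a mesh. -/
def meshSize (𝓜 : Fin n → Finset ℝ) : ℕ := ∑ i, (𝓜 i).card

end BinaryMRF

/-! ### Graph cuts -/

/-- The capacity of the cut `(S, Sᶜ)`: the sum of the capacities of the arcs that leave `S`. -/
def cutCapacity {k : ℕ} (cap : Fin k → Fin k → ℝ) (S : Finset (Fin k)) : ℝ :=
  ∑ u ∈ S, ∑ v ∈ Sᶜ, cap u v

/-- `S` is a minimum `s`-`t` cut. -/
def IsMinCut {k : ℕ} (cap : Fin k → Fin k → ℝ) (s t : Fin k) (S : Finset (Fin k)) : Prop :=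
  (s ∈ S ∧ t ∉ S) ∧
    ∀ S' : Finset (Fin k), s ∈ S' → t ∉ S' → cutCapacity cap S ≤ cutCapacity cap S'

/-- The minimization of `F` over `P` is a minimum cut problem in a network with at most `K` nodes and
non-negative capacities: every `q ∈ P` is encoded by an `s`-`t` cut, with capacity `F q` up to a
constant, and every minimum cut is the encoding of some `q ∈ P` (which then minimizes `F`). -/
def GraphCutSolvable {α : Type} (F : α → ℝ) (P : Set α) (K : ℕ) : Prop :=
  ∃ k ≤ K, ∃ (cap : Fin k → Fin k → ℝ) (s t : Fin k) (c : ℝ) (enc : α → Finset (Fin k)),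
    s ≠ t ∧ (∀ u v, 0 ≤ cap u v) ∧ Set.InjOn enc P ∧
      (∀ q ∈ P, s ∈ enc q ∧ t ∉ enc q ∧ cutCapacity cap (enc q) = F q + c) ∧
      ∀ S, IsMinCut cap s t S → ∃ q ∈ P, S = enc q

/-! ### Real random access machine

Programs for a random access machine with natural-number and real memory. There are countably many
arrays of each kind; a program names the arrays it uses by constants, and indices are computed. The
natural numbers admit addition and truncated subtraction only, the reals the four arithmetic
operations, `exp` and `log`; there is no conversion from reals to natural numbers, only comparison.
Every operation, memory access and test is charged at least one step. -/

namespace RealRAM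

/-- The memory: cell `k` of array `a` is `nat a k` or `real a k`. -/
structure Memory where
  nat : ℕ → ℕ → ℕ
  real : ℕ → ℕ → ℝ

inductive NatExpr : Type
  | const (c : ℕ)
  | read (a : ℕ) (k : NatExpr)
  | add (x y : NatExpr)
  | sub (x y : NatExpr)

inductive RealExpr : Type
  | const (c : ℚ)
  | read (a : ℕ) (k : NatExpr)
  | add (x y : RealExpr)
  | sub (x y : RealExpr)
  | mul (x y : RealExpr)
  | div (x y : RealExpr)
  | exp (x : RealExpr)
  | log (x : RealExpr)

inductive Test : Type
  | natLT (x y : NatExpr)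
  | realLT (x y : RealExpr)
  | neg (b : Test)
  | conj (b b' : Test)

inductive Program : Type
  | skip
  | writeNat (a : ℕ) (k x : NatExpr)
  | writeReal (a : ℕ) (k : NatExpr) (x : RealExpr)
  | seq (p p' : Program)
  | cond (b : Test) (p p' : Program)
  | loop (b : Test) (p : Program)

namespace NatExpr

def eval (σ : Memory) : NatExpr → ℕ
  | const c => c
  | read a k => σ.nat a (k.eval σ)
  | add x y => x.eval σ + y.eval σ
  | sub x y => x.eval σ - y.eval σ

/-- The number of operations in the evaluation. -/
def cost : NatExpr → ℕ
  | const _ => 1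
  | read _ k => k.cost + 1
  | add x y => x.cost + y.cost + 1
  | sub x y => x.cost + y.cost + 1

end NatExpr

namespace RealExpr

def eval (σ : Memory) : RealExpr → ℝ
  | const c => c
  | read a k => σ.real a (k.eval σ)
  | add x y => x.eval σ + y.eval σ
  | sub x y => x.eval σ - y.eval σ
  | mul x y => x.eval σ * y.eval σ
  | div x y => x.eval σ / y.eval σ
  | exp x => Real.exp (x.eval σ)
  | log x => Real.log (x.eval σ)

/-- The number of operations in the evaluation. -/
def cost : RealExpr → ℕ
  | const _ => 1
  | read _ k => k.cost + 1
  | add x y => x.cost + y.cost + 1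
  | sub x y => x.cost + y.cost + 1
  | mul x y => x.cost + y.cost + 1
  | div x y => x.cost + y.cost + 1
  | exp x => x.cost + 1
  | log x => x.cost + 1

end RealExpr

namespace Test

def Holds (σ : Memory) : Test → Prop
  | natLT x y => x.eval σ < y.eval σ
  | realLT x y => x.eval σ < y.eval σ
  | neg b => ¬ b.Holds σ
  | conj b b' => b.Holds σ ∧ b'.Holds σ

/-- The number of operations in the evaluation. -/
def cost : Test → ℕ
  | natLT x y => x.cost + y.cost + 1
  | realLT x y => x.cost + y.cost + 1
  | neg b => b.cost + 1
  | conj b b' => b.cost + b'.cost + 1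

end Test

namespace Memory

def setNat (σ : Memory) (a k x : ℕ) : Memory :=
  { σ with nat := Function.update σ.nat a (Function.update (σ.nat a) k x) }

def setReal (σ : Memory) (a k : ℕ) (x : ℝ) : Memory :=
  { σ with real := Function.update σ.real a (Function.update (σ.real a) k x) }

end Memory

/-- `Exec p σ t σ'`: the program `p`, started in the memory `σ`, halts after `t` steps in the memory
`σ'`. -/
inductive Exec : Program → Memory → ℕ → Memory → Prop
  | skip (σ : Memory) : Exec .skip σ 1 σ
  | writeNat (σ : Memory) (a : ℕ) (k x : NatExpr) :
      Exec (.writeNat a k x) σ (k.cost + x.cost + 1) (σ.setNat a (k.eval σ) (x.eval σ))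
  | writeReal (σ : Memory) (a : ℕ) (k : NatExpr) (x : RealExpr) :
      Exec (.writeReal a k x) σ (k.cost + x.cost + 1) (σ.setReal a (k.eval σ) (x.eval σ))
  | seq {p p' : Program} {σ σ₁ σ₂ : Memory} {t t' : ℕ} :
      Exec p σ t σ₁ → Exec p' σ₁ t' σ₂ → Exec (.seq p p') σ (t + t') σ₂
  | condTrue {b : Test} {p p' : Program} {σ σ₁ : Memory} {t : ℕ} :
      b.Holds σ → Exec p σ t σ₁ → Exec (.cond b p p') σ (b.cost + t) σ₁
  | condFalse {b : Test} {p p' : Program} {σ σ₁ : Memory} {t : ℕ} :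
      ¬ b.Holds σ → Exec p' σ t σ₁ → Exec (.cond b p p') σ (b.cost + t) σ₁
  | loopTrue {b : Test} {p : Program} {σ σ₁ σ₂ : Memory} {t t' : ℕ} :
      b.Holds σ → Exec p σ t σ₁ → Exec (.loop b p) σ₁ t' σ₂ →
        Exec (.loop b p) σ (b.cost + t + t') σ₂
  | loopFalse {b : Test} {p : Program} {σ : Memory} :
      ¬ b.Holds σ → Exec (.loop b p) σ b.cost σ

/-- The array whose first `k` cells hold `f` and whose other cells hold `0`. -/
def ofFin {α : Type} [Zero α] {k : ℕ} (f : Fin k → α) : ℕ → α :=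
  fun j => if h : j < k then f ⟨j, h⟩ else 0

/-- The memory that holds a model and the accuracy `ε`: natural-number array `0` holds `n` and `m`,
arrays `1` and `2` the two endpoints of the edges; real array `0` holds `ε`, array `1` the `θ i` and
array `2` the edge weights. All other cells hold `0`. -/
def inputMemory {n m : ℕ} (M : BinaryMRF n m) (ε : ℝ) : Memory where
  nat
    | 0 => ofFin ![n, m]
    | 1 => ofFin fun e => (M.src e : ℕ)
    | 2 => ofFin fun e => (M.tgt e : ℕ)
    | _ => fun _ => 0
  real
    | 0 => ofFin ![ε]
    | 1 => ofFin M.θ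
    | 2 => ofFin M.W
    | _ => fun _ => 0

/-- The output number: cell `0` of real array `0`. -/
def outputValue (σ : Memory) : ℝ := σ.real 0 0

/-- The output vector: the first `n` cells of real array `1`. -/
def outputPoint (n : ℕ) (σ : Memory) : Fin n → ℝ := fun i => σ.real 1 i

end RealRAM

end

/-! For fixed marginals the optimal table is characterized by μ(1,1) μ(0,0) = e^W μ(1,0) μ(0,1)
(`xi_root`, `edgeCost_le`). This relation removes the derivative of ξ from ∂f/∂q_i, which becomes
log(q_i - (1 - e^{-W}) ξ) - log(1 - q_i) (`hasDerivAt_edgeCost`). Two properties of ξ then give all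
the analysis. Since ξ increases in q_j, the derivative decreases in q_j, which is submodularity
(`edgeCost_decreasing_differences`). Since 0 ≤ ξ ≤ q_i, the derivative of f + S(q_i) lies in [-W,
0].

Distributing the entropies d_i S(q_i) over the edges (`freeEnergy_eq`) confines the i-th slope of
the free energy between logit(q_i) - θ_i - D_i and logit(q_i) - θ_i. Hence moving a coordinate into
the Bethe box does not raise the free energy (`Attractive.clamp_le`), and inside the box the free
energy is D_i-Lipschitz in that coordinate (`Attractive.update_lipschitz`). Rounding a coordinate to
a mesh point at distance at most γ_i costs at most D_i γ_i = ε / n, so n coordinates cost ε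
(`Attractive.exists_meshPoints_le`).

A coordinate with κ + 1 mesh points is encoded by κ binary nodes, one for each interval, with value
1 when the interval lies below the point. Unary and boundary costs telescope into node coefficients,
and pairwise costs into arc weights that are minus mixed second differences, hence non-negative by
submodularity. Heavy arcs between consecutive nodes exclude sets that encode no point
(`GridProblem.energy_eq`, `GridProblem.exists_encodes`).

The cut problem is solved by a push-relabel method without explicit source and sink: a negative
coefficient is an excess, a positive one a free capacity to the sink. A push only reparametrizes the
energy (`cutEnergy_push`). Excess that cannot reach a deficit is left at label K + 1. At the end
some label in 1, …, K + 1 is unused, and the nodes above it form an optimal set (`Valid.isMin`).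
`SweepInv` bounds the number of sweeps by O(K²), and `potential` the number of steps by O(K³).

The RAM program is verified with a frame rule (`Agree`), weakest preconditions for loop-free code,
and rules for loops. With K nodes one has K + n = N, so its cost is O((N + 1)³), which is O(N³)
because N ≥ n ≥ 1. -/

namespace BinaryMRF

/-! ### The optimal pairwise marginal -/

lemma xi_comm (w x y : ℝ) : xi w x y = xi w y x := by
  simp only [xi, add_comm x y, mul_comm x y]

/-- The discriminant equals 1 + 2α (x(1 - y) + y(1 - x)) + α² (x - y)². Being bounded away from 0,
it makes the square root differentiable on the whole closed square and computable as exp(log(·) /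
2). -/
lemma one_le_disc {w x y : ℝ} (hw : 0 < w) (hx : x ∈ Set.Icc (0 : ℝ) 1)
    (hy : y ∈ Set.Icc (0 : ℝ) 1) :
    1 ≤ (1 + (Real.exp w - 1) * (x + y)) ^ 2 -
      4 * (Real.exp w - 1) * ((1 + (Real.exp w - 1)) * (x * y)) := by
  have hα : 0 < Real.exp w - 1 := by linarith [Real.add_one_lt_exp hw.ne']
  generalize Real.exp w - 1 = α at *
  have h1 : 0 ≤ x * (1 - y) + y * (1 - x) :=
    add_nonneg (mul_nonneg hx.1 (by linarith [hy.2])) (mul_nonneg hy.1 (by linarith [hx.2]))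
  nlinarith [mul_nonneg hα.le h1, sq_nonneg (α * (x - y))]

/-- The quadratic defining ξ, evaluated at z, is e^w (x - z)(y - z) - z (1 + z - x - y). If it is
non-negative at a point left of its vertex (x + y)/2 + 1/(2α), that point is at most the lower root.
All lower bounds on ξ are instances of this. -/
lemma le_xi {w x y z : ℝ} (hw : 0 < w)
    (hz : 0 ≤ Real.exp w * ((x - z) * (y - z)) - z * (1 + z - x - y)) (hxy : 2 * z ≤ x + y) :
    z ≤ xi w x y := by
  have hα : 0 < Real.exp w - 1 := by linarith [Real.add_one_lt_exp hw.ne']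
  obtain ⟨α, hα'⟩ : ∃ α, α = Real.exp w - 1 := ⟨_, rfl⟩
  have hE : Real.exp w = 1 + α := by linarith
  simp only [xi, ← hα']
  rw [← hα'] at hα
  rw [hE] at hz
  rw [le_div_iff₀ (by positivity)]
  have : √((1 + α * (x + y)) ^ 2 - 4 * α * ((1 + α) * (x * y))) ≤ 1 + α * (x + y) - 2 * α * z := by
    apply Real.sqrt_le_iff.mpr
    constructor
    · nlinarith
    · nlinarith [mul_nonneg hα.le hz]
  linarith

/-- Where the quadratic is non-positive, z lies between the two roots. -/
lemma xi_le {w x y z : ℝ} (hw : 0 < w)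
    (hz : Real.exp w * ((x - z) * (y - z)) - z * (1 + z - x - y) ≤ 0) :
    xi w x y ≤ z := by
  have hα : 0 < Real.exp w - 1 := by linarith [Real.add_one_lt_exp hw.ne']
  obtain ⟨α, hα'⟩ : ∃ α, α = Real.exp w - 1 := ⟨_, rfl⟩
  have hE : Real.exp w = 1 + α := by linarith
  simp only [xi, ← hα']
  rw [← hα'] at hα
  rw [hE] at hz
  rw [div_le_iff₀ (by positivity)]
  have : 1 + α * (x + y) - 2 * α * z ≤ √((1 + α * (x + y)) ^ 2 - 4 * α * ((1 + α) * (x * y))) := by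
    apply Real.le_sqrt_of_sq_le
    nlinarith [mul_nonneg hα.le (neg_nonneg.mpr hz)]
  linarith

/-- The quadratic equation, read as an odds-ratio identity between the four table entries. After
taking logarithms it is the stationarity condition in ξ. -/
lemma xi_root {w x y : ℝ} (hw : 0 < w) (hx : x ∈ Set.Icc (0 : ℝ) 1) (hy : y ∈ Set.Icc (0 : ℝ) 1) :
    xi w x y * (1 + xi w x y - x - y) = Real.exp w * ((x - xi w x y) * (y - xi w x y)) := by
  have hd := one_le_disc hw hx hy
  have hα : 0 < Real.exp w - 1 := by linarith [Real.add_one_lt_exp hw.ne']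
  obtain ⟨α, hα'⟩ : ∃ α, α = Real.exp w - 1 := ⟨_, rfl⟩
  have hE : Real.exp w = 1 + α := by linarith
  simp only [xi]
  rw [← hα'] at hα hd ⊢
  rw [hE]
  have hs := Real.sq_sqrt (zero_le_one.trans hd)
  set s := √((1 + α * (x + y)) ^ 2 - 4 * α * ((1 + α) * (x * y)))
  field_simp
  linear_combination (-α) * hs

lemma xi_le_left {w x y : ℝ} (hw : 0 < w) (hx : x ∈ Set.Icc (0 : ℝ) 1)
    (hy : y ∈ Set.Icc (0 : ℝ) 1) : xi w x y ≤ x := by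
  apply xi_le hw
  nlinarith [mul_nonneg hx.1 (sub_nonneg.mpr hy.2)]

lemma xi_le_right {w x y : ℝ} (hw : 0 < w) (hx : x ∈ Set.Icc (0 : ℝ) 1)
    (hy : y ∈ Set.Icc (0 : ℝ) 1) : xi w x y ≤ y :=
  xi_comm w x y ▸ xi_le_left hw hy hx

lemma xi_nonneg {w x y : ℝ} (hw : 0 < w) (hx : x ∈ Set.Icc (0 : ℝ) 1)
    (hy : y ∈ Set.Icc (0 : ℝ) 1) : 0 ≤ xi w x y := by
  apply le_xi hw
  · have := mul_nonneg hx.1 hy.1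
    simp only [sub_zero, zero_mul]; positivity
  · linarith [hx.1, hy.1]

lemma add_sub_one_le_xi {w x y : ℝ} (hw : 0 < w) (hx : x ∈ Set.Icc (0 : ℝ) 1)
    (hy : y ∈ Set.Icc (0 : ℝ) 1) : x + y - 1 ≤ xi w x y := by
  apply le_xi hw
  · have : 0 ≤ (1 - x) * (1 - y) := mul_nonneg (sub_nonneg.mpr hx.2) (sub_nonneg.mpr hy.2)
    nlinarith [mul_nonneg (Real.exp_pos w).le this]
  · linarith [hx.2, hy.2]

/-- Raising y to y' increases the quadratic at the old root by (y' - y)(e^w (x - ξ) + ξ) ≥ 0, so the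
old root still lies below the new one. -/
lemma xi_mono_right {w x y y' : ℝ} (hw : 0 < w) (hx : x ∈ Set.Icc (0 : ℝ) 1)
    (hy : y ∈ Set.Icc (0 : ℝ) 1) (hyy' : y ≤ y') :
    xi w x y ≤ xi w x y' := by
  have hr := xi_root hw hx hy
  have h1 := xi_le_left hw hx hy
  have h2 := xi_le_right hw hx hy
  have h3 := xi_nonneg hw hx hy
  apply le_xi hw
  · have h4 : 0 ≤ (y' - y) * (Real.exp w * (x - xi w x y) + xi w x y) :=
      mul_nonneg (by linarith) (add_nonneg (mul_nonneg (Real.exp_pos w).le (by linarith)) h3)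
    linarith
  · linarith

lemma xi_zero_right {w x : ℝ} (hw : 0 < w) (hx : x ∈ Set.Icc (0 : ℝ) 1) : xi w x 0 = 0 :=
  le_antisymm (xi_le_right hw hx (by simp)) (xi_nonneg hw hx (by simp))

lemma xi_one_right {w x : ℝ} (hw : 0 < w) (hx : x ∈ Set.Icc (0 : ℝ) 1) : xi w x 1 = x :=
  le_antisymm (xi_le_left hw hx (by simp)) (by simpa using add_sub_one_le_xi hw hx (y := 1) (by simp))

/-- For interior marginals the optimal pairwise marginal has positive entries. -/
lemma xi_interior {w x y : ℝ} (hw : 0 < w) (hx : x ∈ Set.Ioo (0 : ℝ) 1)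
    (hy : y ∈ Set.Ioo (0 : ℝ) 1) :
    0 < xi w x y ∧ xi w x y < x ∧ xi w x y < y ∧ 0 < 1 + xi w x y - x - y := by
  have hx' := Set.Ioo_subset_Icc_self hx
  have hy' := Set.Ioo_subset_Icc_self hy
  have hr := xi_root hw hx' hy'
  have h1 := xi_le_left hw hx' hy'
  have h2 := xi_le_right hw hx' hy'
  have h3 := xi_nonneg hw hx' hy'
  have h4 := add_sub_one_le_xi hw hx' hy'
  have hE := Real.exp_pos w
  generalize xi w x y = z at *
  refine ⟨lt_of_le_of_ne h3 ?_, lt_of_le_of_ne h1 ?_, lt_of_le_of_ne h2 ?_,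
    lt_of_le_of_ne (by linarith) ?_⟩
  · rintro rfl
    have := mul_pos hE (mul_pos hx.1 hy.1)
    simp at hr
    rcases hr with hr | hr <;> linarith [hx.1, hy.1]
  · rintro rfl
    have := mul_pos hx.1 (sub_pos.mpr hy.2)
    simp at hr
    rcases hr with hr | hr <;> linarith [hx.1, hy.2]
  · rintro rfl
    have := mul_pos hy.1 (sub_pos.mpr hx.2)
    simp at hr
    rcases hr with hr | hr <;> linarith [hy.1, hx.2]
  · intro h
    rw [← h] at hr
    have : 0 < (1 - y) * (1 - x) := mul_pos (sub_pos.mpr hy.2) (sub_pos.mpr hx.2)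
    have h5 : x - z = 1 - y := by linarith
    have h6 : y - z = 1 - x := by linarith
    rw [h5, h6] at hr
    have := mul_pos hE this
    linarith

/-! ### The edge cost as a function of one marginal: continuity, derivative, monotonicity -/

lemma continuous_xi (w y : ℝ) : Continuous fun x => xi w x y := by
  unfold xi; fun_prop

lemma pairEntropy_pairMarginal (x y z : ℝ) :
    pairEntropy (pairMarginal x y z) = Real.negMulLog (1 + z - x - y) + Real.negMulLog (y - z) +
      (Real.negMulLog (x - z) + Real.negMulLog z) := by
  simp [pairEntropy, pairMarginal, Fin.sum_univ_two]

lemma edgeCost_comm (w x y : ℝ) : edgeCost w x y = edgeCost w y x := by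
  simp only [edgeCost, xi_comm w y x, pairEntropy_pairMarginal]
  rw [show 1 + xi w x y - y - x = 1 + xi w x y - x - y by ring]
  ring

lemma continuous_edgeCost (w y : ℝ) : Continuous fun x => edgeCost w x y := by
  have := continuous_xi w y
  have h := Real.continuous_negMulLog
  simp only [edgeCost, pairEntropy_pairMarginal]
  fun_prop

lemma binEntropy_eq (x : ℝ) : Real.binEntropy x = Real.negMulLog x + Real.negMulLog (1 - x) := by
  simp only [Real.binEntropy, Real.negMulLog, Real.log_inv]
  ring

lemma edgeCost_zero_right {w x : ℝ} (hw : 0 < w) (hx : x ∈ Set.Icc (0 : ℝ) 1) :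
    edgeCost w x 0 = -Real.binEntropy x := by
  simp [edgeCost, pairEntropy_pairMarginal, xi_zero_right hw hx, binEntropy_eq, add_comm]

lemma edgeCost_one_right {w x : ℝ} (hw : 0 < w) (hx : x ∈ Set.Icc (0 : ℝ) 1) :
    edgeCost w x 1 = -(w * x) - Real.binEntropy x := by
  simp [edgeCost, pairEntropy_pairMarginal, xi_one_right hw hx, binEntropy_eq, add_comm]

lemma differentiableAt_xi {w x y : ℝ} (hw : 0 < w) (hx : x ∈ Set.Icc (0 : ℝ) 1)
    (hy : y ∈ Set.Icc (0 : ℝ) 1) : DifferentiableAt ℝ (fun x => xi w x y) x := by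
  have hd := one_le_disc hw hx hy
  unfold xi
  refine DifferentiableAt.div_const (DifferentiableAt.sub (by fun_prop) ?_) _
  exact DifferentiableAt.sqrt (by fun_prop) (by linarith)

/-- The derivative of the edge cost, including the boundary values `0` and `1` of the second
argument. -/
lemma hasDerivAt_edgeCost {w x y : ℝ} (hw : 0 < w) (hx : x ∈ Set.Ioo (0 : ℝ) 1)
    (hy : y ∈ Set.Icc (0 : ℝ) 1) :
    HasDerivAt (fun x => edgeCost w x y)
      (Real.log (x - (1 - Real.exp (-w)) * xi w x y) - Real.log (1 - x)) x := by
  have hx' := Set.Ioo_subset_Icc_self hx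
  have hnhds : ∀ᶠ z in nhds x, z ∈ Set.Icc (0 : ℝ) 1 := Icc_mem_nhds hx.1 hx.2
  have hS := (Real.hasDerivAt_binEntropy hx.1.ne' hx.2.ne).neg
  -- For y = 0 or y = 1 some table entries vanish identically near x and the chain rule through
  -- `negMulLog` breaks down. The edge cost is then explicit, and its derivative agrees with the
  -- general formula.
  rcases eq_or_lt_of_le hy.1 with rfl | hy0
  · rw [xi_zero_right hw hx']
    refine HasDerivAt.congr_of_eventuallyEq (f := -Real.binEntropy) ?_
      (hnhds.mono fun z hz => edgeCost_zero_right hw hz)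
    exact hS.congr_deriv (by simp)
  rcases eq_or_lt_of_le hy.2 with rfl | hy1
  · rw [xi_one_right hw hx']
    have h2 : HasDerivAt (fun z => -(w * z) - Real.binEntropy z)
        (-(w * 1) - (Real.log (1 - x) - Real.log x)) x :=
      ((hasDerivAt_id x).const_mul w).neg.sub (Real.hasDerivAt_binEntropy hx.1.ne' hx.2.ne)
    refine HasDerivAt.congr_of_eventuallyEq (h2.congr_deriv ?_)
      (hnhds.mono fun z hz => edgeCost_one_right hw hz)
    rw [show x - (1 - Real.exp (-w)) * x = Real.exp (-w) * x by ring,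
      Real.log_mul (Real.exp_pos _).ne' hx.1.ne', Real.log_exp]
    ring
  obtain ⟨h0, h1, h2, h3⟩ := xi_interior hw hx ⟨hy0, hy1⟩
  have hr := xi_root hw hx' hy
  have hz := (differentiableAt_xi hw hx' hy).hasDerivAt
  set z' := deriv (fun x => xi w x y) x
  have e00 := (Real.hasDerivAt_negMulLog h3.ne').comp x
    (((hz.const_add 1).sub (hasDerivAt_id x)).sub_const y)
  have e01 := (Real.hasDerivAt_negMulLog (sub_pos.mpr h2).ne').comp x (hz.const_sub y)
  have e10 := (Real.hasDerivAt_negMulLog (sub_pos.mpr h1).ne').comp x ((hasDerivAt_id x).sub hz)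
  have e11 := (Real.hasDerivAt_negMulLog h0.ne').comp x hz
  have key := (hz.const_mul w).neg.sub ((e00.add e01).add (e10.add e11))
  have hfun : (fun x => edgeCost w x y) =
      fun x => -(w * xi w x y) - (Real.negMulLog (1 + xi w x y - x - y) +
        Real.negMulLog (y - xi w x y) + (Real.negMulLog (x - xi w x y) +
        Real.negMulLog (xi w x y))) := by
    funext x; rw [edgeCost, pairEntropy_pairMarginal]
  rw [hfun]
  refine HasDerivAt.congr_deriv key ?_
  have hlog := congrArg Real.log hr
  rw [Real.log_mul h0.ne' h3.ne', Real.log_mul (Real.exp_pos w).ne'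
    (mul_pos (sub_pos.mpr h1) (sub_pos.mpr h2)).ne', Real.log_exp,
    Real.log_mul (sub_pos.mpr h1).ne' (sub_pos.mpr h2).ne'] at hlog
  have hE : Real.exp (-w) * Real.exp w = 1 := by rw [← Real.exp_add]; simp
  -- With entries μ: e^{-w} μ11 μ00 = μ10 μ01, so (μ10 + e^{-w} μ11) μ00 = μ10 (μ00 + μ01) = μ10 (1
  -- - x).
  have hid : (x - (1 - Real.exp (-w)) * xi w x y) * (1 + xi w x y - x - y) =
      (x - xi w x y) * (1 - x) := by
    linear_combination Real.exp (-w) * hr + ((x - xi w x y) * (y - xi w x y)) * hE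
  have hpos : 0 < x - (1 - Real.exp (-w)) * xi w x y := by
    have := mul_pos (Real.exp_pos (-w)) h0
    linarith
  have hlog2 := congrArg Real.log hid
  rw [Real.log_mul hpos.ne' h3.ne', Real.log_mul (sub_pos.mpr h1).ne'
    (sub_pos.mpr hx.2).ne'] at hlog2
  -- The stationarity condition `hlog` cancels every term with the derivative of ξ, and `hlog2`
  -- simplifies what remains.
  linear_combination z' * hlog - hlog2

/-- This is 0 ≤ ξ ≤ x. After taking logarithms it places the derivative of edge cost plus entropy in
[-w, 0]. -/
lemma sub_mul_xi_bounds {w x y : ℝ} (hw : 0 < w) (hx : x ∈ Set.Icc (0 : ℝ) 1)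
    (hy : y ∈ Set.Icc (0 : ℝ) 1) :
    Real.exp (-w) * x ≤ x - (1 - Real.exp (-w)) * xi w x y ∧
      x - (1 - Real.exp (-w)) * xi w x y ≤ x := by
  have hb : 0 ≤ 1 - Real.exp (-w) := by
    rw [sub_nonneg, Real.exp_le_one_iff]; linarith
  have h1 := mul_le_mul_of_nonneg_left (xi_le_left hw hx hy) hb
  have h2 := mul_nonneg hb (xi_nonneg hw hx hy)
  constructor <;> linarith

/-- The edge cost has decreasing differences. -/
lemma edgeCost_decreasing_differences {w x x' y y' : ℝ} (hw : 0 < w)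
    (hx : x ∈ Set.Icc (0 : ℝ) 1) (hx' : x' ∈ Set.Icc (0 : ℝ) 1) (hy : y ∈ Set.Icc (0 : ℝ) 1)
    (hy' : y' ∈ Set.Icc (0 : ℝ) 1) (hxx : x ≤ x') (hyy : y ≤ y') :
    edgeCost w x y + edgeCost w x' y' ≤ edgeCost w x y' + edgeCost w x' y := by
  -- In the derivative of the difference the log(1 - x) terms cancel, and only the dependence of ξ
  -- on y is left, which `xi_mono_right` controls.
  have hanti : AntitoneOn (fun x => edgeCost w x y' - edgeCost w x y) (Set.Icc 0 1) := by
    refine antitoneOn_of_hasDerivWithinAt_nonpos (f' := fun z =>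
      (Real.log (z - (1 - Real.exp (-w)) * xi w z y') - Real.log (1 - z)) -
        (Real.log (z - (1 - Real.exp (-w)) * xi w z y) - Real.log (1 - z)))
      (convex_Icc 0 1)
      ((continuous_edgeCost w y').sub (continuous_edgeCost w y)).continuousOn
      (fun z hz => ?_) (fun z hz => ?_)
    · rw [interior_Icc] at hz
      exact ((hasDerivAt_edgeCost hw hz hy').sub (hasDerivAt_edgeCost hw hz hy)).hasDerivWithinAt
    · rw [interior_Icc] at hz
      have hz' := Set.Ioo_subset_Icc_self hz
      have hb : 0 ≤ 1 - Real.exp (-w) := by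
        rw [sub_nonneg, Real.exp_le_one_iff]; linarith
      have hpos := mul_pos (Real.exp_pos (-w)) hz.1
      have := Real.log_le_log (hpos.trans_le (sub_mul_xi_bounds hw hz' hy').1)
        (sub_le_sub_left (mul_le_mul_of_nonneg_left (xi_mono_right hw hz' hy hyy) hb) z)
      linarith
  have := hanti hx hx' hxx
  simp only at this
  linarith

lemma edgeCost_submodularOn {w : ℝ} (hw : 0 < w) {A B : Finset ℝ}
    (hA : ∀ x ∈ A, x ∈ Set.Icc (0 : ℝ) 1) (hB : ∀ x ∈ B, x ∈ Set.Icc (0 : ℝ) 1) :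
    SubmodularOn (edgeCost w) A B := by
  intro x hx x' hx' y hy y' hy'
  rcases le_total x x' with h1 | h1 <;> rcases le_total y y' with h2 | h2 <;>
    simp only [min_eq_left, min_eq_right, max_eq_left, max_eq_right, h1, h2, le_refl]
  · exact edgeCost_decreasing_differences hw (hA _ hx) (hA _ hx') (hB _ hy') (hB _ hy) h1 h2
  · have := edgeCost_decreasing_differences hw (hA _ hx') (hA _ hx) (hB _ hy) (hB _ hy') h1 h2
    linarith
  · linarith

theorem Attractive.submodularMesh {n m : ℕ} {M : BinaryMRF n m} (hM : M.Attractive)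
    {𝓜 : Fin n → Finset ℝ} (h𝓜 : ∀ i, ∀ x ∈ 𝓜 i, x ∈ Set.Icc (0 : ℝ) 1) : M.SubmodularMesh 𝓜 :=
  fun e => edgeCost_submodularOn (hM e) (h𝓜 _) (h𝓜 _)

/-- The entropy contributes log(1 - x) - log x, so the derivative is log((x - (1 - e^{-w}) ξ) / x) ≤
0. The companion lemma below gives the lower bound -w. Both are stated as monotonicity on the closed
interval, so the endpoints need no derivative. -/
lemma edgeCost_add_binEntropy_antitone {w y : ℝ} (hw : 0 < w) (hy : y ∈ Set.Icc (0 : ℝ) 1) :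
    AntitoneOn (fun x => edgeCost w x y + Real.binEntropy x) (Set.Icc 0 1) := by
  refine antitoneOn_of_hasDerivWithinAt_nonpos (f' := fun z =>
      (Real.log (z - (1 - Real.exp (-w)) * xi w z y) - Real.log (1 - z)) +
        (Real.log (1 - z) - Real.log z))
      (convex_Icc 0 1)
    ((continuous_edgeCost w y).add Real.binEntropy_continuous).continuousOn
    (fun z hz => ?_) (fun z hz => ?_)
  · rw [interior_Icc] at hz
    exact ((hasDerivAt_edgeCost hw hz hy).add
      (Real.hasDerivAt_binEntropy hz.1.ne' hz.2.ne)).hasDerivWithinAt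
  · rw [interior_Icc] at hz
    have hz' := Set.Ioo_subset_Icc_self hz
    have hb := sub_mul_xi_bounds hw hz' hy
    have := Real.log_le_log ((mul_pos (Real.exp_pos (-w)) hz.1).trans_le hb.1) hb.2
    linarith

lemma edgeCost_add_binEntropy_add_monotone {w y : ℝ} (hw : 0 < w)
    (hy : y ∈ Set.Icc (0 : ℝ) 1) :
    MonotoneOn (fun x => edgeCost w x y + Real.binEntropy x + w * x) (Set.Icc 0 1) := by
  refine monotoneOn_of_hasDerivWithinAt_nonneg (f' := fun z =>
      (Real.log (z - (1 - Real.exp (-w)) * xi w z y) - Real.log (1 - z)) +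
        (Real.log (1 - z) - Real.log z) + w * 1)
      (convex_Icc 0 1)
    (((continuous_edgeCost w y).add Real.binEntropy_continuous).add
      (continuous_const.mul continuous_id)).continuousOn
    (fun z hz => ?_) (fun z hz => ?_)
  · rw [interior_Icc] at hz
    exact (((hasDerivAt_edgeCost hw hz hy).add
      (Real.hasDerivAt_binEntropy hz.1.ne' hz.2.ne)).add
      ((hasDerivAt_id z).const_mul w)).hasDerivWithinAt
  · rw [interior_Icc] at hz
    have hz' := Set.Ioo_subset_Icc_self hz
    have hb := sub_mul_xi_bounds hw hz' hy
    have := Real.log_le_log (mul_pos (Real.exp_pos (-w)) hz.1) hb.1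
    rw [Real.log_mul (Real.exp_pos _).ne' hz.1.ne', Real.log_exp] at this
    linarith

/-- Gibbs' inequality, termwise. -/
lemma negMulLog_le {a b : ℝ} (ha : 0 ≤ a) (hb : 0 < b) :
    Real.negMulLog a ≤ -(a * Real.log b) + b - a := by
  rcases eq_or_lt_of_le ha with rfl | ha
  · simpa using hb.le
  have h := Real.log_le_sub_one_of_pos (div_pos hb ha)
  rw [Real.log_div hb.ne' ha.ne'] at h
  have h2 := mul_le_mul_of_nonneg_left h ha.le
  have h3 : a * (b / a - 1) = b - a := by field_simp
  rw [Real.negMulLog]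
  linarith

/-- `xi` minimizes the pairwise part of the Bethe free energy. -/
lemma edgeCost_le {w x y z : ℝ} (hw : 0 < w) (hx : x ∈ Set.Icc (0 : ℝ) 1)
    (hy : y ∈ Set.Icc (0 : ℝ) 1) (h11 : 0 ≤ z) (h10 : z ≤ x) (h01 : z ≤ y)
    (h00 : 0 ≤ 1 + z - x - y) :
    edgeCost w x y ≤ -(w * z) - pairEntropy (pairMarginal x y z) := by
  have b1 := xi_le_left hw hx hy
  have b2 := xi_le_right hw hx hy
  have b3 := xi_nonneg hw hx hy
  have b4 := add_sub_one_le_xi hw hx hy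
  by_cases hxy : x ∈ Set.Ioo (0 : ℝ) 1 ∧ y ∈ Set.Ioo (0 : ℝ) 1
  · obtain ⟨h0, h1, h2, h3⟩ := xi_interior hw hxy.1 hxy.2
    have hr := xi_root hw hx hy
    have hlog := congrArg Real.log hr
    rw [Real.log_mul h0.ne' h3.ne', Real.log_mul (Real.exp_pos w).ne'
      (mul_pos (sub_pos.mpr h1) (sub_pos.mpr h2)).ne', Real.log_exp,
      Real.log_mul (sub_pos.mpr h1).ne' (sub_pos.mpr h2).ne'] at hlog
    have g1 := negMulLog_le h00 h3
    have g2 := negMulLog_le (sub_nonneg.mpr h01) (sub_pos.mpr h2)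
    have g3 := negMulLog_le (sub_nonneg.mpr h10) (sub_pos.mpr h1)
    have g4 := negMulLog_le h11 h0
    rw [edgeCost, pairEntropy_pairMarginal, pairEntropy_pairMarginal]
    simp only [Real.negMulLog] at g1 g2 g3 g4 ⊢
    -- The differences b - a in Gibbs' inequality sum to 0 because both tables have mass 1. The
    -- tables differ by (z - ξ) times the sign pattern +, -, -, +, so the cross-entropy terms differ
    -- by a multiple of the log odds ratio, which is w.
    linear_combination g1 + g2 + g3 + g4 + (xi w x y - z) * hlog
  -- If a marginal is 0 or 1, the table is determined by its marginals: two different admissible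
  -- values of the (1,1) entry would force both marginals into the open interval.
  · have hz : z = xi w x y := by
      by_contra hne
      apply hxy
      rcases lt_or_gt_of_ne hne with h | h
      · exact ⟨⟨by linarith, by linarith⟩, ⟨by linarith, by linarith⟩⟩
      · exact ⟨⟨by linarith, by linarith⟩, ⟨by linarith, by linarith⟩⟩
    rw [edgeCost, hz]

/-! ### The free energy in one coordinate -/

/-- The part `-θ t - S(t)` of the free energy that belongs to one variable. -/
noncomputable def unaryCost (θ t : ℝ) : ℝ := -(θ * t) - Real.binEntropy t

/-- The edge cost together with the entropies of the two endpoints. -/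
noncomputable def pairCost (w x y : ℝ) : ℝ := edgeCost w x y + Real.binEntropy x + Real.binEntropy y

lemma pairCost_comm (w x y : ℝ) : pairCost w x y = pairCost w y x := by
  rw [pairCost, pairCost, edgeCost_comm]; ring

lemma unaryCost_hasDerivAt {θ t : ℝ} (ht : t ∈ Set.Ioo (0 : ℝ) 1) :
    HasDerivAt (unaryCost θ) (-θ - (Real.log (1 - t) - Real.log t)) t := by
  have := ((hasDerivAt_id t).const_mul θ).neg.sub (Real.hasDerivAt_binEntropy ht.1.ne' ht.2.ne)
  exact HasDerivAt.congr_deriv this (by simp)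

lemma continuous_unaryCost (θ : ℝ) : Continuous (unaryCost θ) :=
  (continuous_const.mul continuous_id).neg.sub Real.binEntropy_continuous

/-- The derivative is logit(t) - θ, which changes sign at the sigmoid of θ. This is where the ends
of the Bethe box come from. -/
lemma unaryCost_antitoneOn (θ : ℝ) : AntitoneOn (unaryCost θ) (Set.Icc 0 (Real.sigmoid θ)) := by
  refine antitoneOn_of_hasDerivWithinAt_nonpos
    (f' := fun t => -θ - (Real.log (1 - t) - Real.log t)) (convex_Icc _ _)
    (continuous_unaryCost θ).continuousOn (fun t ht => ?_) (fun t ht => ?_) <;>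
  rw [interior_Icc] at ht
  · exact (unaryCost_hasDerivAt ⟨ht.1, ht.2.trans (Real.sigmoid_lt_one θ)⟩).hasDerivWithinAt
  · have h1 : t * (1 + Real.exp (-θ)) < 1 := by
      have := ht.2
      rwa [Real.sigmoid_def, lt_inv_comm₀ ht.1 (by positivity), ← one_div, lt_div_iff₀ ht.1,
        mul_comm] at this
    have := Real.log_le_log (mul_pos ht.1 (Real.exp_pos (-θ)))
      (show t * Real.exp (-θ) ≤ 1 - t by linarith)
    rw [Real.log_mul ht.1.ne' (Real.exp_pos _).ne', Real.log_exp] at this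
    linarith

lemma unaryCost_monotoneOn (θ : ℝ) : MonotoneOn (unaryCost θ) (Set.Icc (Real.sigmoid θ) 1) := by
  refine monotoneOn_of_hasDerivWithinAt_nonneg
    (f' := fun t => -θ - (Real.log (1 - t) - Real.log t)) (convex_Icc _ _)
    (continuous_unaryCost θ).continuousOn (fun t ht => ?_) (fun t ht => ?_) <;>
  rw [interior_Icc] at ht
  · exact (unaryCost_hasDerivAt ⟨(Real.sigmoid_pos θ).trans ht.1, ht.2⟩).hasDerivWithinAt
  · have h0 := (Real.sigmoid_pos θ).trans ht.1
    have h1 : 1 < t * (1 + Real.exp (-θ)) := by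
      have := ht.1
      rwa [Real.sigmoid_def, inv_lt_iff_one_lt_mul₀ (by positivity)] at this
    have := Real.log_le_log (sub_pos.mpr ht.2)
      (show 1 - t ≤ t * Real.exp (-θ) by linarith)
    rw [Real.log_mul h0.ne' (Real.exp_pos _).ne', Real.log_exp] at this
    linarith

variable {n m : ℕ} (M : BinaryMRF n m)

lemma sum_incident (i : Fin n) (g : Fin m → ℝ) :
    ∑ e ∈ M.incident i, g e =
      ∑ e, ((if M.src e = i then g e else 0) + (if M.tgt e = i then g e else 0)) := by
  rw [incident, Finset.sum_filter]
  refine Finset.sum_congr rfl fun e _ => ?_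
  have := (M.src_lt_tgt e).ne
  by_cases h1 : M.src e = i <;> by_cases h2 : M.tgt e = i <;> simp_all

/-- Double counting of incidences. It serves for distributing the entropies over the edges and for
the sum of the D_i, which is twice the total weight. -/
lemma sum_sum_incident (g : Fin m → ℝ) (h : Fin n → ℝ) :
    ∑ i, (∑ e ∈ M.incident i, g e) * h i = ∑ e, g e * (h (M.src e) + h (M.tgt e)) := by
  simp only [sum_incident, Finset.sum_mul]
  rw [Finset.sum_comm]
  refine Finset.sum_congr rfl fun e _ => ?_
  simp only [add_mul, ite_mul, zero_mul, Finset.sum_add_distrib, Finset.sum_ite_eq,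
    Finset.mem_univ, if_true, mul_add]

/-- The free energy as a sum of costs of edges and costs of variables. -/
lemma freeEnergy_eq (q : Fin n → ℝ) :
    M.freeEnergy q = (∑ e, pairCost (M.W e) (q (M.src e)) (q (M.tgt e))) +
      ∑ i, unaryCost (M.θ i) (q i) := by
  have h := M.sum_sum_incident (fun _ => 1) fun i => Real.binEntropy (q i)
  simp only [Finset.sum_const, nsmul_eq_mul, mul_one, one_mul] at h
  simp only [freeEnergy, pairCost, unaryCost, degree, sub_mul, one_mul, Finset.sum_add_distrib,
    Finset.sum_sub_distrib] at h ⊢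
  linarith

variable {M}

lemma pairCost_le_of_le {w x x' y : ℝ} (hw : 0 < w) (hx : x ∈ Set.Icc (0 : ℝ) 1)
    (hx' : x' ∈ Set.Icc (0 : ℝ) 1) (hy : y ∈ Set.Icc (0 : ℝ) 1) (h : x ≤ x') :
    pairCost w x' y ≤ pairCost w x y := by
  have := edgeCost_add_binEntropy_antitone hw hy hx hx' h
  simp only [pairCost] at this ⊢
  linarith

lemma pairCost_add_le_of_le {w x x' y : ℝ} (hw : 0 < w) (hx : x ∈ Set.Icc (0 : ℝ) 1)
    (hx' : x' ∈ Set.Icc (0 : ℝ) 1) (hy : y ∈ Set.Icc (0 : ℝ) 1) (h : x ≤ x') :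
    pairCost w x y - w * (x' - x) ≤ pairCost w x' y := by
  have := edgeCost_add_binEntropy_add_monotone hw hy hx hx' h
  simp only [pairCost] at this ⊢
  linarith

lemma sum_unaryCost_update (q : Fin n → ℝ) (i : Fin n) (t t' : ℝ) :
    ∑ j, unaryCost (M.θ j) (Function.update q i t' j) -
      ∑ j, unaryCost (M.θ j) (Function.update q i t j) =
      unaryCost (M.θ i) t' - unaryCost (M.θ i) t := by
  rw [← Finset.sum_sub_distrib, Finset.sum_eq_single i]
  · simp
  · intro j _ hj; simp [Function.update_of_ne hj]
  · simp

lemma Attractive.posWeight_eq (hM : M.Attractive) (i : Fin n) :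
    M.posWeight i = ∑ e ∈ M.incident i, M.W e :=
  Finset.sum_congr rfl fun e _ => max_eq_left (hM e).le

lemma Attractive.negWeight_eq (hM : M.Attractive) (i : Fin n) : M.negWeight i = 0 :=
  Finset.sum_eq_zero fun e _ => max_eq_right (by linarith [hM e])

lemma Attractive.derivBound_eq (hM : M.Attractive) (i : Fin n) :
    M.derivBound i = ∑ e ∈ M.incident i, M.W e := by
  rw [derivBound, hM.negWeight_eq, hM.posWeight_eq, zero_add]

lemma Attractive.boxLower_eq (hM : M.Attractive) (i : Fin n) :
    M.boxLower i = Real.sigmoid (M.θ i) := by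
  rw [boxLower, hM.negWeight_eq, sub_zero]

lemma Attractive.boxUpper_eq (hM : M.Attractive) (i : Fin n) :
    M.boxUpper i = Real.sigmoid (M.θ i + M.derivBound i) := by
  rw [boxUpper, derivBound, hM.negWeight_eq, zero_add]

lemma Attractive.derivBound_nonneg (hM : M.Attractive) (i : Fin n) : 0 ≤ M.derivBound i := by
  rw [hM.derivBound_eq]; exact Finset.sum_nonneg fun e _ => (hM e).le

/-- Together with `Attractive.le_update` this replaces the bounds on the i-th partial derivative by
finite differences: raising a coordinate lowers the pair costs by an amount between 0 and D_i (t' -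
t). No differentiability of the free energy on the boundary of the cube is needed. -/
lemma Attractive.update_le (hM : M.Attractive) {q : Fin n → ℝ}
    (hq : ∀ i, q i ∈ Set.Icc (0 : ℝ) 1) (i : Fin n) {t t' : ℝ} (ht : t ∈ Set.Icc (0 : ℝ) 1)
    (ht' : t' ∈ Set.Icc (0 : ℝ) 1) (h : t ≤ t') :
    M.freeEnergy (Function.update q i t') - M.freeEnergy (Function.update q i t) ≤
      unaryCost (M.θ i) t' - unaryCost (M.θ i) t := by
  rw [← sum_unaryCost_update q, freeEnergy_eq, freeEnergy_eq]
  have : ∀ e, pairCost (M.W e) (Function.update q i t' (M.src e))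
      (Function.update q i t' (M.tgt e)) ≤ pairCost (M.W e) (Function.update q i t (M.src e))
      (Function.update q i t (M.tgt e)) := by
    intro e
    have hne := (M.src_lt_tgt e).ne
    by_cases h1 : M.src e = i
    · have h2 : M.tgt e ≠ i := fun h => hne (h1.trans h.symm)
      simp only [h1, Function.update_self, Function.update_of_ne h2]
      exact pairCost_le_of_le (hM e) ht ht' (hq _) h
    · by_cases h2 : M.tgt e = i
      · simp only [h2, Function.update_self, Function.update_of_ne h1]
        rw [pairCost_comm, pairCost_comm _ _ t]
        exact pairCost_le_of_le (hM e) ht ht' (hq _) h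
      · simp only [Function.update_of_ne h1, Function.update_of_ne h2, le_refl]
  have := Finset.sum_le_sum fun e (_ : e ∈ Finset.univ) => this e
  linarith

lemma Attractive.le_update (hM : M.Attractive) {q : Fin n → ℝ}
    (hq : ∀ i, q i ∈ Set.Icc (0 : ℝ) 1) (i : Fin n) {t t' : ℝ} (ht : t ∈ Set.Icc (0 : ℝ) 1)
    (ht' : t' ∈ Set.Icc (0 : ℝ) 1) (h : t ≤ t') :
    unaryCost (M.θ i) t' - unaryCost (M.θ i) t - M.derivBound i * (t' - t) ≤
    M.freeEnergy (Function.update q i t') - M.freeEnergy (Function.update q i t) := by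
  rw [← sum_unaryCost_update q, freeEnergy_eq, freeEnergy_eq, hM.derivBound_eq, sum_incident,
    Finset.sum_mul]
  have : ∀ e, pairCost (M.W e) (Function.update q i t (M.src e))
      (Function.update q i t (M.tgt e)) - ((if M.src e = i then M.W e else 0) +
        (if M.tgt e = i then M.W e else 0)) * (t' - t) ≤
      pairCost (M.W e) (Function.update q i t' (M.src e))
      (Function.update q i t' (M.tgt e)) := by
    intro e
    have hne := (M.src_lt_tgt e).ne
    by_cases h1 : M.src e = i
    · have h2 : M.tgt e ≠ i := fun h => hne (h1.trans h.symm)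
      simp only [h1, Function.update_self, Function.update_of_ne h2, h2, if_true, if_false,
        add_zero]
      exact pairCost_add_le_of_le (hM e) ht ht' (hq _) h
    · by_cases h2 : M.tgt e = i
      · simp only [h2, h1, Function.update_self, Function.update_of_ne h1, if_true, if_false,
          zero_add]
        rw [pairCost_comm, pairCost_comm _ _ t']
        exact pairCost_add_le_of_le (hM e) ht ht' (hq _) h
      · simp [h1, h2]
  have := Finset.sum_le_sum fun e (_ : e ∈ Finset.univ) => this e
  rw [Finset.sum_sub_distrib] at this
  linarith

lemma boxLower_mem (i : Fin n) : M.boxLower i ∈ Set.Icc (0 : ℝ) 1 :=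
  ⟨(Real.sigmoid_pos _).le, Real.sigmoid_le_one _⟩

lemma boxUpper_mem (i : Fin n) : M.boxUpper i ∈ Set.Icc (0 : ℝ) 1 :=
  ⟨(Real.sigmoid_pos _).le, Real.sigmoid_le_one _⟩

lemma Attractive.boxLower_le_boxUpper (hM : M.Attractive) (i : Fin n) :
    M.boxLower i ≤ M.boxUpper i := by
  rw [hM.boxLower_eq, hM.boxUpper_eq]
  exact Real.sigmoid_le (by linarith [hM.derivBound_nonneg i])

/-- Moving a coordinate into the Bethe box does not increase the free energy. -/
lemma Attractive.clamp_le (hM : M.Attractive) {q : Fin n → ℝ}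
    (hq : ∀ i, q i ∈ Set.Icc (0 : ℝ) 1) (i : Fin n) :
    M.freeEnergy (Function.update q i (max (M.boxLower i) (min (M.boxUpper i) (q i)))) ≤
      M.freeEnergy q := by
  have hLU := hM.boxLower_le_boxUpper i
  have hL := M.boxLower_mem i
  have hU := M.boxUpper_mem i
  have hself : M.freeEnergy q = M.freeEnergy (Function.update q i (q i)) := by simp
  rw [hself]
  rcases le_total (q i) (M.boxLower i) with h | h
  · rw [min_eq_right (h.trans hLU), max_eq_left h]
    have h1 := hM.update_le hq i (hq i) hL h
    rw [hM.boxLower_eq] at *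
    have h2 := unaryCost_antitoneOn (M.θ i) ⟨(hq i).1, h⟩ ⟨hL.1, le_rfl⟩ h
    linarith
  rcases le_total (q i) (M.boxUpper i) with h' | h'
  · rw [min_eq_right h', max_eq_right h]
  · rw [min_eq_left h', max_eq_right hLU]
    have h1 := hM.le_update hq i hU (hq i) h'
    -- The term -D_i t is absorbed into the field: unary cost minus D_i t is the unary cost with
    -- field θ_i + D_i, whose minimum is at the upper end of the box.
    have h2 : unaryCost (M.θ i + M.derivBound i) (M.boxUpper i) ≤
        unaryCost (M.θ i + M.derivBound i) (q i) := by
      apply unaryCost_monotoneOn _ ⟨(hM.boxUpper_eq i).ge, hU.2⟩ ⟨?_, (hq i).2⟩ h'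
      rw [← hM.boxUpper_eq i]; exact h'
    simp only [unaryCost] at h1 h2
    linarith

/-- Inside the Bethe box the free energy is Lipschitz in each coordinate. -/
lemma Attractive.update_lipschitz (hM : M.Attractive) {q : Fin n → ℝ}
    (hq : ∀ i, q i ∈ Set.Icc (0 : ℝ) 1) (i : Fin n) {t t' : ℝ}
    (ht : t ∈ Set.Icc (M.boxLower i) (M.boxUpper i))
    (ht' : t' ∈ Set.Icc (M.boxLower i) (M.boxUpper i)) :
    M.freeEnergy (Function.update q i t') ≤
      M.freeEnergy (Function.update q i t) + M.derivBound i * |t' - t| := by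
  have hL := M.boxLower_mem i
  have hU := M.boxUpper_mem i
  rcases le_total t t' with h | h
  · have h1 := hM.update_le hq i ⟨hL.1.trans ht.1, ht.2.trans hU.2⟩
      ⟨hL.1.trans ht'.1, ht'.2.trans hU.2⟩ h
    have h2 : unaryCost (M.θ i + M.derivBound i) t' ≤ unaryCost (M.θ i + M.derivBound i) t := by
      have e := hM.boxUpper_eq i
      exact unaryCost_antitoneOn _ ⟨hL.1.trans ht.1, ht.2.trans e.le⟩
        ⟨hL.1.trans ht'.1, ht'.2.trans e.le⟩ h
    rw [abs_of_nonneg (sub_nonneg.mpr h)]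
    simp only [unaryCost] at h1 h2
    linarith
  · have h1 := hM.le_update hq i ⟨hL.1.trans ht'.1, ht'.2.trans hU.2⟩
      ⟨hL.1.trans ht.1, ht.2.trans hU.2⟩ h
    have h2 : unaryCost (M.θ i) t' ≤ unaryCost (M.θ i) t := by
      have e := hM.boxLower_eq i
      exact unaryCost_monotoneOn _ ⟨e.ge.trans ht'.1, ht'.2.trans hU.2⟩
        ⟨e.ge.trans ht.1, ht.2.trans hU.2⟩ h
    rw [abs_of_nonpos (sub_nonpos.mpr h)]
    linarith

/-! ### The simple mesh -/

variable (M) in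
/-- The `k`-th point of the simple mesh in dimension `i`. -/
noncomputable def meshPoint (ε : ℝ) (i : Fin n) (k : ℕ) : ℝ :=
  min (M.boxLower i + 2 * M.meshRadius ε i * k) (M.boxUpper i)

variable (M) in
/-- The number of intervals of the simple mesh in dimension `i`. -/
noncomputable def meshCount (ε : ℝ) (i : Fin n) : ℕ :=
  ⌈(M.boxUpper i - M.boxLower i) / (2 * M.meshRadius ε i)⌉₊

lemma simpleMesh_eq (ε : ℝ) (i : Fin n) :
    M.simpleMesh ε i = (Finset.range (1 + M.meshCount ε i)).image (M.meshPoint ε i) := rfl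

lemma meshRadius_pos {ε : ℝ} (hε : 0 < ε) {i : Fin n}
    (h : 0 < M.derivBound i) : 0 < M.meshRadius ε i := by
  have : 0 < n := i.pos
  rw [meshRadius]; positivity

/-- If D_i = 0, division by zero makes both the radius and the number of intervals 0, so the mesh is
the single point A_i, as it should be. -/
lemma Attractive.box_cases (hM : M.Attractive) {ε : ℝ} (hε : 0 < ε) (i : Fin n) :
    (M.derivBound i = 0 ∧ M.boxUpper i = M.boxLower i ∧ M.meshRadius ε i = 0 ∧
      M.meshCount ε i = 0) ∨
    (0 < M.derivBound i ∧ M.boxLower i < M.boxUpper i ∧ 0 < M.meshRadius ε i) := by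
  rcases eq_or_lt_of_le (hM.derivBound_nonneg i) with h | h
  · left
    have hr : M.meshRadius ε i = 0 := by simp [meshRadius, ← h]
    have hU : M.boxUpper i = M.boxLower i := by
      rw [hM.boxUpper_eq, hM.boxLower_eq, ← h, add_zero]
    exact ⟨h.symm, hU, hr, by simp [meshCount, hr]⟩
  · right
    refine ⟨h, ?_, meshRadius_pos hε h⟩
    rw [hM.boxLower_eq, hM.boxUpper_eq]
    exact Real.sigmoid_lt (by linarith)

lemma Attractive.meshPoint_zero (hM : M.Attractive) (ε : ℝ) (i : Fin n) :
    M.meshPoint ε i 0 = M.boxLower i := by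
  simp [meshPoint, hM.boxLower_le_boxUpper i]

lemma Attractive.meshPoint_of_le (hM : M.Attractive) {ε : ℝ} (hε : 0 < ε) {i : Fin n} {k : ℕ}
    (hk : M.meshCount ε i ≤ k) : M.meshPoint ε i k = M.boxUpper i := by
  rcases hM.box_cases hε i with ⟨_, h1, h2, _⟩ | ⟨_, _, h2⟩
  · simp [meshPoint, h1, h2]
  · rw [meshCount, Nat.ceil_le, div_le_iff₀ (by positivity)] at hk
    exact min_eq_right (by linarith)

lemma Attractive.meshPoint_of_lt (hM : M.Attractive) {ε : ℝ} (hε : 0 < ε) {i : Fin n} {k : ℕ}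
    (hk : k < M.meshCount ε i) :
    M.meshPoint ε i k = M.boxLower i + 2 * M.meshRadius ε i * k ∧
      M.meshPoint ε i k < M.boxUpper i := by
  rcases hM.box_cases hε i with ⟨_, _, _, h3⟩ | ⟨_, _, h2⟩
  · omega
  · rw [meshCount, Nat.lt_ceil, lt_div_iff₀ (by positivity)] at hk
    have : M.boxLower i + 2 * M.meshRadius ε i * k < M.boxUpper i := by linarith
    rw [meshPoint, min_eq_left this.le]
    exact ⟨rfl, this⟩

lemma Attractive.meshPoint_strictMono (hM : M.Attractive) {ε : ℝ} (hε : 0 < ε) {i : Fin n}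
    {k k' : ℕ} (h : k < k') (hk' : k' ≤ M.meshCount ε i) :
    M.meshPoint ε i k < M.meshPoint ε i k' := by
  rcases hk'.lt_or_eq with h1 | rfl
  · rcases hM.box_cases hε i with ⟨_, _, _, h3⟩ | ⟨_, _, h2⟩
    · omega
    rw [(hM.meshPoint_of_lt hε (h.trans h1)).1, (hM.meshPoint_of_lt hε h1).1]
    have : (k : ℝ) < k' := by exact_mod_cast h
    gcongr
  · rw [hM.meshPoint_of_le hε le_rfl]
    exact (hM.meshPoint_of_lt hε h).2

lemma Attractive.meshPoint_mem_box (hM : M.Attractive) {ε : ℝ} (hε : 0 < ε) (i : Fin n) (k : ℕ) :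
    M.meshPoint ε i k ∈ Set.Icc (M.boxLower i) (M.boxUpper i) := by
  refine ⟨le_min ?_ (hM.boxLower_le_boxUpper i), min_le_right _ _⟩
  rcases hM.box_cases hε i with ⟨_, _, h, _⟩ | ⟨_, _, h⟩
  · simp [h]
  · have : 0 ≤ 2 * M.meshRadius ε i * k := by positivity
    linarith

lemma Attractive.meshPoint_mem (hM : M.Attractive) {ε : ℝ} (hε : 0 < ε) (i : Fin n) (k : ℕ) :
    M.meshPoint ε i k ∈ M.simpleMesh ε i := by
  rw [simpleMesh_eq, Finset.mem_image]
  rcases lt_or_ge k (M.meshCount ε i) with h | h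
  · exact ⟨k, by simp; omega, rfl⟩
  · exact ⟨M.meshCount ε i, by simp, by
      rw [hM.meshPoint_of_le hε h, hM.meshPoint_of_le hε le_rfl]⟩

lemma Attractive.card_simpleMesh (hM : M.Attractive) {ε : ℝ} (hε : 0 < ε) (i : Fin n) :
    (M.simpleMesh ε i).card = 1 + M.meshCount ε i := by
  rw [simpleMesh_eq, Finset.card_image_of_injOn, Finset.card_range]
  intro k hk k' hk' h
  simp only [Finset.coe_range, Set.mem_Iio] at hk hk'
  by_contra hne
  rcases lt_or_gt_of_ne hne with h1 | h1
  · exact (hM.meshPoint_strictMono hε h1 (by omega)).ne h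
  · exact (hM.meshPoint_strictMono hε h1 (by omega)).ne' h

lemma Attractive.simpleMesh_subset (hM : M.Attractive) {ε : ℝ} (hε : 0 < ε) (i : Fin n) (x : ℝ)
    (hx : x ∈ M.simpleMesh ε i) : x ∈ Set.Icc (0 : ℝ) 1 := by
  rw [simpleMesh_eq, Finset.mem_image] at hx
  obtain ⟨k, _, rfl⟩ := hx
  have := hM.meshPoint_mem_box hε i k
  exact ⟨(M.boxLower_mem i).1.trans this.1, this.2.trans (M.boxUpper_mem i).2⟩

/-- Every point of the Bethe box is within `γ i` of a mesh point. -/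
lemma Attractive.exists_meshPoint_near (hM : M.Attractive) {ε : ℝ} (hε : 0 < ε) (i : Fin n) {z : ℝ}
    (hz : z ∈ Set.Icc (M.boxLower i) (M.boxUpper i)) :
    ∃ k, M.derivBound i * |M.meshPoint ε i k - z| ≤ ε / n := by
  have hn : (0 : ℝ) < n := by exact_mod_cast i.pos
  rcases hM.box_cases hε i with ⟨h, _⟩ | ⟨hD, _, h⟩
  · exact ⟨0, by rw [h, zero_mul]; positivity⟩
  set a := (z - M.boxLower i) / (2 * M.meshRadius ε i)
  have ha : 0 ≤ a := div_nonneg (by linarith [hz.1]) (by positivity)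
  have haz : a * (2 * M.meshRadius ε i) = z - M.boxLower i := div_mul_cancel₀ _ (by positivity)
  -- The integer nearest to a; spacing 2γ leaves a distance of at most γ.
  refine ⟨⌊a + 1 / 2⌋₊, ?_⟩
  have h1 := Nat.floor_le (show 0 ≤ a + 1 / 2 by positivity)
  have h2 := Nat.lt_floor_add_one (a + 1 / 2)
  set k := ⌊a + 1 / 2⌋₊
  have h3 : |M.boxLower i + 2 * M.meshRadius ε i * k - z| ≤ M.meshRadius ε i := by
    rw [abs_le]; constructor <;> nlinarith
  -- The index may exceed the last one, but truncation at the upper end is 1-Lipschitz and fixes z.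
  have h4 : |M.meshPoint ε i k - z| ≤ M.meshRadius ε i := by
    have := abs_min_sub_min_le_max (M.boxLower i + 2 * M.meshRadius ε i * k) (M.boxUpper i) z
      (M.boxUpper i)
    rw [min_eq_left hz.2] at this
    exact this.trans (by simpa using h3)
  calc M.derivBound i * |M.meshPoint ε i k - z| ≤ M.derivBound i * M.meshRadius ε i := by gcongr
    _ = ε / n := by rw [meshRadius]; field_simp

/-- Changing the coordinates one at a time. -/
lemma le_add_sum_of_update_le {F : (Fin n → ℝ) → ℝ} {q r : Fin n → ℝ} {δ : Fin n → ℝ}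
    {C : Fin n → Set ℝ} (hq : ∀ i, q i ∈ C i) (hr : ∀ i, r i ∈ C i)
    (h : ∀ i p, (∀ j, p j ∈ C j) → p i = q i → F (Function.update p i (r i)) ≤ F p + δ i) :
    F r ≤ F q + ∑ i, δ i := by
  have key : ∀ s : Finset (Fin n), F (s.piecewise r q) ≤ F q + ∑ i ∈ s, δ i := by
    intro s
    induction s using Finset.induction_on with
    | empty => simp
    | insert j s hj ih =>
      rw [Finset.piecewise_insert, Finset.sum_insert hj]
      have := h j (s.piecewise r q) (fun i => by
        by_cases hi : i ∈ s <;> simp [hi, hq, hr]) (by simp [hj])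
      linarith
  simpa using key Finset.univ

/-- In each coordinate, first clamp to the box at no cost, then move to the near mesh point at cost
ε / n. The other coordinates may be arbitrary points of [0,1] meanwhile, so the coordinates can be
treated in turn. -/
lemma Attractive.exists_meshPoints_le (hM : M.Attractive) {ε : ℝ} (hε : 0 < ε) {q : Fin n → ℝ}
    (hq : ∀ i, q i ∈ Set.Icc (0 : ℝ) 1) :
    ∃ r ∈ meshPoints (M.simpleMesh ε), M.freeEnergy r ≤ M.freeEnergy q + ε := by
  have hbox : ∀ i, max (M.boxLower i) (min (M.boxUpper i) (q i)) ∈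
      Set.Icc (M.boxLower i) (M.boxUpper i) := fun i =>
    ⟨le_max_left _ _, max_le (hM.boxLower_le_boxUpper i) (min_le_left _ _)⟩
  choose k hk using fun i => hM.exists_meshPoint_near hε i (hbox i)
  refine ⟨fun i => M.meshPoint ε i (k i), fun i => hM.meshPoint_mem hε i _, ?_⟩
  have h := le_add_sum_of_update_le (F := M.freeEnergy) (δ := fun _ : Fin n => ε / n)
    (r := fun i => M.meshPoint ε i (k i)) hq
    (fun i => hM.simpleMesh_subset hε i _ (hM.meshPoint_mem hε i _)) (fun i p hp hpq => by
      have h1 := hM.clamp_le hp i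
      have h2 := hM.update_lipschitz hp i (hbox i) (hM.meshPoint_mem_box hε i (k i))
      rw [hpq] at h1
      linarith [hk i])
  refine h.trans ?_
  rcases Nat.eq_zero_or_pos n with rfl | hn
  · simpa using hε.le
  · have : (n : ℝ) ≠ 0 := by positivity
    simp only [Finset.sum_const, Finset.card_univ, Fintype.card_fin, nsmul_eq_mul]
    rw [mul_div_cancel₀ _ this]

lemma Attractive.exists_isMeshMinimizer (hM : M.Attractive) {ε : ℝ} (hε : 0 < ε) :
    ∃ q, M.IsMeshMinimizer (M.simpleMesh ε) q := by
  have hne : (Fintype.piFinset (M.simpleMesh ε)).Nonempty :=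
    ⟨fun i => M.meshPoint ε i 0, by
      rw [Fintype.mem_piFinset]; exact fun i => hM.meshPoint_mem hε i 0⟩
  obtain ⟨q, hq, hmin⟩ := Finset.exists_min_image _ M.freeEnergy hne
  exact ⟨q, Fintype.mem_piFinset.mp hq, fun q' hq' => hmin q' (Fintype.mem_piFinset.mpr hq')⟩

lemma IsMeshMinimizer.le_add (hM : M.Attractive) {ε : ℝ} (hε : 0 < ε) {q : Fin n → ℝ}
    (h : M.IsMeshMinimizer (M.simpleMesh ε) q) {q' : Fin n → ℝ}
    (hq' : ∀ i, q' i ∈ Set.Icc (0 : ℝ) 1) : M.freeEnergy q ≤ M.freeEnergy q' + ε := by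
  obtain ⟨r, hr, hle⟩ := hM.exists_meshPoints_le hε hq'
  exact (h.2 r hr).trans hle

theorem Attractive.sufficientMesh (hM : M.Attractive) {ε : ℝ} (hε : 0 < ε) :
    M.SufficientMesh (M.simpleMesh ε) ε := by
  refine ⟨hM.simpleMesh_subset hε, ?_⟩
  obtain ⟨q, hq⟩ := hM.exists_isMeshMinimizer hε
  exact ⟨q, hq.1, fun q' hq' => by linarith [hq.le_add hM hε hq']⟩

/-- The box has length at most 1, so a dimension has at most 2 + 1/(2γ_i) = 2 + n D_i / (2ε) points,
and the D_i sum to twice the total weight. -/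
theorem Attractive.meshSize_le (hM : M.Attractive) {ε : ℝ} (hε : 0 < ε) :
    (meshSize (M.simpleMesh ε) : ℝ) ≤ 2 * n + n / ε * ∑ e, |M.W e| := by
  have h1 : ∀ i, ((M.simpleMesh ε i).card : ℝ) ≤ 2 + n / ε * (M.derivBound i * (1 / 2)) := by
    intro i
    have hn : (0 : ℝ) < n := by exact_mod_cast i.pos
    rw [hM.card_simpleMesh hε]
    push_cast
    rcases hM.box_cases hε i with ⟨h, _, _, h0⟩ | ⟨hD, hlt, h⟩
    · rw [h0, h]; simp
    · have h2 := Nat.ceil_lt_add_one (a := (M.boxUpper i - M.boxLower i) / (2 * M.meshRadius ε i))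
        (div_nonneg (by linarith) (by positivity))
      have h3 : (M.boxUpper i - M.boxLower i) / (2 * M.meshRadius ε i) ≤
          n / ε * (M.derivBound i * (1 / 2)) := by
        rw [div_le_iff₀ (by positivity)]
        have : n / ε * (M.derivBound i * (1 / 2)) * (2 * M.meshRadius ε i) = 1 := by
          rw [meshRadius]; field_simp
        rw [this]
        linarith [(M.boxLower_mem i).1, (M.boxUpper_mem i).2]
      rw [meshCount]
      linarith
  have h2 : ∑ i, M.derivBound i * (1 / 2) = ∑ e, |M.W e| := by
    simp only [hM.derivBound_eq]
    rw [M.sum_sum_incident M.W fun _ => 1 / 2]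
    exact Finset.sum_congr rfl fun e _ => by rw [abs_of_pos (hM e)]; ring
  rw [meshSize]
  push_cast
  refine (Finset.sum_le_sum fun i _ => h1 i).trans ?_
  rw [Finset.sum_add_distrib, ← Finset.mul_sum, h2]
  simp [mul_comm]

/-! ### The Bethe partition function -/

/-- A table with prescribed marginals is determined by its (1,1) entry, so `edgeCost_le` applies
edge by edge. Equality is attained at the table given by ξ, so the two problems have the same
infimum. -/
lemma freeEnergy_le_betheFreeEnergy (hM : M.Attractive)
    {p : (Fin n → ℝ) × (Fin m → Fin 2 → Fin 2 → ℝ)} (hp : p ∈ M.localPolytope) :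
    M.freeEnergy p.1 ≤ M.betheFreeEnergy p := by
  have h : ∀ e, edgeCost (M.W e) (p.1 (M.src e)) (p.1 (M.tgt e)) ≤
      -(M.W e * p.2 e 1 1) - pairEntropy (p.2 e) := by
    intro e
    obtain ⟨h1, h2, h3, h4⟩ := hp.2 e
    simp only [Fin.sum_univ_two] at h2 h3 h4
    have hμ : p.2 e = pairMarginal (p.1 (M.src e)) (p.1 (M.tgt e)) (p.2 e 1 1) := by
      funext a b
      fin_cases a <;> fin_cases b <;> simp [pairMarginal] <;> linarith
    nth_rw 2 [hμ]
    exact edgeCost_le (hM e) (hp.1 _) (hp.1 _) (h1 1 1) (by linarith [h1 1 0])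
      (by linarith [h1 0 1]) (by linarith [h1 0 0])
  have := Finset.sum_le_sum fun e (_ : e ∈ Finset.univ) => h e
  simp only [Finset.sum_sub_distrib, Finset.sum_neg_distrib] at this
  simp only [freeEnergy, betheFreeEnergy, Finset.sum_add_distrib, Finset.sum_neg_distrib, sub_mul,
    Finset.sum_sub_distrib] at this ⊢
  linarith

lemma exists_betheFreeEnergy_eq (hM : M.Attractive) {q : Fin n → ℝ}
    (hq : ∀ i, q i ∈ Set.Icc (0 : ℝ) 1) :
    ∃ p ∈ M.localPolytope, M.betheFreeEnergy p = M.freeEnergy q := by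
  refine ⟨(q, fun e => pairMarginal (q (M.src e)) (q (M.tgt e))
    (xi (M.W e) (q (M.src e)) (q (M.tgt e)))), ⟨hq, fun e => ⟨fun a b => ?_, ?_, ?_, ?_⟩⟩, ?_⟩
  · have b1 := xi_le_left (hM e) (hq (M.src e)) (hq (M.tgt e))
    have b2 := xi_le_right (hM e) (hq (M.src e)) (hq (M.tgt e))
    have b3 := xi_nonneg (hM e) (hq (M.src e)) (hq (M.tgt e))
    have b4 := add_sub_one_le_xi (hM e) (hq (M.src e)) (hq (M.tgt e))
    fin_cases a <;> fin_cases b <;> simp [pairMarginal] <;> linarith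
  · simp [pairMarginal, Fin.sum_univ_two]; ring
  · simp [pairMarginal, Fin.sum_univ_two]
  · simp [pairMarginal, Fin.sum_univ_two]
  · simp only [freeEnergy, betheFreeEnergy, edgeCost, Finset.sum_add_distrib,
      Finset.sum_neg_distrib, sub_mul, Finset.sum_sub_distrib]
    simp [pairMarginal]
    ring

theorem IsMeshMinimizer.abs_sub_logZB_le (hM : M.Attractive) {ε : ℝ} (hε : 0 < ε) {q : Fin n → ℝ}
    (h : M.IsMeshMinimizer (M.simpleMesh ε) q) : |-M.freeEnergy q - M.logZB| ≤ ε := by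
  have hlow : ∀ b ∈ M.betheFreeEnergy '' M.localPolytope, M.freeEnergy q - ε ≤ b := by
    rintro _ ⟨p, hp, rfl⟩
    linarith [freeEnergy_le_betheFreeEnergy hM hp, h.le_add hM hε hp.1]
  obtain ⟨p, hp, hpq⟩ := exists_betheFreeEnergy_eq hM
    (fun i => hM.simpleMesh_subset hε i _ (h.1 i))
  have h1 : sInf (M.betheFreeEnergy '' M.localPolytope) ≤ M.freeEnergy q :=
    hpq ▸ csInf_le ⟨_, hlow⟩ ⟨p, hp, rfl⟩
  have h2 := le_csInf (Set.Nonempty.image _ ⟨p, hp⟩) hlow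
  rw [logZB, abs_le]
  constructor <;> linarith

end BinaryMRF

/-! ### Quadratic binary energies -/

/-- The energy `∑ c u y u + ∑ w u v y u (1 - y v)` on the nodes `0, …, K - 1`. -/
noncomputable def cutEnergy (K : ℕ) (w : ℕ → ℕ → ℝ) (c : ℕ → ℝ) (y : ℕ → ℝ) : ℝ :=
  ∑ u ∈ Finset.range K, c u * y u +
    ∑ u ∈ Finset.range K, ∑ v ∈ Finset.range K, w u v * (y u * (1 - y v))

/-- Shifting `δ` from the arc `(a, b)` to the arc `(b, a)`. -/
noncomputable def pushArc (w : ℕ → ℕ → ℝ) (a b : ℕ) (δ : ℝ) : ℕ → ℕ → ℝ := fun u v =>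
  w u v + (if u = b ∧ v = a then δ else 0) - (if u = a ∧ v = b then δ else 0)

/-- Shifting `δ` from the node `b` to the node `a`. -/
noncomputable def pushNode (c : ℕ → ℝ) (a b : ℕ) (δ : ℝ) : ℕ → ℝ := fun u =>
  c u + (if u = a then δ else 0) - (if u = b then δ else 0)

/-- Pushing flow along an arc is a reparametrization of the energy. -/
lemma cutEnergy_push {K : ℕ} {a b : ℕ} (ha : a < K) (hb : b < K) (w : ℕ → ℕ → ℝ) (c : ℕ → ℝ)
    (δ : ℝ) (y : ℕ → ℝ) :
    cutEnergy K (pushArc w a b δ) (pushNode c a b δ) y = cutEnergy K w c y := by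
  have hsum : ∀ (a b : ℕ), a < K → b < K → ∑ u ∈ Finset.range K, ∑ v ∈ Finset.range K,
      (if u = a ∧ v = b then δ else 0) * (y u * (1 - y v)) = δ * (y a * (1 - y b)) := by
    intro a b ha hb
    rw [Finset.sum_eq_single a, Finset.sum_eq_single b]
    · simp
    · intro v _ hv; simp [hv]
    · intro h; simp at h; omega
    · intro u _ hu; simp [hu]
    · intro h; simp at h; omega
  have hsum1 : ∀ a < K, ∑ u ∈ Finset.range K, (if u = a then δ else 0) * y u = δ * y a := by
    intro a ha
    rw [Finset.sum_eq_single a]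
    · simp
    · intro v _ hv; simp [hv]
    · intro h; simp at h; omega
  simp only [cutEnergy, pushArc, pushNode, add_mul, sub_mul, Finset.sum_add_distrib,
    Finset.sum_sub_distrib]
  -- What remains is the identity y_b (1 - y_a) - y_a (1 - y_b) = y_b - y_a, which the change of the
  -- coefficients compensates.
  rw [hsum _ _ ha hb, hsum _ _ hb ha, hsum1 _ ha, hsum1 _ hb]
  ring

/-- Optimality of a threshold of a labelling: no arcs of positive weight leave the set, the
coefficients are non-positive in the set and non-negative outside. -/
lemma cutEnergy_le_of_tight {K : ℕ} {w : ℕ → ℕ → ℝ} {c : ℕ → ℝ} {z : ℕ → ℝ}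
    (hw : ∀ u < K, ∀ v < K, 0 ≤ w u v)
    (hz : ∀ u < K, (z u = 0 ∧ 0 ≤ c u) ∨ (z u = 1 ∧ c u ≤ 0))
    (hcut : ∀ u < K, ∀ v < K, z u = 1 → z v = 0 → w u v = 0) {y : ℕ → ℝ}
    (hy : ∀ u < K, y u = 0 ∨ y u = 1) :
    cutEnergy K w c z ≤ cutEnergy K w c y := by
  unfold cutEnergy
  refine add_le_add (Finset.sum_le_sum fun u hu => ?_)
    (Finset.sum_le_sum fun u hu => Finset.sum_le_sum fun v hv => ?_)
  · rw [Finset.mem_range] at hu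
    rcases hz u hu with ⟨h1, h2⟩ | ⟨h1, h2⟩ <;> rcases hy u hu with h3 | h3 <;>
      rw [h1, h3] <;> linarith
  · rw [Finset.mem_range] at hu hv
    have h0 := hw u hu v hv
    have : w u v * (z u * (1 - z v)) = 0 := by
      rcases hz u hu with ⟨h1, _⟩ | ⟨h1, _⟩ <;> rcases hz v hv with ⟨h2, _⟩ | ⟨h2, _⟩
      · simp [h1]
      · simp [h1]
      · simp [hcut u hu v hv h1 h2]
      · simp [h2]
    rw [this]
    apply mul_nonneg h0
    rcases hy u hu with h3 | h3 <;> rcases hy v hv with h4 | h4 <;> simp [h3, h4]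

/-! ### The push-relabel method -/

namespace PushRelabel

/-- The state of the push-relabel method: weights, coefficients, labels, current arcs, the vertex in
turn, and the number of completed sweeps. -/
structure State where
  w : ℕ → ℕ → ℝ
  c : ℕ → ℝ
  d : ℕ → ℕ
  cur : ℕ → ℕ
  i : ℕ
  sweep : ℕ

/-- A vertex is active if it has an excess and its label is small. -/
def Active (K : ℕ) (c : ℕ → ℝ) (d : ℕ → ℕ) (u : ℕ) : Prop := c u < 0 ∧ d u < K + 1

open Classical in
/-- One step of the method. -/
noncomputable def step (K : ℕ) (s : State) : State :=
  if s.i < K then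
    if Active K s.c s.d s.i then
      if s.cur s.i < K then
        if 0 < s.w s.i (s.cur s.i) ∧ s.d s.i = s.d (s.cur s.i) + 1 then
          if -s.c s.i < s.w s.i (s.cur s.i) then
            { s with
              w := pushArc s.w s.i (s.cur s.i) (-s.c s.i)
              c := pushNode s.c s.i (s.cur s.i) (-s.c s.i)
              i := s.i + 1 }
          else
            { s with
              w := pushArc s.w s.i (s.cur s.i) (s.w s.i (s.cur s.i))
              c := pushNode s.c s.i (s.cur s.i) (s.w s.i (s.cur s.i))
              cur := Function.update s.cur s.i (s.cur s.i + 1) }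
        else { s with cur := Function.update s.cur s.i (s.cur s.i + 1) }
      else
        { s with
          d := Function.update s.d s.i (s.d s.i + 1)
          cur := Function.update s.cur s.i 0 }
    else { s with i := s.i + 1 }
  else { s with i := 0, sweep := s.sweep + 1 }

/-- The labelling is valid and arcs before the current ones are not admissible. -/
structure Valid (K : ℕ) (w₀ : ℕ → ℕ → ℝ) (c₀ : ℕ → ℝ) (s : State) : Prop where
  w_nonneg : ∀ u < K, ∀ v < K, 0 ≤ s.w u v
  label_le : ∀ u < K, ∀ v < K, 0 < s.w u v → s.d u ≤ s.d v + 1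
  label_zero : ∀ u < K, 0 < s.c u → s.d u = 0
  label_bound : ∀ u < K, s.d u ≤ K + 1
  cur_bound : ∀ u < K, s.cur u ≤ K
  cur_spec : ∀ u < K, ∀ v < s.cur u, ¬(0 < s.w u v ∧ s.d u = s.d v + 1)
  i_bound : s.i ≤ K
  energy : ∀ y, cutEnergy K s.w s.c y = cutEnergy K w₀ c₀ y

/-- The sum of the distances of the labels from their bound. -/
def slack (K : ℕ) (d : ℕ → ℕ) : ℕ := ∑ u ∈ Finset.range K, (K + 1 - d u)

/-- The bound on the number of sweeps. -/
def sweepBound (K : ℕ) : ℕ := 1 + (K + 1) * K + (K + 1) * K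

/-- `H` bounds the labels of the active vertices at the start of the sweep, `ρ` is the number of label
increases in the sweep. -/
def SweepInv (K : ℕ) (s : State) : Prop :=
  ∃ H ρ : ℕ, (∀ u < K, Active K s.c s.d u → s.d u + 1 ≤ H + ρ) ∧
    (ρ = 0 → ∀ u < s.i, Active K s.c s.d u → s.d u + 2 ≤ H) ∧
    ((H = 0 ∧ ρ = 0) ∨ H + 2 * (slack K s.d + ρ) + s.sweep ≤ sweepBound K)

/-- The number of steps that remain. -/
def potential (K : ℕ) (s : State) : ℕ :=
  ∑ u ∈ Finset.range K, ((K + 1 - s.d u) * (K + 1) + (K - s.cur u)) +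
    ((sweepBound K - s.sweep) * (K + 1) + (K - s.i))

lemma sum_update_range {K a : ℕ} (ha : a < K) (f : ℕ → ℕ → ℕ) (g : ℕ → ℕ) (x : ℕ) :
    ∑ u ∈ Finset.range K, f u (Function.update g a x u) + f a (g a) =
      ∑ u ∈ Finset.range K, f u (g u) + f a x := by
  have hmem : a ∈ Finset.range K := Finset.mem_range.mpr ha
  rw [← Finset.add_sum_erase _ _ hmem, ← Finset.add_sum_erase _ (fun u => f u (g u)) hmem]
  have : ∑ u ∈ (Finset.range K).erase a, f u (Function.update g a x u) =
      ∑ u ∈ (Finset.range K).erase a, f u (g u) :=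
    Finset.sum_congr rfl fun u hu => by rw [Function.update_of_ne (Finset.ne_of_mem_erase hu)]
  rw [this, Function.update_self]
  ring

variable {K : ℕ} {w₀ : ℕ → ℕ → ℝ} {c₀ : ℕ → ℝ} {s : State}

lemma pushArc_apply_of_ne {w : ℕ → ℕ → ℝ} {a b u v : ℕ} {δ : ℝ} (h1 : ¬(u = b ∧ v = a))
    (h2 : ¬(u = a ∧ v = b)) : pushArc w a b δ u v = w u v := by
  simp [pushArc, h1, h2]

/-- A push along an admissible arc keeps everything valid. -/
lemma Valid.push (h : Valid K w₀ c₀ s) (hi : s.i < K) (hcur : s.cur s.i < K)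
    (hd : s.d s.i = s.d (s.cur s.i) + 1) {δ : ℝ} (h0 : 0 ≤ δ) (h1 : δ ≤ -s.c s.i)
    (h2 : δ ≤ s.w s.i (s.cur s.i)) :
    Valid K w₀ c₀ { s with
      w := pushArc s.w s.i (s.cur s.i) δ
      c := pushNode s.c s.i (s.cur s.i) δ } := by
  have hne : s.i ≠ s.cur s.i := by
    intro h; rw [← h] at hd; omega
  set a := s.i
  set b := s.cur a
  have hba : pushArc s.w a b δ b a = s.w b a + δ := by simp [pushArc, hne]
  have hab : pushArc s.w a b δ a b = s.w a b - δ := by simp [pushArc, hne]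
  refine ⟨?_, ?_, ?_, h.label_bound, h.cur_bound, ?_, h.i_bound, ?_⟩
  · intro u hu v hv
    by_cases e1 : u = b ∧ v = a
    · obtain ⟨rfl, rfl⟩ := e1
      simp only
      rw [hba]; linarith [h.w_nonneg b hu a hv]
    by_cases e2 : u = a ∧ v = b
    · obtain ⟨rfl, rfl⟩ := e2
      simp only
      rw [hab]; linarith
    simp only [pushArc_apply_of_ne e1 e2]
    exact h.w_nonneg u hu v hv
  · intro u hu v hv hpos
    simp only at hpos ⊢
    -- The only arc that can become residual is the reverse one, and it goes from label d b to d a =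
    -- d b + 1. For the same reason it is not admissible, which `cur_spec` needs below.
    by_cases e1 : u = b ∧ v = a
    · obtain ⟨rfl, rfl⟩ := e1
      omega
    by_cases e2 : u = a ∧ v = b
    · obtain ⟨rfl, rfl⟩ := e2
      omega
    rw [pushArc_apply_of_ne e1 e2] at hpos
    exact h.label_le u hu v hv hpos
  · intro u hu hpos
    simp only [pushNode] at hpos ⊢
    apply h.label_zero u hu
    by_cases e1 : u = a
    · subst e1
      simp only [if_true, hne, if_false] at hpos
      linarith
    · simp only [e1, if_false] at hpos
      split_ifs at hpos <;> linarith
  · intro u hu v hv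
    simp only at hv ⊢
    by_cases e1 : u = b ∧ v = a
    · obtain ⟨rfl, rfl⟩ := e1
      omega
    by_cases e2 : u = a ∧ v = b
    · obtain ⟨rfl, rfl⟩ := e2
      omega
    rw [pushArc_apply_of_ne e1 e2]
    exact h.cur_spec u hu v hv
  · intro y
    rw [← h.energy y]
    exact cutEnergy_push hi hcur _ _ _ _

lemma Valid.advance (h : Valid K w₀ c₀ s) (hcur : s.cur s.i < K)
    (hadm : ¬(0 < s.w s.i (s.cur s.i) ∧ s.d s.i = s.d (s.cur s.i) + 1)) :
    Valid K w₀ c₀ { s with cur := Function.update s.cur s.i (s.cur s.i + 1) } := by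
  refine ⟨h.w_nonneg, h.label_le, h.label_zero, h.label_bound, ?_, ?_, h.i_bound, h.energy⟩
  · intro u hu
    simp only [Function.update_apply]
    split_ifs
    · omega
    · exact h.cur_bound u hu
  · intro u hu v hv
    simp only [Function.update_apply] at hv ⊢
    split_ifs at hv with e
    · subst e
      rcases (Nat.lt_succ_iff_lt_or_eq.mp hv) with hv | rfl
      · exact h.cur_spec _ hu v hv
      · exact hadm
    · exact h.cur_spec u hu v hv

/-- When the current arc has passed all K heads, `cur_spec` says that no arc is admissible, so every
residual arc has d i ≤ d v. Raising the label by exactly one therefore keeps it valid. -/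
lemma Valid.relabel (h : Valid K w₀ c₀ s) (hact : Active K s.c s.d s.i)
    (hcur : ¬ s.cur s.i < K) :
    Valid K w₀ c₀ { s with
      d := Function.update s.d s.i (s.d s.i + 1)
      cur := Function.update s.cur s.i 0 } := by
  refine ⟨h.w_nonneg, ?_, ?_, ?_, ?_, ?_, h.i_bound, h.energy⟩
  · intro u hu v hv hpos
    simp only [Function.update_apply] at hpos ⊢
    have h1 := h.label_le u hu v hv hpos
    split_ifs with e1 e2
    · omega
    · subst e1
      have := h.cur_spec _ hu v (by omega)
      have : s.d s.i ≠ s.d v + 1 := fun h => this ⟨hpos, h⟩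
      omega
    · subst_vars; omega
    · exact h1
  · intro u hu hpos
    simp only [Function.update_apply] at hpos ⊢
    split_ifs with e1
    · subst e1
      linarith [hact.1]
    · exact h.label_zero u hu hpos
  · intro u hu
    simp only [Function.update_apply]
    split_ifs with e1
    · have := hact.2; omega
    · exact h.label_bound u hu
  · intro u hu
    simp only [Function.update_apply]
    split_ifs with e1
    · omega
    · exact h.cur_bound u hu
  · intro u hu v hv
    simp only [Function.update_apply] at hv ⊢
    split_ifs at hv with e1
    · omega
    have h1 := h.cur_spec u hu v hv
    simp only [e1, if_false]
    rintro ⟨h2, h3⟩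
    split_ifs at h3 with e2
    -- An arc into the relabelled vertex that becomes admissible would have had d u = d v + 2
    -- before, against validity.
    · have := h.label_le u hu v (lt_of_lt_of_le hv (h.cur_bound u hu)) h2
      rw [e2] at this
      omega
    · exact h1 ⟨h2, h3⟩

lemma Valid.with_position (h : Valid K w₀ c₀ s) {i p : ℕ} (hi : i ≤ K) :
    Valid K w₀ c₀ { s with i := i, sweep := p } :=
  ⟨h.w_nonneg, h.label_le, h.label_zero, h.label_bound, h.cur_bound, h.cur_spec, hi, h.energy⟩

theorem Valid.step (h : Valid K w₀ c₀ s) : Valid K w₀ c₀ (step K s) := by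
  unfold PushRelabel.step
  split_ifs with h1 h2 h3 h4 h5
  · have := h.push h1 h3 h4.2 (δ := -s.c s.i) (by linarith [h2.1]) le_rfl h5.le
    exact this.with_position (i := s.i + 1) (p := s.sweep) h1
  · have h' := h.push h1 h3 h4.2 (δ := s.w s.i (s.cur s.i)) h4.1.le (by linarith) le_rfl
    -- After a saturating push the arc has weight 0, so the current-arc pointer may move past it.
    refine h'.advance h3 ?_
    have hne : s.i ≠ s.cur s.i := by
      intro h; have := h4.2; rw [← h] at this; omega
    simp [pushArc, hne]
  · exact h.advance h3 h4
  · exact h.relabel h2 h3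
  · exact h.with_position (i := s.i + 1) (p := s.sweep) h1
  · exact h.with_position (i := 0) (p := s.sweep + 1) (Nat.zero_le K)

lemma slack_update (hi : s.i < K) (hd : s.d s.i < K + 1) :
    slack K (Function.update s.d s.i (s.d s.i + 1)) + 1 = slack K s.d := by
  have := sum_update_range hi (fun _ x => K + 1 - x) s.d (s.d s.i + 1)
  unfold slack
  omega

/-- After a push, only the head of the arc can have become active. -/
lemma active_push {a b : ℕ} {δ : ℝ} {c : ℕ → ℝ} {d : ℕ → ℕ} {u : ℕ} (h0 : 0 ≤ δ)
    (h : Active K (pushNode c a b δ) d u) : Active K c d u ∨ u = b := by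
  by_cases e : u = b
  · exact .inr e
  · left
    refine ⟨?_, h.2⟩
    have := h.1
    simp only [pushNode, e, if_false] at this
    split_ifs at this <;> linarith

/-- Only the head can become active, and its label is one below that of an active vertex. So it
satisfies the stricter bound demanded of vertices already passed in the sweep. -/
lemma SweepInv.push (h : SweepInv K s) (hact : Active K s.c s.d s.i) (hi : s.i < K)
    {b : ℕ} (hd : s.d s.i = s.d b + 1) {δ : ℝ} (h0 : 0 ≤ δ) (w : ℕ → ℕ → ℝ) :
    SweepInv K { s with w := w, c := pushNode s.c s.i b δ } := by
  obtain ⟨H, ρ, h1, h2, h3⟩ := h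
  have h4 := h1 _ hi hact
  refine ⟨H, ρ, fun u hu ha => ?_, fun hρ u hu ha => ?_, h3⟩
  · rcases active_push h0 ha with h | rfl
    · exact h1 u hu h
    · simp only; omega
  · rcases active_push h0 ha with h | rfl
    · exact h2 hρ u hu h
    · simp only; omega

lemma SweepInv.advance (h : SweepInv K s) (hact : ¬ Active K s.c s.d s.i) :
    SweepInv K { s with i := s.i + 1 } := by
  obtain ⟨H, ρ, h1, h2, h3⟩ := h
  refine ⟨H, ρ, h1, fun hρ u hu ha => ?_, h3⟩
  simp only at hu ha ⊢
  rcases Nat.lt_succ_iff_lt_or_eq.mp hu with hu | rfl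
  · exact h2 hρ u hu ha
  · exact absurd ha hact

theorem SweepInv.step (h : SweepInv K s) (hb : s.i ≤ K) : SweepInv K (step K s) := by
  unfold PushRelabel.step
  split_ifs with h1 h2 h3 h4 h5
  · refine (h.push h2 h1 h4.2 (δ := -s.c s.i) (by linarith [h2.1]) _).advance ?_
    have hne : s.i ≠ s.cur s.i := by
      intro h; have := h4.2; rw [← h] at this; omega
    rintro ⟨h6, _⟩
    simp [pushNode, hne] at h6
  · exact h.push h2 h1 h4.2 h4.1.le s.w
  · exact h
  · obtain ⟨H, ρ, g1, g2, g3⟩ := h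
    have hs := slack_update h1 h2.2
    refine ⟨H, ρ + 1, fun u hu ha => ?_, fun h => by omega, ?_⟩
    · simp only [Function.update_apply]
      split_ifs with e
      · have := g1 _ h1 h2; omega
      · refine (g1 u hu ⟨ha.1, ?_⟩).trans (by omega)
        have := ha.2
        simpa [Function.update_apply, e] using this
    · rcases g3 with ⟨g3, g4⟩ | g3
      · have := g1 _ h1 h2; omega
      · right; simp only; omega
  · exact h.advance h2
  · obtain ⟨H, ρ, g1, g2, g3⟩ := h
    have hK : s.i = K := by omega
    rw [hK] at g2
    rcases Nat.eq_zero_or_pos ρ with rfl | hρ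
    -- No label increased during the sweep: every vertex has been passed, so the maximal active
    -- label dropped and H decreases. This pays for the completed sweep.
    · refine ⟨H - 1, 0, fun u hu ha => ?_, fun _ u hu => by simp at hu, ?_⟩
      · have := g2 rfl u hu ha; simp only; omega
      · rcases Nat.eq_zero_or_pos H with rfl | hH
        · exact .inl ⟨rfl, rfl⟩
        · refine .inr ?_
          have g3 := g3.resolve_left (by omega)
          simp only; omega
    -- H grows by ρ, but the slack at the start of the sweep has been reduced by ρ and is counted
    -- twice. The net gain ρ ≥ 1 pays for the completed sweep.
    · refine ⟨H + ρ, 0, fun u hu ha => ?_, fun _ u hu => by simp at hu, ?_⟩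
      · exact g1 u hu ha
      · simp only; omega

/-- The weight K + 1 on labels and sweeps pays for the resets: a relabelling puts the current arc
back from K to 0, and the end of a sweep does the same to the vertex in turn, each of which raises
the potential by at most K. -/
theorem potential_step (h : Valid K w₀ c₀ s) (hs : s.sweep < sweepBound K) :
    potential K (step K s) + 1 ≤ potential K s := by
  have hcurstep : s.i < K → s.cur s.i < K →
      ∑ u ∈ Finset.range K, ((K + 1 - s.d u) * (K + 1) +
        (K - Function.update s.cur s.i (s.cur s.i + 1) u)) + 1 =
      ∑ u ∈ Finset.range K, ((K + 1 - s.d u) * (K + 1) + (K - s.cur u)) := by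
    intro h1 h3
    have := sum_update_range h1 (fun u x => (K + 1 - s.d u) * (K + 1) + (K - x)) s.cur
      (s.cur s.i + 1)
    omega
  unfold PushRelabel.step
  split_ifs with h1 h2 h3 h4 h5
  · simp only [potential]; omega
  · have := hcurstep h1 h3
    simp only [potential]; omega
  · have := hcurstep h1 h3
    simp only [potential]; omega
  · have e1 := sum_update_range h1 (fun u x => (K + 1 - x) * (K + 1) + (K - s.cur u)) s.d
      (s.d s.i + 1)
    have e2 := sum_update_range h1 (fun u x =>
      (K + 1 - Function.update s.d s.i (s.d s.i + 1) u) * (K + 1) + (K - x)) s.cur 0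
    have hd := h2.2
    have hc := h.cur_bound _ h1
    simp only [Function.update_self] at e1 e2
    obtain ⟨r, hr⟩ : ∃ r, K + 1 - s.d s.i = r + 1 := ⟨K - s.d s.i, by omega⟩
    have hr' : K + 1 - (s.d s.i + 1) = r := by omega
    rw [hr, hr', add_mul] at e1
    simp only [potential]
    omega
  · simp only [potential]; omega
  · obtain ⟨r, hr⟩ : ∃ r, sweepBound K - s.sweep = r + 1 := ⟨sweepBound K - s.sweep - 1, by omega⟩
    have hr' : sweepBound K - (s.sweep + 1) = r := by omega
    simp only [potential, hr, hr', add_mul]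
    omega

/-- The initial state. -/
def initial (w : ℕ → ℕ → ℝ) (c : ℕ → ℝ) : State := ⟨w, c, fun _ => 0, fun _ => 0, 0, 0⟩

lemma valid_initial (hw : ∀ u < K, ∀ v < K, 0 ≤ w₀ u v) : Valid K w₀ c₀ (initial w₀ c₀) :=
  ⟨hw, by simp [initial], by simp [initial], by simp [initial], by simp [initial], by simp [initial],
    by simp [initial], by simp [initial]⟩

/-- All labels are 0, so H = 1 works, and the slack is K (K + 1). The value of `sweepBound` is 1
plus twice this slack. -/
lemma sweepInv_initial (w : ℕ → ℕ → ℝ) (c : ℕ → ℝ) : SweepInv K (initial w c) := by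
  refine ⟨1, 0, by simp [initial], by simp [initial], .inr ?_⟩
  simp only [initial, slack, sweepBound, Finset.sum_const, Finset.card_range, smul_eq_mul]
  have : K * (K + 1) = (K + 1) * K := mul_comm _ _
  simp only [Nat.sub_zero]
  omega

lemma potential_initial_le (w : ℕ → ℕ → ℝ) (c : ℕ → ℝ) :
    potential K (initial w c) ≤ 6 * (K + 1) ^ 3 := by
  simp only [potential, initial, sweepBound, Finset.sum_const, Finset.card_range, smul_eq_mul,
    Nat.sub_zero]
  nlinarith [sq_nonneg K]

/-- When all sweeps are done, no vertex is active. -/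
lemma SweepInv.not_active (h : SweepInv K s) (hs : sweepBound K ≤ s.sweep) {u : ℕ} (hu : u < K) :
    ¬ Active K s.c s.d u := by
  obtain ⟨H, ρ, h1, _, h3⟩ := h
  intro ha
  have := h1 u hu ha
  -- Either way H = ρ = 0, so an active vertex would have d u + 1 ≤ 0.
  omega

/-- Some label is not taken. -/
lemma exists_gap (K : ℕ) (d : ℕ → ℕ) : ∃ k, 1 ≤ k ∧ k ≤ K + 1 ∧ ∀ u < K, d u ≠ k := by
  by_contra! h
  have hsub : Finset.Icc 1 (K + 1) ⊆ (Finset.range K).image d := by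
    intro k hk
    rw [Finset.mem_Icc] at hk
    obtain ⟨u, hu, rfl⟩ := h k hk.1 hk.2
    exact Finset.mem_image_of_mem d (Finset.mem_range.mpr hu)
  have h1 := (Finset.card_le_card hsub).trans Finset.card_image_le
  simp at h1

/-- The vertices above a gap in the labels minimize the energy. -/
theorem Valid.isMin (h : Valid K w₀ c₀ s) (hact : ∀ u < K, ¬ Active K s.c s.d u) {k : ℕ}
    (hk1 : 1 ≤ k) (hk2 : k ≤ K + 1) (hgap : ∀ u < K, s.d u ≠ k) {y : ℕ → ℝ}
    (hy : ∀ u < K, y u = 0 ∨ y u = 1) :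
    cutEnergy K w₀ c₀ (fun u => if k ≤ s.d u then 1 else 0) ≤ cutEnergy K w₀ c₀ y := by
  rw [← h.energy, ← h.energy]
  refine cutEnergy_le_of_tight h.w_nonneg (fun u hu => ?_) (fun u hu v hv h1 h2 => ?_) hy
  · by_cases e : k ≤ s.d u
    · refine .inr ⟨if_pos e, ?_⟩
      by_contra hc
      have := h.label_zero u hu (not_le.mp hc)
      omega
    · refine .inl ⟨if_neg e, ?_⟩
      by_contra hc
      exact hact u hu ⟨not_le.mp hc, by omega⟩
  · have e1 : k ≤ s.d u := by by_contra e; simp [e] at h1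
    have e2 : ¬ k ≤ s.d v := by intro e; simp [e] at h2
    by_contra hne
    -- A residual arc from above the gap to below it would satisfy k ≤ d u ≤ d v + 1 ≤ k, so the
    -- label k would be in use.
    have := h.label_le u hu v hv (lt_of_le_of_ne (h.w_nonneg u hu v hv) (Ne.symm hne))
    have := hgap u hu
    omega

end PushRelabel

/-! ### Pairwise problems on grids as cut problems -/

/-- The minimization of `∑ φ i (q i) + ∑ f i j (q i) (q j)`, where `q i` ranges over the points
`pt i 0, …, pt i (κ i)`. -/
structure GridProblem where
  n : ℕ
  κ : ℕ → ℕ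
  pt : ℕ → ℕ → ℝ
  φ : ℕ → ℝ → ℝ
  f : ℕ → ℕ → ℝ → ℝ → ℝ

namespace GridProblem

variable (G : GridProblem)

/-- The objective function. -/
noncomputable def cost (q : ℕ → ℝ) : ℝ :=
  ∑ i ∈ Finset.range G.n, G.φ i (q i) +
    ∑ i ∈ Finset.range G.n, ∑ j ∈ Finset.range G.n, G.f i j (q i) (q j)

/-- The index of the first node of variable `i`. -/
def offset (i : ℕ) : ℕ := ∑ j ∈ Finset.range i, G.κ j

/-- The number of nodes. -/
def nodes : ℕ := G.offset G.n

lemma offset_succ (i : ℕ) : G.offset (i + 1) = G.offset i + G.κ i := Finset.sum_range_succ _ _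

lemma offset_mono : Monotone G.offset :=
  monotone_nat_of_le_succ fun i => by rw [offset_succ]; omega

lemma offset_add_lt {i b : ℕ} (hi : i < G.n) (hb : b < G.κ i) : G.offset i + b < G.nodes := by
  have := G.offset_mono (show i + 1 ≤ G.n from hi)
  rw [offset_succ] at this
  unfold nodes
  omega

lemma sum_range_offset (g : ℕ → ℝ) (k : ℕ) : ∑ u ∈ Finset.range (G.offset k), g u =
    ∑ i ∈ Finset.range k, ∑ b ∈ Finset.range (G.κ i), g (G.offset i + b) := by
  induction k with
  | zero => simp [offset]
  | succ k ih => rw [offset_succ, Finset.sum_range_add, ih, Finset.sum_range_succ]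

lemma sum_nodes (g : ℕ → ℝ) : ∑ u ∈ Finset.range G.nodes, g u =
    ∑ i ∈ Finset.range G.n, ∑ b ∈ Finset.range (G.κ i), g (G.offset i + b) :=
  G.sum_range_offset g G.n

lemma exists_eq_offset_add {u : ℕ} (hu : u < G.nodes) :
    ∃ i < G.n, ∃ b < G.κ i, u = G.offset i + b := by
  have : ∀ k, u < G.offset k → ∃ i < k, ∃ b < G.κ i, u = G.offset i + b := by
    intro k
    induction k with
    | zero => simp [offset]
    | succ k ih =>
      intro h
      rw [offset_succ] at h
      by_cases hk : u < G.offset k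
      · obtain ⟨i, hi, hb⟩ := ih hk
        exact ⟨i, by omega, hb⟩
      · exact ⟨k, by omega, u - G.offset k, by omega, by omega⟩
  exact this _ hu

/-- The arrays that describe the nodes: node `offset i + b` belongs to variable `i` and to the
interval from `pt i b` to `pt i (b + 1)`. -/
structure IsLayout (own : ℕ → ℕ) (lo hi : ℕ → ℝ) : Prop where
  own_eq : ∀ i < G.n, ∀ b < G.κ i, own (G.offset i + b) = i
  lo_eq : ∀ i < G.n, ∀ b < G.κ i, lo (G.offset i + b) = G.pt i b
  hi_eq : ∀ i < G.n, ∀ b < G.κ i, hi (G.offset i + b) = G.pt i (b + 1)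

lemma exists_isLayout : ∃ own lo hi, G.IsLayout own lo hi := by
  classical
  choose! own hown idx hidx heq using fun u => G.exists_eq_offset_add (u := u)
  have key : ∀ i < G.n, ∀ b < G.κ i, own (G.offset i + b) = i ∧ idx (G.offset i + b) = b := by
    intro i hi b hb
    have hlt := G.offset_add_lt hi hb
    have e := heq _ hlt
    have hb' := hidx _ hlt
    generalize own (G.offset i + b) = i' at *
    generalize idx (G.offset i + b) = b' at *
    have : i' = i := by
      rcases lt_trichotomy i i' with h | h | h
      · have := G.offset_mono (show i + 1 ≤ i' from h)
        rw [offset_succ] at this; omega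
      · exact h.symm
      · have := G.offset_mono (show i' + 1 ≤ i from h)
        rw [offset_succ] at this; omega
    subst this
    exact ⟨rfl, by omega⟩
  refine ⟨own, fun u => G.pt (own u) (idx u), fun u => G.pt (own u) (idx u + 1), ?_, ?_, ?_⟩
  · exact fun i hi b hb => (key i hi b hb).1
  · intro i hi b hb; simp only [(key i hi b hb).1, (key i hi b hb).2]
  · intro i hi b hb; simp only [(key i hi b hb).1, (key i hi b hb).2]

/-- The coefficients of the nodes. -/
noncomputable def coef (own : ℕ → ℕ) (lo hi : ℕ → ℝ) (u : ℕ) : ℝ :=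
  (G.φ (own u) (hi u) - G.φ (own u) (lo u)) + ∑ j ∈ Finset.range G.n,
    ((G.f (own u) j (hi u) (G.pt j (G.κ j)) - G.f (own u) j (lo u) (G.pt j (G.κ j))) +
      (G.f j (own u) (G.pt j 0) (hi u) - G.f j (own u) (G.pt j 0) (lo u)))

/-- The weight of the arcs that enforce consistency. -/
noncomputable def bigWeight (own : ℕ → ℕ) (lo hi : ℕ → ℝ) : ℝ :=
  1 + ∑ u ∈ Finset.range G.nodes, |G.coef own lo hi u|

/-- The weights of the arcs. -/
noncomputable def weight (own : ℕ → ℕ) (lo hi : ℕ → ℝ) (u v : ℕ) : ℝ :=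
  if own u = own v then (if v + 1 = u then G.bigWeight own lo hi else 0)
  else G.f (own u) (own v) (hi u) (lo v) + G.f (own u) (own v) (lo u) (hi v) -
    G.f (own u) (own v) (hi u) (hi v) - G.f (own u) (own v) (lo u) (lo v)

/-- The energy of the cut problem. -/
noncomputable def energy (own : ℕ → ℕ) (lo hi : ℕ → ℝ) (y : ℕ → ℝ) : ℝ :=
  cutEnergy G.nodes (G.weight own lo hi) (G.coef own lo hi) y

/-- `y` is the indicator of the nodes below the grid point with indices `a`. -/
def Encodes (a : ℕ → ℕ) (y : ℕ → ℝ) : Prop :=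
  ∀ i < G.n, a i ≤ G.κ i ∧ ∀ b < G.κ i, y (G.offset i + b) = if b < a i then 1 else 0

/-- The pairwise costs have decreasing differences on the grid. -/
structure Submodular : Prop where
  diag : ∀ i x y, G.f i i x y = 0
  diff : ∀ i < G.n, ∀ j < G.n, ∀ b < G.κ i, ∀ b' < G.κ j,
    G.f i j (G.pt i b) (G.pt j b') + G.f i j (G.pt i (b + 1)) (G.pt j (b' + 1)) ≤
      G.f i j (G.pt i (b + 1)) (G.pt j b') + G.f i j (G.pt i b) (G.pt j (b' + 1))

variable {G}

lemma sum_indicator_telescope (g : ℕ → ℝ) {a κ : ℕ} (ha : a ≤ κ) :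
    ∑ b ∈ Finset.range κ, (g (b + 1) - g b) * (if b < a then 1 else 0) = g a - g 0 := by
  obtain ⟨r, rfl⟩ := Nat.exists_eq_add_of_le ha
  rw [Finset.sum_range_add, Finset.sum_eq_zero (s := Finset.range r), add_zero,
    ← Finset.sum_range_sub]
  · exact Finset.sum_congr rfl fun b hb => by simp [Finset.mem_range.mp hb]
  · intro b _; simp

lemma sum_one_sub_indicator_telescope (g : ℕ → ℝ) {a κ : ℕ} (ha : a ≤ κ) :
    ∑ b ∈ Finset.range κ, (g (b + 1) - g b) * (1 - if b < a then 1 else 0) = g κ - g a := by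
  simp only [mul_sub, mul_one, Finset.sum_sub_distrib]
  rw [← Finset.sum_sub_distrib, Finset.sum_range_sub, sum_indicator_telescope g ha]
  ring

variable {own : ℕ → ℕ} {lo hi : ℕ → ℝ}

/-- The cut energy is the objective function, up to a constant. -/
theorem energy_eq (hL : G.IsLayout own lo hi) (hG : G.Submodular) {a : ℕ → ℕ} {y : ℕ → ℝ}
    (h : G.Encodes a y) :
    G.energy own lo hi y = G.cost (fun i => G.pt i (a i)) - G.cost (fun i => G.pt i 0) := by
  -- The coefficients telescope, for each ordered pair, to f(a_i, κ_j) - f(0, κ_j) and, with the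
  -- roles exchanged, to f(0, a_j) - f(0, 0), the arguments being grid indices.
  have hc : ∑ u ∈ Finset.range G.nodes, G.coef own lo hi u * y u =
      ∑ i ∈ Finset.range G.n, ((G.φ i (G.pt i (a i)) - G.φ i (G.pt i 0)) +
        ∑ j ∈ Finset.range G.n,
        ((G.f i j (G.pt i (a i)) (G.pt j (G.κ j)) - G.f i j (G.pt i 0) (G.pt j (G.κ j))) +
          (G.f j i (G.pt j 0) (G.pt i (a i)) - G.f j i (G.pt j 0) (G.pt i 0)))) := by
    rw [sum_nodes]
    refine Finset.sum_congr rfl fun i hi' => ?_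
    rw [Finset.mem_range] at hi'
    obtain ⟨ha, hy⟩ := h i hi'
    have h1 : ∀ b ∈ Finset.range (G.κ i), G.coef own lo hi (G.offset i + b) * y (G.offset i + b) =
        (G.φ i (G.pt i (b + 1)) - G.φ i (G.pt i b)) * (if b < a i then 1 else 0) +
        ∑ j ∈ Finset.range G.n,
        ((G.f i j (G.pt i (b + 1)) (G.pt j (G.κ j)) - G.f i j (G.pt i b) (G.pt j (G.κ j))) *
            (if b < a i then 1 else 0) +
          (G.f j i (G.pt j 0) (G.pt i (b + 1)) - G.f j i (G.pt j 0) (G.pt i b)) *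
            (if b < a i then 1 else 0)) := by
      intro b hb
      rw [Finset.mem_range] at hb
      rw [coef, hL.own_eq i hi' b hb, hL.lo_eq i hi' b hb, hL.hi_eq i hi' b hb, hy b hb, add_mul,
        Finset.sum_mul]
      simp only [add_mul]
    rw [Finset.sum_congr rfl h1, Finset.sum_add_distrib,
      sum_indicator_telescope (fun b => G.φ i (G.pt i b)) ha, Finset.sum_comm]
    congr 1
    refine Finset.sum_congr rfl fun j _ => ?_
    rw [Finset.sum_add_distrib,
      sum_indicator_telescope (fun b => G.f i j (G.pt i b) (G.pt j (G.κ j))) ha,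
      sum_indicator_telescope (fun b => G.f j i (G.pt j 0) (G.pt i b)) ha]
  -- An arc contributes when b < a_i and b' ≥ a_j. Minus the mixed second differences over this
  -- rectangle telescope to f(a_i, a_j) - f(a_i, κ_j) - f(0, a_j) + f(0, κ_j). Added to the
  -- coefficients this leaves f(a_i, a_j) - f(0, 0).
  have hw : ∑ u ∈ Finset.range G.nodes, ∑ v ∈ Finset.range G.nodes,
      G.weight own lo hi u v * (y u * (1 - y v)) =
      ∑ i ∈ Finset.range G.n, ∑ j ∈ Finset.range G.n,
        (-G.f i j (G.pt i (a i)) (G.pt j (G.κ j)) + G.f i j (G.pt i (a i)) (G.pt j (a j)) +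
          G.f i j (G.pt i 0) (G.pt j (G.κ j)) - G.f i j (G.pt i 0) (G.pt j (a j))) := by
    rw [sum_nodes]
    refine Finset.sum_congr rfl fun i hi' => ?_
    simp only [sum_nodes]
    rw [Finset.sum_comm]
    refine Finset.sum_congr rfl fun j hj' => ?_
    rw [Finset.mem_range] at hi' hj'
    obtain ⟨ha, hy⟩ := h i hi'
    obtain ⟨ha', hy'⟩ := h j hj'
    by_cases hij : i = j
    · subst hij
      simp only [hG.diag]
      simp only [neg_zero, add_zero, sub_zero]
      refine Finset.sum_eq_zero fun b hb => Finset.sum_eq_zero fun b' hb' => ?_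
      rw [Finset.mem_range] at hb hb'
      rw [weight, hL.own_eq i hi' b hb, hL.own_eq i hi' b' hb', if_pos rfl, hy b hb, hy b' hb']
      -- A consistency arc goes from a node to its predecessor, and the indicator of an initial
      -- segment never cuts it.
      split_ifs <;> first | omega | simp
    · have h1 : ∀ b ∈ Finset.range (G.κ i), ∑ b' ∈ Finset.range (G.κ j),
          G.weight own lo hi (G.offset i + b) (G.offset j + b') *
            (y (G.offset i + b) * (1 - y (G.offset j + b'))) =
          ((-G.f i j (G.pt i (b + 1)) (G.pt j (G.κ j)) + G.f i j (G.pt i (b + 1)) (G.pt j (a j))) -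
            (-G.f i j (G.pt i b) (G.pt j (G.κ j)) + G.f i j (G.pt i b) (G.pt j (a j)))) *
            (if b < a i then 1 else 0) := by
        intro b hb
        rw [Finset.mem_range] at hb
        have h2 : ∀ b' ∈ Finset.range (G.κ j),
            G.weight own lo hi (G.offset i + b) (G.offset j + b') *
              (y (G.offset i + b) * (1 - y (G.offset j + b'))) =
            ((G.f i j (G.pt i b) (G.pt j (b' + 1)) - G.f i j (G.pt i (b + 1)) (G.pt j (b' + 1))) -
              (G.f i j (G.pt i b) (G.pt j b') - G.f i j (G.pt i (b + 1)) (G.pt j b'))) *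
              (1 - if b' < a j then 1 else 0) * (if b < a i then 1 else 0) := by
          intro b' hb'
          rw [Finset.mem_range] at hb'
          rw [weight, hL.own_eq i hi' b hb, hL.own_eq j hj' b' hb', if_neg hij, hy b hb, hy' b' hb',
            hL.lo_eq i hi' b hb, hL.hi_eq i hi' b hb, hL.lo_eq j hj' b' hb', hL.hi_eq j hj' b' hb']
          ring
        rw [Finset.sum_congr rfl h2, ← Finset.sum_mul,
          sum_one_sub_indicator_telescope
            (fun b' => G.f i j (G.pt i b) (G.pt j b') - G.f i j (G.pt i (b + 1)) (G.pt j b')) ha']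
        ring
      rw [Finset.sum_congr rfl h1,
        sum_indicator_telescope (fun b => -G.f i j (G.pt i b) (G.pt j (G.κ j)) +
          G.f i j (G.pt i b) (G.pt j (a j))) ha]
      ring
  rw [energy, cutEnergy, hc, hw]
  simp only [cost, Finset.sum_add_distrib, Finset.sum_sub_distrib, Finset.sum_neg_distrib]
  have e1 : ∑ i ∈ Finset.range G.n, ∑ j ∈ Finset.range G.n, G.f j i (G.pt j 0) (G.pt i (a i)) =
      ∑ i ∈ Finset.range G.n, ∑ j ∈ Finset.range G.n, G.f i j (G.pt i 0) (G.pt j (a j)) :=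
    Finset.sum_comm
  have e2 : ∑ i ∈ Finset.range G.n, ∑ j ∈ Finset.range G.n, G.f j i (G.pt j 0) (G.pt i 0) =
      ∑ i ∈ Finset.range G.n, ∑ j ∈ Finset.range G.n, G.f i j (G.pt i 0) (G.pt j 0) :=
    Finset.sum_comm
  rw [e1, e2]
  ring

lemma bigWeight_pos : 0 < G.bigWeight own lo hi := by
  have : 0 ≤ ∑ u ∈ Finset.range G.nodes, |G.coef own lo hi u| :=
    Finset.sum_nonneg fun _ _ => abs_nonneg _
  unfold bigWeight
  linarith

lemma weight_nonneg (hL : G.IsLayout own lo hi) (hG : G.Submodular) :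
    ∀ u < G.nodes, ∀ v < G.nodes, 0 ≤ G.weight own lo hi u v := by
  intro u hu v hv
  obtain ⟨i, hi', b, hb, rfl⟩ := G.exists_eq_offset_add hu
  obtain ⟨j, hj', b', hb', rfl⟩ := G.exists_eq_offset_add hv
  have := hG.diff i hi' j hj' b hb b' hb'
  have hbig := bigWeight_pos (G := G) (own := own) (lo := lo) (hi := hi)
  rw [weight, hL.own_eq i hi' b hb, hL.own_eq j hj' b' hb', hL.lo_eq i hi' b hb,
    hL.hi_eq i hi' b hb, hL.lo_eq j hj' b' hb', hL.hi_eq j hj' b' hb']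
  split_ifs <;> linarith

lemma energy_zero : G.energy own lo hi (fun _ => 0) = 0 := by simp [energy, cutEnergy]

/-- A set of nodes that is not closed downwards has positive energy. -/
lemma energy_pos (hL : G.IsLayout own lo hi) (hG : G.Submodular) {y : ℕ → ℝ}
    (hy : ∀ u < G.nodes, y u = 0 ∨ y u = 1) {i b : ℕ} (hi' : i < G.n) (hb : b + 1 < G.κ i)
    (h1 : y (G.offset i + (b + 1)) = 1) (h0 : y (G.offset i + b) = 0) :
    0 < G.energy own lo hi y := by
  have hu := G.offset_add_lt hi' hb
  have hv := G.offset_add_lt hi' (show b < G.κ i by omega)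
  have e1 : -∑ u ∈ Finset.range G.nodes, |G.coef own lo hi u| ≤
      ∑ u ∈ Finset.range G.nodes, G.coef own lo hi u * y u := by
    rw [← Finset.sum_neg_distrib]
    refine Finset.sum_le_sum fun u hu => ?_
    rcases hy u (Finset.mem_range.mp hu) with h | h <;> rw [h]
    · simp
    · rw [mul_one]; exact neg_abs_le _
  have hnn : ∀ u ∈ Finset.range G.nodes, ∀ v ∈ Finset.range G.nodes,
      0 ≤ G.weight own lo hi u v * (y u * (1 - y v)) := by
    intro u hu v hv
    rw [Finset.mem_range] at hu hv
    apply mul_nonneg (weight_nonneg hL hG u hu v hv)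
    rcases hy u hu with h3 | h3 <;> rcases hy v hv with h4 | h4 <;> simp [h3, h4]
  -- A single cut consistency arc already costs 1 more than all coefficients together can gain.
  have e2 : G.bigWeight own lo hi ≤ ∑ u ∈ Finset.range G.nodes, ∑ v ∈ Finset.range G.nodes,
      G.weight own lo hi u v * (y u * (1 - y v)) := by
    refine le_trans ?_ (Finset.single_le_sum (fun u hu => Finset.sum_nonneg (hnn u hu))
      (Finset.mem_range.mpr hu))
    refine le_trans ?_ (Finset.single_le_sum (hnn _ (Finset.mem_range.mpr hu))
      (Finset.mem_range.mpr hv))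
    rw [weight, hL.own_eq i hi' _ hb, hL.own_eq i hi' b (by omega), h0, h1, if_pos rfl,
      if_pos (by omega)]
    simp
  rw [energy, cutEnergy]
  rw [bigWeight] at e2
  linarith

/-- A minimizer of the energy encodes a grid point. -/
lemma exists_encodes (hL : G.IsLayout own lo hi) (hG : G.Submodular) {y : ℕ → ℝ}
    (hy : ∀ u < G.nodes, y u = 0 ∨ y u = 1)
    (hmin : G.energy own lo hi y ≤ G.energy own lo hi (fun _ => 0)) : ∃ a, G.Encodes a y := by
  classical
  rw [energy_zero] at hmin
  have hmono : ∀ i < G.n, ∀ b, b + 1 < G.κ i → y (G.offset i + b) = 0 →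
      y (G.offset i + (b + 1)) = 0 := by
    intro i hi' b hb h0
    by_contra h1
    have h1 := (hy _ (G.offset_add_lt hi' hb)).resolve_left h1
    linarith [energy_pos hL hG hy hi' hb h1 h0]
  -- The index of the point is the first node with value 0; the alternative b = κ i serves when all
  -- nodes of the variable have value 1.
  have hex : ∀ i, ∃ b, b = G.κ i ∨ y (G.offset i + b) = 0 := fun i => ⟨G.κ i, .inl rfl⟩
  refine ⟨fun i => Nat.find (hex i), fun i hi' => ⟨Nat.find_min' _ (.inl rfl), fun b hb => ?_⟩⟩
  split_ifs with h
  · have := Nat.find_min (hex i) h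
    push Not at this
    exact (hy _ (G.offset_add_lt hi' hb)).resolve_left this.2
  · have hspec := Nat.find_spec (hex i)
    push Not at h
    induction b, h using Nat.le_induction with
    | base => exact hspec.resolve_left (by omega)
    | succ b hle ih => exact hmono i hi' b hb (ih (by omega))

lemma exists_encoding (hL : G.IsLayout own lo hi) {a : ℕ → ℕ} (ha : ∀ i < G.n, a i ≤ G.κ i) :
    ∃ y, G.Encodes a y ∧ ∀ u, y u = 0 ∨ y u = 1 := by
  refine ⟨fun u => if u - G.offset (own u) < a (own u) then 1 else 0,
    fun i hi' => ⟨ha i hi', fun b hb => ?_⟩, fun u => ?_⟩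
  · simp only [hL.own_eq i hi' b hb, Nat.add_sub_cancel_left]
  · simp only; split_ifs <;> simp

/-- The minimizers of the energy encode minimizers of the objective function. -/
theorem encodes_isMin (hL : G.IsLayout own lo hi) (hG : G.Submodular) {y : ℕ → ℝ}
    (hmin : ∀ z : ℕ → ℝ, (∀ u, z u = 0 ∨ z u = 1) → G.energy own lo hi y ≤ G.energy own lo hi z)
    {a : ℕ → ℕ} (h : G.Encodes a y) {a' : ℕ → ℕ} (ha' : ∀ i < G.n, a' i ≤ G.κ i) :
    G.cost (fun i => G.pt i (a i)) ≤ G.cost (fun i => G.pt i (a' i)) := by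
  obtain ⟨z, hz, hz01⟩ := exists_encoding hL ha'
  have := hmin z hz01
  rw [energy_eq hL hG h, energy_eq hL hG hz] at this
  linarith

/-- The coordinates of the encoded point. -/
lemma Encodes.point_eq (hL : G.IsLayout own lo hi) {a : ℕ → ℕ} {y : ℕ → ℝ} (h : G.Encodes a y)
    {i : ℕ} (hi' : i < G.n) :
    G.pt i 0 + ∑ u ∈ Finset.range G.nodes, (if own u = i then (hi u - lo u) * y u else 0) =
      G.pt i (a i) := by
  rw [sum_nodes, Finset.sum_eq_single i]
  · obtain ⟨ha, hy⟩ := h i hi'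
    rw [Finset.sum_congr rfl fun b hb => ?_, sum_indicator_telescope (G.pt i) ha]
    · ring
    · rw [Finset.mem_range] at hb
      rw [hL.own_eq i hi' b hb, if_pos rfl, hL.hi_eq i hi' b hb, hL.lo_eq i hi' b hb, hy b hb]
  · intro j hj hji
    refine Finset.sum_eq_zero fun b hb => ?_
    rw [Finset.mem_range] at hj hb
    rw [hL.own_eq j hj b hb, if_neg hji]
  · intro h; simp at h; omega

end GridProblem

/-! ### The network of a binary energy -/

/-- The capacities of the network with source `K` and sink `K + 1`. -/
noncomputable def networkCap (K : ℕ) (w : ℕ → ℕ → ℝ) (c : ℕ → ℝ) (u v : Fin (K + 2)) : ℝ :=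
  if (u : ℕ) < K then
    if (v : ℕ) < K then w u v else if (v : ℕ) = K + 1 then max (c u) 0 else 0
  else if (u : ℕ) = K ∧ (v : ℕ) < K then max (-c v) 0 else 0

lemma networkCap_nonneg {K : ℕ} {w : ℕ → ℕ → ℝ} {c : ℕ → ℝ}
    (hw : ∀ u < K, ∀ v < K, 0 ≤ w u v) (u v : Fin (K + 2)) : 0 ≤ networkCap K w c u v := by
  unfold networkCap
  split_ifs with h1 h2
  · exact hw _ h1 _ h2
  all_goals simp

/-- A coefficient is split as c y = max(c, 0) y + max(-c, 0) (1 - y) - max(-c, 0): an arc to the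
sink, an arc from the source, and a constant. -/
lemma cutCapacity_networkCap {K : ℕ} (w : ℕ → ℕ → ℝ) (c : ℕ → ℝ) {S : Finset (Fin (K + 2))}
    {y : ℕ → ℝ} (hy : ∀ u : Fin (K + 2), y u = if u ∈ S then 1 else 0)
    (hs : y K = 1) (ht : y (K + 1) = 0) :
    cutCapacity (networkCap K w c) S =
      cutEnergy K w c y + ∑ u ∈ Finset.range K, max (-c u) 0 := by
  have h1 : cutCapacity (networkCap K w c) S =
      ∑ u : Fin (K + 2), ∑ v : Fin (K + 2), networkCap K w c u v * (y u * (1 - y v)) := by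
    rw [cutCapacity, ← Finset.sum_subset (Finset.subset_univ S)]
    · refine Finset.sum_congr rfl fun u hu => ?_
      rw [← Finset.sum_subset (Finset.subset_univ Sᶜ)]
      · refine Finset.sum_congr rfl fun v hv => ?_
        rw [Finset.mem_compl] at hv
        rw [hy, hy, if_pos hu, if_neg hv]; ring
      · intro v _ hv
        rw [Finset.mem_compl, not_not] at hv
        rw [hy v, if_pos hv]; ring
    · intro u _ hu
      refine Finset.sum_eq_zero fun v _ => ?_
      rw [hy u, if_neg hu]; ring
  have hn : ∀ u : Fin K, (u : ℕ) ≠ K + 1 := fun u => by have := u.2; omega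
  have hn' : ∀ u : Fin K, (u : ℕ) ≠ K := fun u => by have := u.2; omega
  rw [h1]
  simp only [Fin.sum_univ_castSucc, networkCap, Fin.val_castSucc, Fin.val_last, Fin.is_lt, if_true,
    hs, ht, lt_irrefl, if_false, hn, hn', false_and, true_and]
  simp only [Fin.sum_univ_eq_sum_range (fun v => max (-c v) 0 * (1 * (1 - y v))) K,
    fun u : Fin K => Fin.sum_univ_eq_sum_range (fun v => w u v * (y u * (1 - y v))) K]
  simp only [Finset.sum_add_distrib]
  simp [cutEnergy]
  simp only [Fin.sum_univ_eq_sum_range (fun u => ∑ v ∈ Finset.range K, w u v * (y u * (1 - y v))) K,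
    Fin.sum_univ_eq_sum_range (fun u => max (c u) 0 * y u) K]
  have : ∑ u ∈ Finset.range K, c u * y u + ∑ u ∈ Finset.range K, max (-c u) 0 =
      ∑ u ∈ Finset.range K, max (c u) 0 * y u + ∑ u ∈ Finset.range K, max (-c u) 0 * (1 - y u) := by
    rw [← Finset.sum_add_distrib, ← Finset.sum_add_distrib]
    refine Finset.sum_congr rfl fun u _ => ?_
    rcases le_total (c u) 0 with h | h
    · rw [max_eq_right h, max_eq_left (by linarith)]; ring
    · rw [max_eq_left h, max_eq_right (by linarith)]; ring
  linarith

open RealRAM (ofFin)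

namespace BinaryMRF

variable {n m : ℕ} (M : BinaryMRF n m)

/-! ### The discretized model as a grid problem -/

/-- The matrix of the edge weights, in the direction from source to target. -/
noncomputable def weightMatrix (i j : ℕ) : ℝ :=
  ∑ e, if (M.src e : ℕ) = i ∧ (M.tgt e : ℕ) = j then M.W e else 0

lemma weightMatrix_edge (e : Fin m) : M.weightMatrix (M.src e) (M.tgt e) = M.W e := by
  rw [weightMatrix, Finset.sum_eq_single e]
  · simp
  · intro e' _ hne
    rw [if_neg]
    rintro ⟨h1, h2⟩
    exact hne (M.edge_injective (Prod.ext (Fin.ext h1) (Fin.ext h2)))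
  · simp

lemma weightMatrix_eq_zero {i j : ℕ} (h : ∀ e, ¬((M.src e : ℕ) = i ∧ (M.tgt e : ℕ) = j)) :
    M.weightMatrix i j = 0 :=
  Finset.sum_eq_zero fun e _ => if_neg (h e)

lemma weightMatrix_diag (i : ℕ) : M.weightMatrix i i = 0 := by
  refine M.weightMatrix_eq_zero fun e h => ?_
  have := M.src_lt_tgt e
  rw [Fin.lt_def] at this
  omega

/-- The cost of a pair with weight `w`; pairs with `w = 0` are not edges. -/
noncomputable def matrixCost (w x y : ℝ) : ℝ := if 0 < w then pairCost w x y else 0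

lemma sum_matrixCost (hM : M.Attractive) (q : ℕ → ℝ) :
    ∑ i ∈ Finset.range n, ∑ j ∈ Finset.range n, matrixCost (M.weightMatrix i j) (q i) (q j) =
      ∑ e, pairCost (M.W e) (q (M.src e)) (q (M.tgt e)) := by
  rw [← Finset.sum_product']
  have hinj : Function.Injective fun e => ((M.src e : ℕ), (M.tgt e : ℕ)) := by
    intro e e' h
    simp only [Prod.mk.injEq] at h
    exact M.edge_injective (Prod.ext (Fin.ext h.1) (Fin.ext h.2))
  rw [← Finset.sum_subset (s₁ := Finset.univ.map ⟨_, hinj⟩)]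
  · rw [Finset.sum_map]
    refine Finset.sum_congr rfl fun e _ => ?_
    simp [weightMatrix_edge, matrixCost, hM e]
  · intro p hp
    simp only [Finset.mem_map, Finset.mem_univ, true_and, Function.Embedding.coeFn_mk] at hp
    obtain ⟨e, rfl⟩ := hp
    simp
  · intro p _ hp
    rw [weightMatrix_eq_zero]
    · simp [matrixCost]
    · intro e he
      apply hp
      simp only [Finset.mem_map, Finset.mem_univ, true_and, Function.Embedding.coeFn_mk]
      exact ⟨e, Prod.ext he.1 he.2⟩

/-- The minimization of the free energy over the simple mesh. -/
noncomputable def gridProblem (ε : ℝ) : GridProblem where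
  n := n
  κ := ofFin (M.meshCount ε)
  pt i k := ofFin (fun i => M.meshPoint ε i k) i
  φ i := unaryCost (ofFin M.θ i)
  f i j := matrixCost (M.weightMatrix i j)

lemma ofFin_val {α : Type} [Zero α] {k : ℕ} (f : Fin k → α) (i : Fin k) : ofFin f i = f i := by
  simp [ofFin]

variable {M}

lemma gridProblem_κ {ε : ℝ} {i : ℕ} (hi : i < n) :
    (M.gridProblem ε).κ i = M.meshCount ε ⟨i, hi⟩ := by
  simp [gridProblem, ofFin, hi]

lemma gridProblem_pt {ε : ℝ} {i k : ℕ} (hi : i < n) :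
    (M.gridProblem ε).pt i k = M.meshPoint ε ⟨i, hi⟩ k := by
  simp [gridProblem, ofFin, hi]

lemma Attractive.cost_eq (hM : M.Attractive) (ε : ℝ) (q : ℕ → ℝ) :
    (M.gridProblem ε).cost q = M.freeEnergy (fun i => q i) := by
  rw [freeEnergy_eq, GridProblem.cost]
  simp only [gridProblem]
  rw [sum_matrixCost M hM, ← Fin.sum_univ_eq_sum_range (fun i => unaryCost (ofFin M.θ i) (q i)) n,
    add_comm]
  simp only [ofFin_val]

lemma Attractive.submodular (hM : M.Attractive) {ε : ℝ} (hε : 0 < ε) :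
    (M.gridProblem ε).Submodular where
  diag i x y := by simp [gridProblem, weightMatrix_diag, matrixCost]
  diff i hi j hj b hb b' hb' := by
    have hi : i < n := hi
    have hj : j < n := hj
    rw [gridProblem_κ hi] at hb
    rw [gridProblem_κ hj] at hb'
    simp only [gridProblem_pt hi, gridProblem_pt hj]
    simp only [gridProblem, matrixCost]
    split_ifs with h
    · have hmem : ∀ (i : Fin n) k, M.meshPoint ε i k ∈ Set.Icc (0 : ℝ) 1 := fun i k =>
        hM.simpleMesh_subset hε i _ (hM.meshPoint_mem hε i k)
      have := edgeCost_decreasing_differences h (hmem ⟨i, hi⟩ b) (hmem ⟨i, hi⟩ (b + 1))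
        (hmem ⟨j, hj⟩ b') (hmem ⟨j, hj⟩ (b' + 1))
        (hM.meshPoint_strictMono hε (Nat.lt_succ_self b) hb).le
        (hM.meshPoint_strictMono hε (Nat.lt_succ_self b') hb').le
      -- The endpoint entropies depend on one argument each and cancel in the mixed difference.
      simp only [pairCost]
      linarith
    · simp

/-- A mesh of κ_i + 1 points needs only κ_i nodes. -/
lemma Attractive.nodes_add (hM : M.Attractive) {ε : ℝ} (hε : 0 < ε) :
    (M.gridProblem ε).nodes + n = meshSize (M.simpleMesh ε) := by
  simp only [meshSize, hM.card_simpleMesh hε, GridProblem.nodes, GridProblem.offset, gridProblem]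
  rw [← Fin.sum_univ_eq_sum_range (fun i => ofFin (M.meshCount ε) i) n]
  simp [ofFin_val, Finset.sum_add_distrib, add_comm]

lemma Attractive.mem_meshPoints_iff (hM : M.Attractive) {ε : ℝ} (hε : 0 < ε) {q : Fin n → ℝ} :
    q ∈ meshPoints (M.simpleMesh ε) ↔ ∃ a : ℕ → ℕ,
      (∀ i < (M.gridProblem ε).n, a i ≤ (M.gridProblem ε).κ i) ∧
        q = fun i : Fin n => (M.gridProblem ε).pt i (a i) := by
  constructor
  · intro hq
    have : ∀ i, ∃ k ≤ M.meshCount ε i, M.meshPoint ε i k = q i := by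
      intro i
      have := hq i
      rw [simpleMesh_eq, Finset.mem_image] at this
      obtain ⟨k, hk, h⟩ := this
      exact ⟨k, by rw [Finset.mem_range] at hk; omega, h⟩
    choose k hk hkq using this
    refine ⟨ofFin k, fun i hi => ?_, funext fun i => ?_⟩
    · have hi : i < n := hi
      simpa [gridProblem, ofFin, hi] using hk ⟨i, hi⟩
    · simp [gridProblem, ofFin_val, hkq]
  · rintro ⟨a, _, rfl⟩ i
    simp only [gridProblem, ofFin_val]
    exact hM.meshPoint_mem hε i _

lemma Attractive.gridProblem_pt_strictMono (hM : M.Attractive) {ε : ℝ} (hε : 0 < ε) {i k k' : ℕ}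
    (hi : i < n) (h : k < k') (hk' : k' ≤ (M.gridProblem ε).κ i) :
    (M.gridProblem ε).pt i k < (M.gridProblem ε).pt i k' := by
  rw [gridProblem_pt hi, gridProblem_pt hi]
  rw [gridProblem_κ hi] at hk'
  exact hM.meshPoint_strictMono hε h hk'

/-- The discretized problem is a minimum cut problem. -/
theorem Attractive.graphCutSolvable (hM : M.Attractive) {ε : ℝ} (hε : 0 < ε) :
    GraphCutSolvable M.freeEnergy (meshPoints (M.simpleMesh ε))
      (meshSize (M.simpleMesh ε) + 2) := by
  classical
  set G := M.gridProblem ε with hGdef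
  have hG : G.Submodular := hM.submodular hε
  obtain ⟨own, lo, hi, hL⟩ := G.exists_isLayout
  have hw := GridProblem.weight_nonneg hL hG
  -- A node lies on the source side when its interval lies below the coordinate of its owner. Number
  -- `G.nodes` is the source and `G.nodes + 1` the sink.
  set y : (Fin n → ℝ) → ℕ → ℝ := fun q u =>
    if u = G.nodes ∨ (u < G.nodes ∧ hi u ≤ ofFin q (own u)) then 1 else 0 with hydef
  set enc : (Fin n → ℝ) → Finset (Fin (G.nodes + 2)) := fun q =>
    Finset.univ.filter fun u => y q u = 1 with hencdef
  have hyenc : ∀ q (u : Fin (G.nodes + 2)), y q u = if u ∈ enc q then 1 else 0 := by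
    intro q u
    by_cases h : y q u = 1
    · simp [hencdef, h]
    · have : y q u = 0 := by
        simp only [hydef] at h ⊢
        split_ifs at h ⊢
        · exact absurd rfl h
        · rfl
      simp [hencdef, this]
  have hys : ∀ q, y q G.nodes = 1 := fun q => by simp [hydef]
  have hyt : ∀ q, y q (G.nodes + 1) = 0 := fun q => by simp [hydef]
  have hcode : ∀ a : ℕ → ℕ, (∀ i < G.n, a i ≤ G.κ i) →
      G.Encodes a (y fun i : Fin n => G.pt i (a i)) := by
    intro a ha i hi'
    refine ⟨ha i hi', fun b hb => ?_⟩
    have hlt := G.offset_add_lt hi' hb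
    have hin : i < n := hi'
    simp only [hydef, hL.own_eq i hi' b hb, hL.hi_eq i hi' b hb, hlt, hlt.ne, true_and, false_or,
      ofFin, hin, dite_true]
    congr 1
    rw [eq_iff_iff]
    constructor
    · intro h
      by_contra hba
      exact absurd h (not_le.mpr
        (hM.gridProblem_pt_strictMono hε hin (show a i < b + 1 by omega) hb))
    · intro h
      rcases Nat.lt_or_ge (b + 1) (a i) with h' | h'
      · exact (hM.gridProblem_pt_strictMono hε hin h' (ha i hi')).le
      · rw [show a i = b + 1 by omega]
  have hcost : ∀ a : ℕ → ℕ, (∀ i < G.n, a i ≤ G.κ i) →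
      cutCapacity (networkCap G.nodes (G.weight own lo hi) (G.coef own lo hi))
        (enc fun i : Fin n => G.pt i (a i)) = M.freeEnergy (fun i : Fin n => G.pt i (a i)) +
        (∑ u ∈ Finset.range G.nodes, max (-G.coef own lo hi u) 0 -
          G.cost fun i => G.pt i 0) := by
    intro a ha
    rw [cutCapacity_networkCap _ _ (hyenc _) (hys _) (hyt _)]
    have := GridProblem.energy_eq hL hG (hcode a ha)
    rw [GridProblem.energy] at this
    rw [this, hM.cost_eq]
    ring
  refine ⟨G.nodes + 2, ?_, networkCap G.nodes (G.weight own lo hi) (G.coef own lo hi),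
    ⟨G.nodes, by omega⟩, ⟨G.nodes + 1, by omega⟩,
    ∑ u ∈ Finset.range G.nodes, max (-G.coef own lo hi u) 0 - G.cost fun i => G.pt i 0, enc, ?_, networkCap_nonneg hw, ?_, ?_, ?_⟩
  · have : G.nodes + n = meshSize (M.simpleMesh ε) := hM.nodes_add hε
    omega
  · simp
  · intro q hq q' hq' h
    obtain ⟨a, ha, rfl⟩ := (hM.mem_meshPoints_iff hε).mp hq
    obtain ⟨a', ha', rfl⟩ := (hM.mem_meshPoints_iff hε).mp hq'
    have hyy : ∀ u < G.nodes, y (fun i : Fin n => G.pt i (a i)) u =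
        y (fun i : Fin n => G.pt i (a' i)) u := by
      intro u hu
      have h1 := hyenc (fun i : Fin n => G.pt i (a i)) ⟨u, by omega⟩
      have h2 := hyenc (fun i : Fin n => G.pt i (a' i)) ⟨u, by omega⟩
      rw [h] at h1
      exact h1.trans h2.symm
    -- By `point_eq` the cut determines each coordinate, as the lowest mesh point plus the lengths
    -- of the selected intervals.
    funext i
    have hi' : (i : ℕ) < G.n := i.2
    have h1 := GridProblem.Encodes.point_eq hL (hcode a ha) hi'
    have h2 := GridProblem.Encodes.point_eq hL (hcode a' ha') hi'
    refine h1.symm.trans (Eq.trans ?_ h2)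
    congr 1
    refine Finset.sum_congr rfl fun u hu => ?_
    rw [hyy u (Finset.mem_range.mp hu)]
  · intro q hq
    obtain ⟨a, ha, rfl⟩ := (hM.mem_meshPoints_iff hε).mp hq
    refine ⟨?_, ?_, hcost a ha⟩
    · simp [hencdef, hys]
    · simp [hencdef, hyt]
  · intro S hS
    set z : ℕ → ℝ := fun u => if h : u < G.nodes + 2 then
      (if (⟨u, h⟩ : Fin (G.nodes + 2)) ∈ S then 1 else 0) else 0 with hz
    have hzS : ∀ u : Fin (G.nodes + 2), z u = if u ∈ S then 1 else 0 := fun u => by simp [hz]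
    have hz01 : ∀ u, z u = 0 ∨ z u = 1 := by
      intro u; simp only [hz]; split_ifs <;> simp
    have hzs : z G.nodes = 1 := by
      have := hzS ⟨G.nodes, by omega⟩
      rw [if_pos hS.1.1] at this
      exact this
    have hzt : z (G.nodes + 1) = 0 := by
      have := hzS ⟨G.nodes + 1, by omega⟩
      rw [if_neg hS.1.2] at this
      exact this
    have hmin : ∀ a : ℕ → ℕ, (∀ i < G.n, a i ≤ G.κ i) →
        G.energy own lo hi z ≤ G.energy own lo hi (y fun i : Fin n => G.pt i (a i)) := by
      intro a ha
      have h1 := hS.2 (enc fun i : Fin n => G.pt i (a i)) (by simp [hencdef, hys])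
        (by simp [hencdef, hyt])
      rw [cutCapacity_networkCap _ _ hzS hzs hzt,
        cutCapacity_networkCap _ _ (hyenc _) (hys _) (hyt _)] at h1
      simp only [GridProblem.energy]
      linarith
    -- The lowest mesh point has energy 0, like the empty set, so a minimum cut satisfies the
    -- hypothesis of `exists_encodes`.
    have hzero : G.energy own lo hi (y fun i : Fin n => G.pt i 0) =
        G.energy own lo hi (fun _ => 0) := by
      rw [GridProblem.energy_eq hL hG (hcode (fun _ => 0) (by simp)), GridProblem.energy_zero]
      ring
    obtain ⟨a, ha⟩ := GridProblem.exists_encodes hL hG (fun u _ => hz01 u)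
      ((hmin (fun _ => 0) (by simp)).trans hzero.le)
    have ha' : ∀ i < G.n, a i ≤ G.κ i := fun i hi => (ha i hi).1
    refine ⟨fun i => G.pt i (a i), (hM.mem_meshPoints_iff hε).mpr ⟨a, ha', rfl⟩, ?_⟩
    ext u
    have hzy : z u = y (fun i : Fin n => G.pt i (a i)) u := by
      rcases lt_trichotomy (u : ℕ) G.nodes with hu | hu | hu
      · obtain ⟨i, hi', b, hb, he⟩ := G.exists_eq_offset_add hu
        rw [he, (ha i hi').2 b hb, (hcode a ha' i hi').2 b hb]
      · rw [hu, hzs, hys]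
      · rw [show (u : ℕ) = G.nodes + 1 by omega, hzt, hyt]
    rw [hzS, hyenc] at hzy
    by_cases h1 : u ∈ S <;> by_cases h2 : u ∈ enc (fun i : Fin n => G.pt i (a i))
    · exact ⟨fun _ => h2, fun _ => h1⟩
    · rw [if_pos h1, if_neg h2] at hzy; exact absurd hzy one_ne_zero
    · rw [if_neg h1, if_pos h2] at hzy; exact absurd hzy zero_ne_one
    · exact ⟨fun h => absurd h h1, fun h => absurd h h2⟩

end BinaryMRF

/-! ### Reasoning about real RAM programs -/

namespace RealRAM

/-- The natural-number arrays that a program writes. -/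
def Program.natWrites : Program → List ℕ
  | skip => []
  | writeNat a _ _ => [a]
  | writeReal _ _ _ => []
  | seq p p' => p.natWrites ++ p'.natWrites
  | cond _ p p' => p.natWrites ++ p'.natWrites
  | loop _ p => p.natWrites

/-- The real arrays that a program writes. -/
def Program.realWrites : Program → List ℕ
  | skip => []
  | writeNat _ _ _ => []
  | writeReal a _ _ => [a]
  | seq p p' => p.realWrites ++ p'.realWrites
  | cond _ p p' => p.realWrites ++ p'.realWrites
  | loop _ p => p.realWrites

/-- The two memories agree on the arrays that the program does not write. -/
structure Agree (p : Program) (σ σ' : Memory) : Prop where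
  nat : ∀ a, a ∉ p.natWrites → σ'.nat a = σ.nat a
  real : ∀ a, a ∉ p.realWrites → σ'.real a = σ.real a

lemma Agree.refl (p : Program) (σ : Memory) : Agree p σ σ := ⟨fun _ _ => rfl, fun _ _ => rfl⟩

lemma Agree.trans {p : Program} {σ σ₁ σ₂ : Memory} (h : Agree p σ σ₁) (h' : Agree p σ₁ σ₂) :
    Agree p σ σ₂ :=
  ⟨fun a ha => (h'.nat a ha).trans (h.nat a ha), fun a ha => (h'.real a ha).trans (h.real a ha)⟩

lemma Agree.mono {p p' : Program} {σ σ' : Memory} (h : Agree p σ σ')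
    (hn : p.natWrites ⊆ p'.natWrites) (hr : p.realWrites ⊆ p'.realWrites) : Agree p' σ σ' :=
  ⟨fun a ha => h.nat a fun h => ha (hn h), fun a ha => h.real a fun h => ha (hr h)⟩

namespace Memory

variable (σ : Memory) (a b k x : ℕ) (y : ℝ)

@[simp] lemma setNat_nat_self : (σ.setNat a k x).nat a = Function.update (σ.nat a) k x := by
  simp [setNat]

@[simp] lemma setNat_nat_of_ne {a b : ℕ} (h : b ≠ a) : (σ.setNat a k x).nat b = σ.nat b := by
  simp [setNat, h]

@[simp] lemma setNat_real : (σ.setNat a k x).real = σ.real := rfl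

@[simp] lemma setReal_real_self : (σ.setReal a k y).real a = Function.update (σ.real a) k y := by
  simp [setReal]

@[simp] lemma setReal_real_of_ne {a b : ℕ} (h : b ≠ a) : (σ.setReal a k y).real b = σ.real b := by
  simp [setReal, h]

@[simp] lemma setReal_nat : (σ.setReal a k y).nat = σ.nat := rfl

end Memory

lemma Exec.agree {p : Program} {σ σ' : Memory} {t : ℕ} (h : Exec p σ t σ') : Agree p σ σ' := by
  induction h with
  | skip σ => exact Agree.refl _ _
  | writeNat σ a k x =>
    refine ⟨fun b hb => ?_, fun _ _ => rfl⟩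
    simp only [Program.natWrites, List.mem_singleton] at hb
    exact Memory.setNat_nat_of_ne _ _ _ hb
  | writeReal σ a k x =>
    refine ⟨fun _ _ => rfl, fun b hb => ?_⟩
    simp only [Program.realWrites, List.mem_singleton] at hb
    exact Memory.setReal_real_of_ne _ _ _ hb
  | seq _ _ ih ih' =>
    exact (ih.mono (by simp [Program.natWrites]) (by simp [Program.realWrites])).trans
      (ih'.mono (by simp [Program.natWrites]) (by simp [Program.realWrites]))
  | condTrue _ _ ih => exact ih.mono (by simp [Program.natWrites]) (by simp [Program.realWrites])
  | condFalse _ _ ih => exact ih.mono (by simp [Program.natWrites]) (by simp [Program.realWrites])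
  | loopTrue _ _ _ ih ih' => exact Agree.trans ⟨ih.nat, ih.real⟩ ih'
  | loopFalse _ => exact Agree.refl _ _

/-- The program halts within `T` steps in a memory that satisfies `Q`. -/
def Runs (p : Program) (σ : Memory) (T : ℕ) (Q : Memory → Prop) : Prop :=
  ∃ t σ', Exec p σ t σ' ∧ t ≤ T ∧ Q σ'

lemma Runs.mono {p : Program} {σ : Memory} {T T' : ℕ} {Q Q' : Memory → Prop} (h : Runs p σ T Q)
    (hT : T ≤ T') (hQ : ∀ σ', Agree p σ σ' → Q σ' → Q' σ') : Runs p σ T' Q' := by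
  obtain ⟨t, σ', he, ht, hq⟩ := h
  exact ⟨t, σ', he, ht.trans hT, hQ σ' he.agree hq⟩

lemma Runs.seq {p p' : Program} {σ : Memory} {T T' : ℕ} {Q Q' : Memory → Prop} (h : Runs p σ T Q)
    (h' : ∀ σ', Agree p σ σ' → Q σ' → Runs p' σ' T' Q') : Runs (.seq p p') σ (T + T') Q' := by
  obtain ⟨t, σ', he, ht, hq⟩ := h
  obtain ⟨t', σ'', he', ht', hq'⟩ := h' σ' he.agree hq
  exact ⟨t + t', σ'', .seq he he', add_le_add ht ht', hq'⟩

/-- The weakest precondition of a program without loops. -/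
def Program.wp : Program → (Memory → Prop) → Memory → Prop
  | skip, Q, σ => Q σ
  | writeNat a k x, Q, σ => Q (σ.setNat a (k.eval σ) (x.eval σ))
  | writeReal a k x, Q, σ => Q (σ.setReal a (k.eval σ) (x.eval σ))
  | seq p p', Q, σ => p.wp (p'.wp Q) σ
  | cond b p p', Q, σ => (b.Holds σ → p.wp Q σ) ∧ (¬ b.Holds σ → p'.wp Q σ)
  | loop _ _, _, _ => False

/-- A bound on the number of steps of a program without loops. -/
def Program.maxCost : Program → ℕ
  | skip => 1
  | writeNat _ k x => k.cost + x.cost + 1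
  | writeReal _ k x => k.cost + x.cost + 1
  | seq p p' => p.maxCost + p'.maxCost
  | cond b p p' => b.cost + (p.maxCost + p'.maxCost)
  | loop _ _ => 0

/-- For conditionals `maxCost` adds the costs of both branches; only constants matter. -/
lemma runs_of_wp {p : Program} {σ : Memory} {Q : Memory → Prop} (h : p.wp Q σ) :
    Runs p σ p.maxCost Q := by
  induction p generalizing σ Q with
  | skip => exact ⟨_, _, .skip σ, le_rfl, h⟩
  | writeNat a k x => exact ⟨_, _, .writeNat σ a k x, le_rfl, h⟩
  | writeReal a k x => exact ⟨_, _, .writeReal σ a k x, le_rfl, h⟩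
  | seq p p' ih ih' => exact (ih h).seq fun σ' _ h' => ih' h'
  | cond b p p' ih ih' =>
    by_cases hb : b.Holds σ
    · obtain ⟨t, σ', he, ht, hq⟩ := ih (h.1 hb)
      exact ⟨_, σ', .condTrue hb he, by simp only [Program.maxCost]; omega, hq⟩
    · obtain ⟨t, σ', he, ht, hq⟩ := ih' (h.2 hb)
      exact ⟨_, σ', .condFalse hb he, by simp only [Program.maxCost]; omega, hq⟩
  | loop b p _ => exact h.elim

/-- A loop with a variant: `I k` holds whenever `k` bounds the number of remaining iterations. -/
theorem runs_loop_variant {b : Test} {p : Program} {σ : Memory} {T k : ℕ}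
    (I : ℕ → Memory → Prop) (h0 : I k σ)
    (hstep : ∀ k σ', Agree p σ σ' → I k σ' → b.Holds σ' →
      Runs p σ' T (fun σ'' => ∃ k' < k, I k' σ'')) :
    Runs (.loop b p) σ (k * (b.cost + T) + b.cost) (fun σ' => ∃ k, I k σ' ∧ ¬ b.Holds σ') := by
  suffices ∀ k σ', Agree p σ σ' → I k σ' →
      Runs (.loop b p) σ' (k * (b.cost + T) + b.cost) (fun σ' => ∃ k, I k σ' ∧ ¬ b.Holds σ') from
    this k σ (Agree.refl _ _) h0
  intro k
  induction k using Nat.strong_induction_on with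
  | _ k ih =>
    intro σ' hA hI
    by_cases hb : b.Holds σ'
    · obtain ⟨t, σ'', he, ht, k', hk', hI'⟩ := hstep k σ' hA hI hb
      obtain ⟨t', σ₃, he', ht', hQ⟩ := ih k' hk' σ'' (hA.trans he.agree) hI'
      refine ⟨_, σ₃, .loopTrue hb he he', ?_, hQ⟩
      have : (k' + 1) * (b.cost + T) ≤ k * (b.cost + T) := Nat.mul_le_mul_right _ hk'
      rw [add_mul, one_mul] at this
      omega
    · exact ⟨_, σ', .loopFalse hb, by omega, k, hI, hb⟩

/-- A loop with a known number of iterations. -/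
theorem runs_loop_count {b : Test} {p : Program} {σ : Memory} {N : ℕ} {T : ℕ → ℕ}
    (I : ℕ → Memory → Prop) (h0 : I 0 σ)
    (hstep : ∀ j < N, ∀ σ', Agree p σ σ' → I j σ' → b.Holds σ' ∧ Runs p σ' (T j) (I (j + 1)))
    (hend : ∀ σ', Agree p σ σ' → I N σ' → ¬ b.Holds σ') :
    Runs (.loop b p) σ (∑ j ∈ Finset.range N, (b.cost + T j) + b.cost) (I N) := by
  suffices ∀ r j σ', j + r = N → Agree p σ σ' → I j σ' →
      Runs (.loop b p) σ' (∑ i ∈ Finset.Ico j N, (b.cost + T i) + b.cost) (I N) by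
    have h := this N 0 σ (by omega) (Agree.refl _ _) h0
    rwa [← Finset.range_eq_Ico] at h
  intro r
  induction r with
  | zero =>
    intro j σ' hj hA hI
    obtain rfl : j = N := by omega
    exact ⟨_, σ', .loopFalse (hend σ' hA hI), by simp, hI⟩
  | succ r ih =>
    intro j σ' hj hA hI
    obtain ⟨hb, t, σ'', he, ht, hI'⟩ := hstep j (by omega) σ' hA hI
    obtain ⟨t', σ₃, he', ht', hQ⟩ := ih (j + 1) σ'' (by omega) (hA.trans he.agree) hI'
    refine ⟨_, σ₃, .loopTrue hb he he', ?_, hQ⟩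
    rw [Finset.sum_eq_sum_Ico_succ_bot (by omega)]
    omega

/-- Cell `0` of a natural-number array. -/
abbrev NatExpr.var (a : ℕ) : NatExpr := .read a (.const 0)

/-- Cell `0` of a real array. -/
abbrev RealExpr.var (a : ℕ) : RealExpr := .read a (.const 0)

/-- `for c = 0, …, bound - 1 do p`, where the counter is cell `0` of array `c`. -/
def Program.forLoop (c : ℕ) (bound : NatExpr) (p : Program) : Program :=
  .seq (.writeNat c (.const 0) (.const 0))
    (.loop (.natLT (.var c) bound)
      (.seq p (.writeNat c (.const 0) (.add (.var c) (.const 1)))))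

/-- The rule for `for` loops. -/
theorem runs_forLoop {c : ℕ} {bound : NatExpr} {p : Program} {σ : Memory} {N : ℕ} {T : ℕ → ℕ}
    (I : ℕ → Memory → Prop) (hc : c ∉ p.natWrites)
    (hI : ∀ j σ k, I j σ → I j (σ.setNat c 0 k)) (h0 : I 0 σ)
    (hbound : ∀ σ', Agree (Program.forLoop c bound p) σ σ' → bound.eval σ' = N)
    (hstep : ∀ j < N, ∀ σ', Agree (Program.forLoop c bound p) σ σ' → σ'.nat c 0 = j → I j σ' →
      Runs p σ' (T j) (I (j + 1))) :
    Runs (Program.forLoop c bound p) σ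
      (∑ j ∈ Finset.range N, (bound.cost + 9 + T j) + (bound.cost + 9)) (I N) := by
  have hset : ∀ σ k, Agree (Program.forLoop c bound p) σ (σ.setNat c 0 k) := by
    intro σ k
    refine ⟨fun a ha => Memory.setNat_nat_of_ne _ _ _ ?_, fun _ _ => rfl⟩
    simp [Program.forLoop, Program.natWrites] at ha
    tauto
  have hsub : ∀ {σ σ'}, Agree (.seq p (.writeNat c (.const 0) (.add (.var c) (.const 1)))) σ σ' →
      Agree (Program.forLoop c bound p) σ σ' := fun h =>
    h.mono (by simp [Program.forLoop, Program.natWrites])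
      (by simp [Program.forLoop, Program.realWrites])
  have key := runs_loop_count (b := .natLT (.var c) bound)
    (p := .seq p (.writeNat c (.const 0) (.add (.var c) (.const 1)))) (σ := σ.setNat c 0 0)
    -- The increment of the counter costs 6 and the test 3 more than the bound expression, which
    -- gives the 9. The same 9 after the sum covers the initialization (3) and the final test.
    (N := N) (T := fun j => T j + 6)
    (fun j σ' => I j σ' ∧ σ'.nat c 0 = j) ⟨hI _ _ _ h0, by simp⟩
    (fun j hj σ' hA hIj => by
      have hA' := (hset σ 0).trans (hsub hA)
      refine ⟨?_, ?_⟩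
      · simp only [Test.Holds, NatExpr.eval]
        rw [hbound σ' hA', hIj.2]; exact hj
      · refine (hstep j hj σ' hA' hIj.2 hIj.1).seq fun σ'' hA'' hI'' => ?_
        refine (runs_of_wp (p := .writeNat c (.const 0) (.add (.var c) (.const 1))) ?_).mono
          (by simp [Program.maxCost, NatExpr.cost]) fun _ _ h => h
        simp only [Program.wp, NatExpr.eval]
        refine ⟨hI _ _ _ hI'', ?_⟩
        rw [hA''.nat c hc, hIj.2]
        simp)
    (fun σ' hA hIN => by
      simp only [Test.Holds, NatExpr.eval]
      rw [hbound σ' ((hset σ 0).trans (hsub hA)), hIN.2]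
      exact lt_irrefl N)
  obtain ⟨t, σ', he, ht, hQ⟩ := key
  refine ⟨_, σ', .seq (.writeNat σ c (.const 0) (.const 0)) he, ?_, hQ.1⟩
  have : ∑ j ∈ Finset.range N, ((Test.natLT (.var c) bound).cost + (T j + 6)) =
      ∑ j ∈ Finset.range N, (bound.cost + 9 + T j) :=
    Finset.sum_congr rfl fun j _ => by simp only [Test.cost, NatExpr.cost]; ring
  rw [this] at ht
  simp only [Test.cost, NatExpr.cost] at ht ⊢
  omega

/-- The rule for `for` loops whose bodies have no loops. -/
theorem runs_forLoop_wp {c : ℕ} {bound : NatExpr} {p : Program} {σ : Memory} {N : ℕ}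
    (I : ℕ → Memory → Prop) (hc : c ∉ p.natWrites)
    (hI : ∀ j σ k, I j σ → I j (σ.setNat c 0 k)) (h0 : I 0 σ)
    (hbound : ∀ σ', Agree (Program.forLoop c bound p) σ σ' → bound.eval σ' = N)
    (hstep : ∀ j < N, ∀ σ', Agree (Program.forLoop c bound p) σ σ' → σ'.nat c 0 = j → I j σ' →
      p.wp (I (j + 1)) σ') :
    Runs (Program.forLoop c bound p) σ ((bound.cost + 9 + p.maxCost) * (N + 1)) (I N) := by
  refine (runs_forLoop I hc hI h0 hbound
    (fun j hj σ' hA hcj hIj => runs_of_wp (hstep j hj σ' hA hcj hIj))).mono ?_ fun _ _ h => h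
  simp only [Finset.sum_const, Finset.card_range, smul_eq_mul]
  nlinarith

end RealRAM

open RealRAM BinaryMRF

/-! ### The algorithm

The natural-number arrays of the program are: `0` to `2` input, `3` the multiples of `n`, `4` the
owners of the nodes, `5` the multiples of the number of nodes, `6` the labels, `7` the current arcs,
`8` the marked labels, `10` and `11` loop counters, `12` the number of nodes, `13` the number of
sweeps, `14` the vertex in turn, `15` the threshold.
The real arrays are: `0` to `2` input, `3` the weight matrix, `4` the bounds `D i`, `5` and `6` the
ends of the Bethe box, `7` and `8` the ends of the intervals of the nodes, `9` the coefficients and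
`10` the weights of the cut problem, `11` the minimizer, `20` the number `n`, `21` the current mesh
point, `22` the weight of the consistency arcs, `23` the value of the free energy, `24` the amount of a
push. -/

namespace BetheRAM

/-- `-x log x - (1 - x) log (1 - x)`. -/
def entropyExpr (x : RealExpr) : RealExpr :=
  .sub (.sub (.const 0) (.mul x (.log x))) (.mul (.sub (.const 1) x) (.log (.sub (.const 1) x)))

/-- `-θ x - S(x)`. -/
def unaryExpr (θ x : RealExpr) : RealExpr := .sub (.sub (.const 0) (.mul θ x)) (entropyExpr x)

/-- The formula for `xi`, with the square root as `exp (log · / 2)`. -/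
def xiExpr (w x y : RealExpr) : RealExpr :=
  let α : RealExpr := .sub (.exp w) (.const 1)
  let b : RealExpr := .add (.const 1) (.mul α (.add x y))
  let disc : RealExpr := .sub (.mul b b) (.mul (.mul (.const 4) α) (.mul (.exp w) (.mul x y)))
  .div (.sub b (.exp (.div (.log disc) (.const 2)))) (.mul (.const 2) α)

/-- `x log x`. -/
def mulLogExpr (x : RealExpr) : RealExpr := .mul x (.log x)

/-- The cost of an edge, including the entropies of its endpoints. -/
def pairExpr (w x y : RealExpr) : RealExpr :=
  let z := xiExpr w x y
  .add (.add (.add (.sub (.const 0) (.mul w z))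
    (.add (.add (mulLogExpr (.sub (.sub (.add (.const 1) z) x) y)) (mulLogExpr (.sub y z)))
      (.add (mulLogExpr (.sub x z)) (mulLogExpr z)))) (entropyExpr x)) (entropyExpr y)

/-- `1 / (1 + exp (-x))`. -/
def sigmoidExpr (x : RealExpr) : RealExpr :=
  .div (.const 1) (.add (.const 1) (.exp (.sub (.const 0) x)))

variable (σ : Memory)

/-- Valid at 0 and 1 too, since `Real.log 0 = 0` realizes the convention 0 log 0 = 0. -/
lemma eval_entropyExpr (x : RealExpr) :
    (entropyExpr x).eval σ = Real.binEntropy (x.eval σ) := by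
  simp only [entropyExpr, RealExpr.eval, binEntropy_eq, Real.negMulLog, Rat.cast_zero, Rat.cast_one]
  ring

lemma eval_unaryExpr (θ x : RealExpr) :
    (unaryExpr θ x).eval σ = unaryCost (θ.eval σ) (x.eval σ) := by
  simp only [unaryExpr, RealExpr.eval, eval_entropyExpr, unaryCost, Rat.cast_zero, zero_sub]

lemma eval_sigmoidExpr (x : RealExpr) :
    (sigmoidExpr x).eval σ = Real.sigmoid (x.eval σ) := by
  simp [sigmoidExpr, RealExpr.eval, Real.sigmoid_def]

lemma exp_half_log {x : ℝ} (hx : 0 < x) : Real.exp (Real.log x / 2) = √x := by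
  rw [Real.exp_half, Real.exp_log hx]

lemma eval_xiExpr {w x y : RealExpr} (hw : 0 < w.eval σ) (hx : x.eval σ ∈ Set.Icc (0 : ℝ) 1)
    (hy : y.eval σ ∈ Set.Icc (0 : ℝ) 1) :
    (xiExpr w x y).eval σ = xi (w.eval σ) (x.eval σ) (y.eval σ) := by
  have hd := one_le_disc hw hx hy
  simp only [xiExpr, RealExpr.eval, xi, Rat.cast_one, Rat.cast_ofNat]
  rw [exp_half_log]
  · congr 4 <;> ring
  · refine lt_of_lt_of_le one_pos (hd.trans (le_of_eq ?_))
    ring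

lemma eval_pairExpr {w x y : RealExpr} (hw : 0 < w.eval σ) (hx : x.eval σ ∈ Set.Icc (0 : ℝ) 1)
    (hy : y.eval σ ∈ Set.Icc (0 : ℝ) 1) :
    (pairExpr w x y).eval σ = pairCost (w.eval σ) (x.eval σ) (y.eval σ) := by
  simp only [pairExpr, mulLogExpr, RealExpr.eval, eval_xiExpr σ hw hx hy, eval_entropyExpr, pairCost,
    edgeCost, pairEntropy_pairMarginal, Real.negMulLog, Rat.cast_one, Rat.cast_zero]
  ring

variable {σ}

/-- Row-major indices are injective. -/
lemma rowMajor_inj {n a b a' b' : ℕ} (hb : b < n) (hb' : b' < n) :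
    a * n + b = a' * n + b' ↔ a = a' ∧ b = b' := by
  constructor
  · intro h
    have hn : 0 < n := by omega
    have h1 := congrArg (· / n) h
    have h2 := congrArg (· % n) h
    simp only [mul_comm _ n, Nat.mul_add_div hn, Nat.mul_add_mod, Nat.div_eq_of_lt hb,
      Nat.div_eq_of_lt hb', Nat.mod_eq_of_lt hb, Nat.mod_eq_of_lt hb', add_zero] at h1 h2
    exact ⟨h1, h2⟩
  · rintro ⟨rfl, rfl⟩; rfl

/-! #### The weight matrix -/

/-- Computes `n` as a real number and the multiples of `n`. -/
def rowProgram : Program :=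
  .forLoop 10 (.read 0 (.const 0)) (.seq
    (.writeReal 20 (.const 0) (.add (.var 20) (.const 1)))
    (.writeNat 3 (.add (.var 10) (.const 1)) (.add (.read 3 (.var 10)) (.read 0 (.const 0)))))

/-- The machine neither multiplies natural numbers nor converts them to reals. So the row offsets i
n are tabulated by repeated addition, and n is obtained as a real by counting. Here and below the
constant is chosen before the model, as uniformity requires. -/
lemma runs_rowProgram : ∃ C, ∀ {n : ℕ} {σ : Memory}, σ.nat 0 0 = n → σ.real 20 0 = 0 →
    σ.nat 3 0 = 0 → Runs rowProgram σ (C * (n + 1))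
      (fun σ' => σ'.real 20 0 = n ∧ ∀ i ≤ n, σ'.nat 3 i = i * n) := by
  refine ⟨_, fun {n σ} hn h20 h3 => runs_forLoop_wp
    (fun j σ' => σ'.real 20 0 = j ∧ ∀ i ≤ j, σ'.nat 3 i = i * n) (by decide)
    (fun _ _ _ h => h) ⟨by simpa using h20, by simpa using h3⟩ ?_ ?_⟩
  · intro σ' hA
    simp only [NatExpr.eval, hA.nat 0 (by decide), hn]
  · intro j _ σ' hA hj ⟨hI1, hI2⟩
    have hn' : σ'.nat 0 0 = n := by rw [hA.nat 0 (by decide), hn]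
    simp only [Program.wp, NatExpr.eval, RealExpr.eval]
    refine ⟨by simp [hI1], fun i hi => ?_⟩
    simp only [Memory.setNat_nat_self, Memory.setReal_nat, hj, hn']
    rw [Function.update_apply]
    split_ifs with h
    · rw [h, hI2 j le_rfl, add_mul, one_mul]
    · exact hI2 i (by omega)

/-- Computes the weight matrix and the sums of the weights at the vertices. -/
def weightProgram : Program :=
  .forLoop 10 (.read 0 (.const 1)) (.seq
    (.writeReal 3 (.add (.read 3 (.read 1 (.var 10))) (.read 2 (.var 10)))
      (.add (.read 3 (.add (.read 3 (.read 1 (.var 10))) (.read 2 (.var 10)))) (.read 2 (.var 10))))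
    (.seq
      (.writeReal 4 (.read 1 (.var 10)) (.add (.read 4 (.read 1 (.var 10))) (.read 2 (.var 10))))
      (.writeReal 4 (.read 2 (.var 10)) (.add (.read 4 (.read 2 (.var 10))) (.read 2 (.var 10))))))

lemma runs_weightProgram : ∃ C, ∀ {n m : ℕ} (M : BinaryMRF n m), M.Attractive → ∀ {σ : Memory},
    σ.nat 0 1 = m → σ.nat 1 = ofFin (fun e => (M.src e : ℕ)) →
    σ.nat 2 = ofFin (fun e => (M.tgt e : ℕ)) → σ.real 2 = ofFin M.W →
    (∀ i ≤ n, σ.nat 3 i = i * n) → σ.real 3 = (fun _ => 0) → σ.real 4 = (fun _ => 0) →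
    Runs weightProgram σ (C * (m + 1)) (fun σ' =>
      (∀ i < n, ∀ j < n, σ'.real 3 (i * n + j) = M.weightMatrix i j) ∧
      ∀ i : Fin n, σ'.real 4 i = M.derivBound i) := by
  refine ⟨_, fun {n m} M hM {σ} hm h1 h2 hW h3 hr3 hr4 => (runs_forLoop_wp (N := m)
    (fun k σ' => (∀ i < n, ∀ j < n, σ'.real 3 (i * n + j) = ∑ e ∈ Finset.range k,
        if ofFin (fun e => (M.src e : ℕ)) e = i ∧ ofFin (fun e => (M.tgt e : ℕ)) e = j
          then ofFin M.W e else 0) ∧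
      ∀ i < n, σ'.real 4 i = ∑ e ∈ Finset.range k,
        ((if ofFin (fun e => (M.src e : ℕ)) e = i then ofFin M.W e else 0) +
          if ofFin (fun e => (M.tgt e : ℕ)) e = i then ofFin M.W e else 0)) (by decide)
    (fun _ _ _ h => h) ⟨by simp [hr3], by simp [hr4]⟩ ?_ ?_).mono le_rfl ?_⟩
  · intro σ' hA
    simp only [NatExpr.eval, hA.nat 0 (by decide), hm]
  · intro k hk σ' hA hj ⟨hI1, hI2⟩
    have hs : ofFin (fun e => (M.src e : ℕ)) k = M.src ⟨k, hk⟩ := by simp [ofFin, hk]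
    have ht : ofFin (fun e => (M.tgt e : ℕ)) k = M.tgt ⟨k, hk⟩ := by simp [ofFin, hk]
    have hlt := (M.src_lt_tgt ⟨k, hk⟩)
    rw [Fin.lt_def] at hlt
    have hsn := (M.src ⟨k, hk⟩).2
    have htn := (M.tgt ⟨k, hk⟩).2
    simp only [Program.wp, NatExpr.eval, RealExpr.eval, hj, Memory.setReal_nat,
      hA.nat 1 (by decide), hA.nat 2 (by decide), hA.nat 3 (by decide), h1, h2, hs, ht,
      h3 _ hsn.le, Memory.setReal_real_of_ne, ne_eq, Nat.reduceEqDiff,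
      not_false_eq_true, hA.real 2 (by decide), hW, Memory.setReal_real_self]
    generalize (M.src ⟨k, hk⟩ : ℕ) = s at *
    generalize (M.tgt ⟨k, hk⟩ : ℕ) = t at *
    constructor
    · intro i hi j hj'
      rw [Finset.sum_range_succ, hs, ht, Function.update_apply, ← hI1 i hi j hj']
      simp only [rowMajor_inj hj' htn]
      by_cases h : i = s ∧ j = t
      · simp [h]
      · rw [if_neg h, if_neg (fun h' => h ⟨h'.1.symm, h'.2.symm⟩), add_zero]
    · intro i hi
      rw [Finset.sum_range_succ, hs, ht, ← hI2 i hi]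
      simp only [Function.update_apply]
      by_cases e1 : i = s <;> by_cases e2 : i = t
      · omega
      · subst e1; simp [e2, Ne.symm e2]
      · subst e2; simp [e1, Ne.symm e1]
      · simp [e1, e2, Ne.symm e1, Ne.symm e2]
  · rintro σ' - ⟨hI1, hI2⟩
    refine ⟨fun i hi j hj => ?_, fun i => ?_⟩
    · rw [hI1 i hi j hj, weightMatrix, ← Fin.sum_univ_eq_sum_range (fun e =>
        if ofFin (fun e => (M.src e : ℕ)) e = i ∧ ofFin (fun e => (M.tgt e : ℕ)) e = j
          then ofFin M.W e else 0) m]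
      simp only [ofFin_val]
    · rw [hI2 i i.2, hM.derivBound_eq, sum_incident, ← Fin.sum_univ_eq_sum_range (fun e =>
        ((if ofFin (fun e => (M.src e : ℕ)) e = i then ofFin M.W e else 0) +
          if ofFin (fun e => (M.tgt e : ℕ)) e = i then ofFin M.W e else 0)) m]
      simp only [ofFin_val, Fin.val_inj]

end BetheRAM

namespace BetheRAM

/-! #### The mesh -/

/-- Adds the node of the interval that starts at the current mesh point. -/
def nodeProgram : Program :=
  .seq (.writeNat 4 (.var 12) (.var 10)) <|
  .seq (.writeReal 7 (.var 12) (.var 21)) <|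
  .seq (.writeReal 21 (.const 0) (.add (.var 21)
    (.mul (.const 2) (.div (.var 0) (.mul (.var 20) (.read 4 (.var 10))))))) <|
  .seq (.cond (.realLT (.read 6 (.var 10)) (.var 21))
    (.writeReal 21 (.const 0) (.read 6 (.var 10))) .skip) <|
  .seq (.writeReal 8 (.var 12) (.var 21))
    (.writeNat 12 (.const 0) (.add (.var 12) (.const 1)))

/-- Adds the nodes of one variable. -/
def nodesProgram : Program := .loop (.realLT (.var 21) (.read 6 (.var 10))) nodeProgram

/-- Computes the Bethe box and the nodes. -/
def meshProgram : Program :=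
  .forLoop 10 (.read 0 (.const 0)) <|
  .seq (.seq (.writeReal 5 (.var 10) (sigmoidExpr (.read 1 (.var 10)))) <|
    .seq (.writeReal 6 (.var 10) (sigmoidExpr (.add (.read 1 (.var 10)) (.read 4 (.var 10)))))
    (.writeReal 21 (.const 0) (.read 5 (.var 10))))
  nodesProgram

/-- The nodes before node `b` of variable `i` have been computed. -/
def LayoutUpTo (G : GridProblem) (i b : ℕ) (σ : Memory) : Prop :=
  σ.nat 12 0 = G.offset i + b ∧ ∀ i' b', (i' < i ∧ b' < G.κ i') ∨ (i' = i ∧ b' < b) →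
    σ.nat 4 (G.offset i' + b') = i' ∧ σ.real 7 (G.offset i' + b') = G.pt i' b' ∧
      σ.real 8 (G.offset i' + b') = G.pt i' (b' + 1)

lemma LayoutUpTo.succ {G : GridProblem} {i : ℕ} {σ : Memory} (h : LayoutUpTo G i (G.κ i) σ) :
    LayoutUpTo G (i + 1) 0 σ := by
  refine ⟨by rw [h.1, G.offset_succ, add_zero], fun i' b' hi => h.2 i' b' ?_⟩
  rcases hi with ⟨h1, h2⟩ | ⟨_, h2⟩
  · rcases Nat.lt_succ_iff_lt_or_eq.mp h1 with h1 | rfl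
    · exact .inl ⟨h1, h2⟩
    · exact .inr ⟨rfl, h2⟩
  · omega

lemma LayoutUpTo.isLayout {G : GridProblem} {σ : Memory} (h : LayoutUpTo G G.n 0 σ) :
    G.IsLayout (σ.nat 4) (σ.real 7) (σ.real 8) :=
  ⟨fun i hi b hb => (h.2 i b (.inl ⟨hi, hb⟩)).1, fun i hi b hb => (h.2 i b (.inl ⟨hi, hb⟩)).2.1,
    fun i hi b hb => (h.2 i b (.inl ⟨hi, hb⟩)).2.2⟩

/-- Nodes are numbered in lexicographic order, so writing a new node leaves the earlier ones intact.
-/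
lemma layout_index_lt {G : GridProblem} {i b i' b' : ℕ}
    (h : (i' < i ∧ b' < G.κ i') ∨ (i' = i ∧ b' < b)) : G.offset i' + b' < G.offset i + b := by
  rcases h with ⟨h1, h2⟩ | ⟨rfl, h2⟩
  · have := G.offset_mono (show i' + 1 ≤ i from h1)
    rw [G.offset_succ] at this
    omega
  · omega

/-- Point b is still untruncated, so adding the width and truncating gives the next point. The
program can thus generate the mesh by iteration. -/
lemma meshPoint_succ {n m : ℕ} {M : BinaryMRF n m} (hM : M.Attractive) {ε : ℝ} (hε : 0 < ε)
    {i : Fin n} {b : ℕ} (hb : b < M.meshCount ε i) :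
    M.meshPoint ε i (b + 1) =
      min (M.meshPoint ε i b + 2 * (ε / (n * M.derivBound i))) (M.boxUpper i) := by
  rw [(hM.meshPoint_of_lt hε hb).1, meshPoint]
  simp only [meshRadius]
  push_cast
  congr 1
  ring

/-- Comparing the current point with the upper end replaces the ceiling, which the machine cannot
compute. If D_i = 0 the body is never entered, so its division by D_i does no harm. -/
lemma runs_nodesProgram : ∃ C, ∀ {n m : ℕ} {M : BinaryMRF n m}, M.Attractive → ∀ {ε : ℝ}, 0 < ε →
    ∀ {i : Fin n} {σ : Memory}, σ.nat 10 0 = i → σ.real 0 0 = ε → σ.real 20 0 = n →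
    σ.real 4 i = M.derivBound i → σ.real 6 i = M.boxUpper i → σ.real 21 0 = M.boxLower i →
    LayoutUpTo (M.gridProblem ε) i 0 σ →
    Runs nodesProgram σ (C * (M.meshCount ε i + 1))
      (LayoutUpTo (M.gridProblem ε) i ((M.gridProblem ε).κ i)) := by
  refine ⟨(Test.realLT (.var 21) (.read 6 (.var 10))).cost + nodeProgram.maxCost,
    fun {n m M} hM {ε} hε {i σ} h10 h0 h20 h4 h6 h21 hL => ?_⟩
  have hκ : (M.gridProblem ε).κ i = M.meshCount ε i := gridProblem_κ i.2
  rw [hκ]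
  refine (runs_loop_count (N := M.meshCount ε i) (T := fun _ => nodeProgram.maxCost)
    (fun b σ' => LayoutUpTo (M.gridProblem ε) i b σ' ∧ σ'.real 21 0 = M.meshPoint ε i b)
    ⟨hL, by rw [h21, hM.meshPoint_zero]⟩ (fun b hb σ' hA hI => ⟨?_, runs_of_wp ?_⟩)
    (fun σ' hA hI => ?_)).mono ?_ fun σ' _ h => h.1
  · simp only [Test.Holds, RealExpr.eval, NatExpr.eval, hA.real 6 (by decide),
      hA.nat 10 (by decide), h10, h6, hI.2]
    exact (hM.meshPoint_of_lt hε hb).2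
  · obtain ⟨⟨hI1, hI2⟩, hI3⟩ := hI
    have hstep := meshPoint_succ hM hε hb
    have hfin : ∀ σ'' : Memory, σ''.nat 12 = Function.update (σ'.nat 12) 0 (σ'.nat 12 0 + 1) →
        σ''.nat 4 = Function.update (σ'.nat 4) (σ'.nat 12 0) i →
        σ''.real 7 = Function.update (σ'.real 7) (σ'.nat 12 0) (M.meshPoint ε i b) →
        σ''.real 8 = Function.update (σ'.real 8) (σ'.nat 12 0) (M.meshPoint ε i (b + 1)) →
        σ''.real 21 0 = M.meshPoint ε i (b + 1) →
        LayoutUpTo (M.gridProblem ε) i (b + 1) σ'' ∧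
          σ''.real 21 0 = M.meshPoint ε i (b + 1) := by
      intro σ'' e1 e2 e3 e4 e5
      refine ⟨⟨by simp [e1, hI1, add_assoc], fun i' b' hi' => ?_⟩, e5⟩
      rw [e2, e3, e4, hI1]
      by_cases hnew : i' = i ∧ b' = b
      · obtain ⟨rfl, rfl⟩ := hnew
        simp [gridProblem_pt i.2]
      · have hold : (i' < i ∧ b' < (M.gridProblem ε).κ i') ∨ (i' = i ∧ b' < b) := by
          rcases hi' with h | h
          · exact .inl h
          · exact .inr ⟨h.1, by omega⟩
        have hne := (layout_index_lt hold).ne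
        simp only [Function.update_of_ne hne]
        exact hI2 i' b' hold
    have e4 : σ'.real 4 i = M.derivBound i := by rw [hA.real 4 (by decide), h4]
    have e6 : σ'.real 6 i = M.boxUpper i := by rw [hA.real 6 (by decide), h6]
    have e0 : σ'.real 0 0 = ε := by rw [hA.real 0 (by decide), h0]
    have e20 : σ'.real 20 0 = n := by rw [hA.real 20 (by decide), h20]
    have e10 : σ'.nat 10 0 = i := by rw [hA.nat 10 (by decide), h10]
    simp only [nodeProgram, Program.wp, NatExpr.eval, RealExpr.eval, Test.Holds,
      Memory.setReal_nat, Memory.setNat_real, Memory.setReal_real_of_ne, Memory.setNat_nat_of_ne,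
      ne_eq, Nat.reduceEqDiff, not_false_eq_true, OfNat.zero_ne_ofNat,
      Memory.setReal_real_self, Function.update_self, hI3, e0, e4, e6, e10, e20, Rat.cast_ofNat]
    constructor
    · intro hlt
      rw [min_eq_right hlt.le] at hstep
      apply hfin <;> simp [hstep]
    · intro hge
      rw [min_eq_left (not_lt.mp hge)] at hstep
      apply hfin <;> simp [hstep]
  · simp only [Test.Holds, RealExpr.eval, NatExpr.eval, hA.real 6 (by decide),
      hA.nat 10 (by decide), h10, h6, hI.2, hM.meshPoint_of_le hε le_rfl]
    exact lt_irrefl _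
  · simp only [Finset.sum_const, Finset.card_range, smul_eq_mul]
    nlinarith

lemma runs_meshProgram : ∃ C, ∀ {n m : ℕ} {M : BinaryMRF n m}, M.Attractive → ∀ {ε : ℝ}, 0 < ε →
    ∀ {σ : Memory}, σ.nat 0 0 = n → σ.real 0 0 = ε → σ.real 1 = ofFin M.θ → σ.real 20 0 = n →
    (∀ i : Fin n, σ.real 4 i = M.derivBound i) → σ.nat 12 0 = 0 →
    Runs meshProgram σ (C * ((M.gridProblem ε).nodes + n + 1)) (fun σ' =>
      (∀ i : Fin n, σ'.real 5 i = M.boxLower i ∧ σ'.real 6 i = M.boxUpper i) ∧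
      σ'.nat 12 0 = (M.gridProblem ε).nodes ∧
      (M.gridProblem ε).IsLayout (σ'.nat 4) (σ'.real 7) (σ'.real 8)) := by
  obtain ⟨C, hC⟩ := runs_nodesProgram
  have : ∃ D, D = Program.maxCost (.seq
    (.writeReal 5 (.var 10) (sigmoidExpr (.read 1 (.var 10)))) <|
    .seq (.writeReal 6 (.var 10) (sigmoidExpr (.add (.read 1 (.var 10)) (.read 4 (.var 10)))))
    (.writeReal 21 (.const 0) (.read 5 (.var 10)))) := ⟨_, rfl⟩
  obtain ⟨D, hD⟩ := this
  refine ⟨C + D + 11, fun {n m M} hM {ε} hε {σ} hn h0 h1 h20 h4 h12 => ?_⟩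
  refine (runs_forLoop (c := 10) (N := n) (T := fun i => D + C * (ofFin (M.meshCount ε) i + 1))
    (fun i σ' => (∀ i' : Fin n, i'.val < i → σ'.real 5 i' = M.boxLower i' ∧
      σ'.real 6 i' = M.boxUpper i') ∧ LayoutUpTo (M.gridProblem ε) i 0 σ') (by decide)
    (fun _ _ _ h => h) ⟨by simp, ?_⟩ ?_ ?_).mono ?_ ?_
  · exact ⟨by simp [h12, GridProblem.offset], fun i' b' h => by omega⟩
  · intro σ' hA
    simp only [NatExpr.eval, hA.nat 0 (by decide), hn]
  · intro i hi σ' hA h10 ⟨hI1, hI2⟩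
    have e1 : σ'.real 1 i = M.θ ⟨i, hi⟩ := by
      rw [hA.real 1 (by decide), h1]; simp [ofFin, hi]
    have e4 : σ'.real 4 i = M.derivBound ⟨i, hi⟩ := by
      rw [hA.real 4 (by decide)]; exact h4 ⟨i, hi⟩
    rw [hD]
    refine Runs.seq (Q := fun σ'' => (∀ i' : Fin n, i'.val < i + 1 →
      σ''.real 5 i' = M.boxLower i' ∧ σ''.real 6 i' = M.boxUpper i') ∧
      σ''.real 21 0 = M.boxLower ⟨i, hi⟩ ∧ LayoutUpTo (M.gridProblem ε) i 0 σ'')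
      (runs_of_wp ?_) ?_
    · simp only [Program.wp, NatExpr.eval, RealExpr.eval, eval_sigmoidExpr,
        Memory.setReal_nat, Memory.setReal_real_of_ne, ne_eq, Nat.reduceEqDiff, not_false_eq_true,
        OfNat.one_ne_ofNat, Memory.setReal_real_self, Function.update_self, h10, e1, e4]
      refine ⟨fun i' hi' => ?_, ?_, hI2⟩
      · by_cases e : i' = ⟨i, hi⟩
        · subst e
          simp [hM.boxLower_eq, hM.boxUpper_eq]
        · have hne : (i' : ℕ) ≠ i := fun h => e (Fin.ext h)
          rw [Function.update_of_ne hne, Function.update_of_ne hne]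
          exact hI1 i' (by omega)
      · rw [hM.boxLower_eq]
    · rintro σ'' hA' ⟨hJ1, hJ2, hJ3⟩
      have hA'' := hA.trans (hA'.mono (p' := meshProgram) (by decide) (by decide))
      have hrun := hC hM hε (i := ⟨i, hi⟩) (σ := σ'') (by rw [hA'.nat 10 (by decide), h10])
        (by rw [hA''.real 0 (by decide), h0]) (by rw [hA''.real 20 (by decide), h20])
        (by rw [hA'.real 4 (by decide)]; exact e4)
        (hJ1 ⟨i, hi⟩ (Nat.lt_succ_self i)).2 hJ2 hJ3
      refine hrun.mono (by simp [ofFin, hi]) fun σ₃ hA₃ hL => ⟨fun i' hi' => ?_, hL.succ⟩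
      rw [hA₃.real 5 (by decide), hA₃.real 6 (by decide)]
      exact hJ1 i' hi'
  · simp only [Finset.sum_add_distrib, Finset.sum_const, Finset.card_range, smul_eq_mul,
      ← Finset.mul_sum, NatExpr.cost]
    have : ∑ i ∈ Finset.range n, ofFin (M.meshCount ε) i = (M.gridProblem ε).nodes := rfl
    rw [this]
    nlinarith
  · rintro σ' - ⟨hI1, hI2⟩
    have hI2' : LayoutUpTo (M.gridProblem ε) (M.gridProblem ε).n 0 σ' := hI2
    exact ⟨fun i => hI1 i i.2, hI2'.1, hI2'.isLayout⟩

/-- Computes the multiples of the number of nodes. -/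
def nodeRowProgram : Program :=
  .forLoop 10 (.add (.var 12) (.const 1))
    (.writeNat 5 (.add (.var 10) (.const 1)) (.add (.read 5 (.var 10)) (.var 12)))

/-- The table goes up to K + 1 because entry K + 1 also supplies the term (K + 1) K of the sweep
bound. -/
lemma runs_nodeRowProgram : ∃ C, ∀ {K : ℕ} {σ : Memory}, σ.nat 12 0 = K → σ.nat 5 0 = 0 →
    Runs nodeRowProgram σ (C * (K + 1 + 1)) (fun σ' => ∀ i ≤ K + 1, σ'.nat 5 i = i * K) := by
  refine ⟨_, fun {K σ} hK h5 => runs_forLoop_wp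
    (fun j σ' => ∀ i ≤ j, σ'.nat 5 i = i * K) (by decide)
    (fun _ _ _ h => h) (by simpa using h5) ?_ ?_⟩
  · intro σ' hA
    simp only [NatExpr.eval, hA.nat 12 (by decide), hK]
  · intro j _ σ' hA hj hI i hi
    have hn' : σ'.nat 12 0 = K := by rw [hA.nat 12 (by decide), hK]
    simp only [NatExpr.eval, Memory.setNat_nat_self, hj, hn']
    rw [Function.update_apply]
    split_ifs with h
    · rw [h, hI j le_rfl, add_mul, one_mul]
    · exact hI i (by omega)

end BetheRAM

namespace BetheRAM

/-! #### The coefficients and weights of the cut problem -/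

/-- The data of the discretized problem are in the memory. -/
structure Ready {n m : ℕ} (M : BinaryMRF n m) (ε : ℝ) (σ : Memory) : Prop where
  size : σ.nat 0 0 = n
  field : σ.real 1 = ofFin M.θ
  rows : ∀ i ≤ n, σ.nat 3 i = i * n
  matrix : ∀ i < n, ∀ j < n, σ.real 3 (i * n + j) = M.weightMatrix i j
  lower : ∀ i < n, σ.real 5 i = (M.gridProblem ε).pt i 0
  upper : ∀ i < n, σ.real 6 i = (M.gridProblem ε).pt i ((M.gridProblem ε).κ i)
  nodes : σ.nat 12 0 = (M.gridProblem ε).nodes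
  layout : (M.gridProblem ε).IsLayout (σ.nat 4) (σ.real 7) (σ.real 8)
  nodeRows : ∀ i ≤ (M.gridProblem ε).nodes + 1, σ.nat 5 i = i * (M.gridProblem ε).nodes

variable {n m : ℕ} {M : BinaryMRF n m} {ε : ℝ} {σ : Memory}

/-- Frame rule: the listed arrays are the ones that `Ready` mentions, and the side conditions are
decided by computation. -/
lemma Ready.of_agree {p : Program} {σ' : Memory} (h : Ready M ε σ) (hA : Agree p σ σ')
    (hn : ∀ a ∈ [0, 3, 4, 5, 12], a ∉ p.natWrites)
    (hr : ∀ a ∈ [1, 3, 5, 6, 7, 8], a ∉ p.realWrites) : Ready M ε σ' := by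
  constructor
  · rw [hA.nat 0 (hn 0 (by simp))]; exact h.size
  · rw [hA.real 1 (hr 1 (by simp))]; exact h.field
  · rw [hA.nat 3 (hn 3 (by simp))]; exact h.rows
  · rw [hA.real 3 (hr 3 (by simp))]; exact h.matrix
  · rw [hA.real 5 (hr 5 (by simp))]; exact h.lower
  · rw [hA.real 6 (hr 6 (by simp))]; exact h.upper
  · rw [hA.nat 12 (hn 12 (by simp))]; exact h.nodes
  · rw [hA.nat 4 (hn 4 (by simp)), hA.real 7 (hr 7 (by simp)), hA.real 8 (hr 8 (by simp))]
    exact h.layout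
  · rw [hA.nat 5 (hn 5 (by simp))]; exact h.nodeRows

lemma gridProblem_pt_mem (hM : M.Attractive) (hε : 0 < ε) {i : ℕ} (hi : i < n) (k : ℕ) :
    (M.gridProblem ε).pt i k ∈ Set.Icc (0 : ℝ) 1 := by
  rw [gridProblem_pt hi]
  exact hM.simpleMesh_subset hε _ _ (hM.meshPoint_mem hε _ _)

lemma Ready.node (h : Ready M ε σ) (hM : M.Attractive) (hε : 0 < ε) {u : ℕ}
    (hu : u < (M.gridProblem ε).nodes) :
    σ.nat 4 u < n ∧ σ.real 7 u ∈ Set.Icc (0 : ℝ) 1 ∧ σ.real 8 u ∈ Set.Icc (0 : ℝ) 1 := by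
  obtain ⟨i, hi, b, hb, rfl⟩ := (M.gridProblem ε).exists_eq_offset_add hu
  rw [h.layout.own_eq i hi b hb, h.layout.lo_eq i hi b hb, h.layout.hi_eq i hi b hb]
  exact ⟨hi, gridProblem_pt_mem hM hε hi _, gridProblem_pt_mem hM hε hi _⟩

/-- The entry of the weight matrix at a pair of variables. -/
def matrixExpr (i j : NatExpr) : RealExpr := .read 3 (.add (.read 3 i) j)

lemma Ready.eval_matrixExpr (h : Ready M ε σ) {i j : NatExpr} (hi : i.eval σ < n)
    (hj : j.eval σ < n) : (matrixExpr i j).eval σ = M.weightMatrix (i.eval σ) (j.eval σ) := by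
  simp only [matrixExpr, RealExpr.eval, NatExpr.eval, h.rows _ hi.le]
  exact h.matrix _ hi _ hj

lemma setReal_self (σ : Memory) (a k : ℕ) : σ.setReal a k (σ.real a k) = σ := by
  simp [Memory.setReal]

/-- Adds the difference of two pairwise costs of weight `w` to cell `k` of array `a`. -/
def addPairsProgram (a : ℕ) (k : NatExpr) (w x y x' y' : RealExpr) : Program :=
  .cond (.realLT (.const 0) w)
    (.writeReal a k (.add (.read a k) (.sub (pairExpr w x y) (pairExpr w x' y')))) .skip

/-- `pairExpr` is correct only for positive weights, hence the test. For other pairs both matrix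
costs are 0, and skipping amounts to rewriting the cell with its own value. -/
lemma wp_addPairsProgram {a : ℕ} {k : NatExpr} {w x y x' y' : RealExpr} {Q : Memory → Prop}
    (hx : x.eval σ ∈ Set.Icc (0 : ℝ) 1) (hy : y.eval σ ∈ Set.Icc (0 : ℝ) 1)
    (hx' : x'.eval σ ∈ Set.Icc (0 : ℝ) 1) (hy' : y'.eval σ ∈ Set.Icc (0 : ℝ) 1)
    (hQ : Q (σ.setReal a (k.eval σ) (σ.real a (k.eval σ) +
      (matrixCost (w.eval σ) (x.eval σ) (y.eval σ) -
        matrixCost (w.eval σ) (x'.eval σ) (y'.eval σ))))) :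
    (addPairsProgram a k w x y x' y').wp Q σ := by
  simp only [addPairsProgram, Program.wp, Test.Holds, RealExpr.eval, Rat.cast_zero]
  constructor
  · intro hw
    rw [eval_pairExpr σ hw hx hy, eval_pairExpr σ hw hx' hy']
    simpa only [matrixCost, if_pos hw] using hQ
  · intro hw
    simpa only [matrixCost, if_neg hw, sub_zero, add_zero, setReal_self] using hQ

/-- Adds the pairwise terms of variable `j` to the coefficient of node `u`. -/
def coefTermProgram : Program :=
  .seq
    (addPairsProgram 9 (.var 10) (matrixExpr (.read 4 (.var 10)) (.var 11))
      (.read 8 (.var 10)) (.read 6 (.var 11)) (.read 7 (.var 10)) (.read 6 (.var 11)))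
    (addPairsProgram 9 (.var 10) (matrixExpr (.var 11) (.read 4 (.var 10)))
      (.read 5 (.var 11)) (.read 8 (.var 10)) (.read 5 (.var 11)) (.read 7 (.var 10)))

/-- Computes the coefficients of the nodes and the weight of the consistency arcs. -/
def coefProgram : Program :=
  .seq (.writeReal 22 (.const 0) (.const 1)) <|
  .forLoop 10 (.var 12) <|
  .seq (.writeReal 9 (.var 10) (.sub
    (unaryExpr (.read 1 (.read 4 (.var 10))) (.read 8 (.var 10)))
    (unaryExpr (.read 1 (.read 4 (.var 10))) (.read 7 (.var 10))))) <|
  .seq (.forLoop 11 (.read 0 (.const 0)) coefTermProgram)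
  (.cond (.realLT (.read 9 (.var 10)) (.const 0))
    (.writeReal 22 (.const 0) (.sub (.var 22) (.read 9 (.var 10))))
    (.writeReal 22 (.const 0) (.add (.var 22) (.read 9 (.var 10)))))

/-- The contribution of variable `j` to the coefficient of node `u`. -/
noncomputable def coefTerm (G : GridProblem) (own : ℕ → ℕ) (lo hi : ℕ → ℝ) (u j : ℕ) : ℝ :=
  (G.f (own u) j (hi u) (G.pt j (G.κ j)) - G.f (own u) j (lo u) (G.pt j (G.κ j))) +
    (G.f j (own u) (G.pt j 0) (hi u) - G.f j (own u) (G.pt j 0) (lo u))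

lemma wp_coefTermProgram (hM : M.Attractive) (hε : 0 < ε) (h : Ready M ε σ)
    (hu : σ.nat 10 0 < (M.gridProblem ε).nodes) (hj : σ.nat 11 0 < n) {Q : Memory → Prop}
    (hQ : ∀ σ' : Memory, σ'.real 9 = Function.update (σ.real 9) (σ.nat 10 0)
      (σ.real 9 (σ.nat 10 0) + coefTerm (M.gridProblem ε) (σ.nat 4) (σ.real 7) (σ.real 8)
        (σ.nat 10 0) (σ.nat 11 0)) → Q σ') : coefTermProgram.wp Q σ := by
  obtain ⟨hown, hlo, hhi⟩ := h.node hM hε hu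
  have hU : σ.real 6 (σ.nat 11 0) ∈ Set.Icc (0 : ℝ) 1 := by
    rw [h.upper _ hj]; exact gridProblem_pt_mem hM hε hj _
  have hA : σ.real 5 (σ.nat 11 0) ∈ Set.Icc (0 : ℝ) 1 := by
    rw [h.lower _ hj]; exact gridProblem_pt_mem hM hε hj _
  have e1 := h.eval_matrixExpr (i := .read 4 (.var 10)) (j := .var 11) hown hj
  refine wp_addPairsProgram hhi hU hlo hU (wp_addPairsProgram ?_ ?_ ?_ ?_ (hQ _ ?_))
  · exact hA
  · exact hhi
  · exact hA
  · exact hlo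
  · rw [e1]
    set σ₁ := σ.setReal 9 (NatExpr.eval σ (.var 10)) _ with hσ₁
    have h₁ : Ready M ε σ₁ := h.of_agree (p := .writeReal 9 (.const 0) (.const 0))
      ⟨fun _ _ => rfl, fun a ha => by
        simp only [Program.realWrites, List.mem_singleton] at ha
        exact Memory.setReal_real_of_ne _ _ _ ha⟩ (by decide) (by decide)
    have e2 := h₁.eval_matrixExpr (i := .var 11) (j := .read 4 (.var 10)) hj hown
    rw [e2, hσ₁]
    simp only [NatExpr.eval, RealExpr.eval, Memory.setReal_real_self, Memory.setReal_nat,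
      Function.update_self, Function.update_idem, Memory.setReal_real_of_ne, ne_eq,
      Nat.reduceEqDiff, not_false_eq_true]
    rw [coefTerm, h.upper _ hj, h.lower _ hj, add_assoc]
    rfl

lemma runs_coefProgram : ∃ C, ∀ {n m : ℕ} {M : BinaryMRF n m}, M.Attractive → ∀ {ε : ℝ}, 0 < ε →
    ∀ {σ : Memory}, Ready M ε σ →
    Runs coefProgram σ (C * (((M.gridProblem ε).nodes + 1) * (n + 1))) (fun σ' =>
      (∀ u < (M.gridProblem ε).nodes,
        σ'.real 9 u = (M.gridProblem ε).coef (σ.nat 4) (σ.real 7) (σ.real 8) u) ∧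
      σ'.real 22 0 = (M.gridProblem ε).bigWeight (σ.nat 4) (σ.real 7) (σ.real 8)) := by
  obtain ⟨C₁, hC₁⟩ : ∃ C, C = Program.maxCost (.writeReal 9 (.var 10) (.sub
    (unaryExpr (.read 1 (.read 4 (.var 10))) (.read 8 (.var 10)))
    (unaryExpr (.read 1 (.read 4 (.var 10))) (.read 7 (.var 10))))) := ⟨_, rfl⟩
  obtain ⟨C₂, hC₂⟩ : ∃ C, C = (NatExpr.read 0 (.const 0)).cost + 9 + coefTermProgram.maxCost :=
    ⟨_, rfl⟩
  obtain ⟨C₃, hC₃⟩ : ∃ C, C = Program.maxCost (.cond (.realLT (.read 9 (.var 10)) (.const 0))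
    (.writeReal 22 (.const 0) (.sub (.var 22) (.read 9 (.var 10))))
    (.writeReal 22 (.const 0) (.add (.var 22) (.read 9 (.var 10))))) := ⟨_, rfl⟩
  refine ⟨C₁ + C₂ + C₃ + 14, fun {n m M} hM {ε} hε {σ} hR => ?_⟩
  set G := M.gridProblem ε with hG
  have hloop : ∀ σ₀ : Memory, Agree coefProgram σ σ₀ → σ₀.real 22 0 = 1 → Runs (.forLoop 10 (.var 12) <|
      .seq (.writeReal 9 (.var 10) (.sub
        (unaryExpr (.read 1 (.read 4 (.var 10))) (.read 8 (.var 10)))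
        (unaryExpr (.read 1 (.read 4 (.var 10))) (.read 7 (.var 10))))) <|
      .seq (.forLoop 11 (.read 0 (.const 0)) coefTermProgram)
      (.cond (.realLT (.read 9 (.var 10)) (.const 0))
        (.writeReal 22 (.const 0) (.sub (.var 22) (.read 9 (.var 10))))
        (.writeReal 22 (.const 0) (.add (.var 22) (.read 9 (.var 10)))))) σ₀
      (∑ _u ∈ Finset.range G.nodes, (2 + 9 + (C₁ + (C₂ * (n + 1) + C₃))) + (2 + 9)) (fun σ' =>
      (∀ u < G.nodes, σ'.real 9 u = G.coef (σ.nat 4) (σ.real 7) (σ.real 8) u) ∧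
      σ'.real 22 0 = 1 + ∑ u ∈ Finset.range G.nodes,
        |G.coef (σ.nat 4) (σ.real 7) (σ.real 8) u|) := by
    intro σ₀ hA₀ h22
    refine runs_forLoop (c := 10) (bound := .var 12) (fun k σ' =>
      (∀ u < k, σ'.real 9 u = G.coef (σ.nat 4) (σ.real 7) (σ.real 8) u) ∧
      σ'.real 22 0 = 1 + ∑ u ∈ Finset.range k,
        |G.coef (σ.nat 4) (σ.real 7) (σ.real 8) u|) (by decide) (fun _ _ _ h => h)
      ⟨by simp, by simpa using h22⟩ ?_ ?_
    · intro σ' hA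
      simp only [NatExpr.eval, hA.nat 12 (by decide), hA₀.nat 12 (by decide), hR.nodes, hG]
    · intro u hu σ₁ hA₁ h10 ⟨hI1, hI2⟩
      have hA : Agree coefProgram σ σ₁ := hA₀.trans (hA₁.mono (by decide) (by decide))
      have hR₁ := hR.of_agree hA (by decide) (by decide)
      have hn4 := hA.nat 4 (by decide)
      have hr7 := hA.real 7 (by decide)
      have hr8 := hA.real 8 (by decide)
      have hown := (hR.node hM hε hu).1
      rw [hC₁]
      refine Runs.seq (Q := fun σ' => σ'.real 9 = Function.update (σ₁.real 9) u
        (G.φ (σ.nat 4 u) (σ.real 8 u) - G.φ (σ.nat 4 u) (σ.real 7 u))) (runs_of_wp ?_) ?_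
      · simp only [Program.wp, NatExpr.eval, RealExpr.eval, eval_unaryExpr,
          Memory.setReal_real_self, h10, hn4, hr7, hr8, hR₁.field]
        rfl
      intro σ₂ hA₂ h9
      have hA' : Agree coefProgram σ σ₂ := hA.trans (hA₂.mono (by decide) (by decide))
      have h10' : σ₂.nat 10 0 = u := by rw [hA₂.nat 10 (by decide), h10]
      have h22' : σ₂.real 22 = σ₁.real 22 := hA₂.real 22 (by decide)
      rw [hC₂]
      refine (runs_forLoop_wp (fun j σ' => σ'.real 9 = Function.update (σ₁.real 9) u
        (G.φ (σ.nat 4 u) (σ.real 8 u) - G.φ (σ.nat 4 u) (σ.real 7 u) +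
          ∑ j' ∈ Finset.range j, coefTerm G (σ.nat 4) (σ.real 7) (σ.real 8) u j')) (by decide)
        (fun _ _ _ h => h) (by simpa using h9) ?_ ?_).seq ?_
      · intro σ' hA
        simp only [NatExpr.eval, hA.nat 0 (by decide), hA'.nat 0 (by decide), hR.size]
      · intro j hj σ₃ hA₃ h11 hI
        have hA'' : Agree coefProgram σ σ₃ := hA'.trans (hA₃.mono (by decide) (by decide))
        have h10'' : σ₃.nat 10 0 = u := by rw [hA₃.nat 10 (by decide), h10']
        apply wp_coefTermProgram hM hε (hR.of_agree hA'' (by decide) (by decide))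
          (by rw [h10'']; exact hu) (by rw [h11]; exact hj)
        intro σ₄ h₄
        rw [h₄, hI, h10'', h11, hA''.nat 4 (by decide), hA''.real 7 (by decide),
          hA''.real 8 (by decide), Function.update_self, Function.update_idem,
          Finset.sum_range_succ, add_assoc]
      · intro σ₃ hA₃ h9'
        have hcoef : G.φ (σ.nat 4 u) (σ.real 8 u) - G.φ (σ.nat 4 u) (σ.real 7 u) +
          ∑ j' ∈ Finset.range n, coefTerm G (σ.nat 4) (σ.real 7) (σ.real 8) u j' =
          G.coef (σ.nat 4) (σ.real 7) (σ.real 8) u := rfl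
        rw [hcoef] at h9'
        have h10'' : σ₃.nat 10 0 = u := by rw [hA₃.nat 10 (by decide), h10']
        have h22'' : σ₃.real 22 0 = 1 + ∑ u ∈ Finset.range u,
            |G.coef (σ.nat 4) (σ.real 7) (σ.real 8) u| := by
          rw [hA₃.real 22 (by decide), h22', hI2]
        have hnew : ∀ u' < u + 1, σ₃.real 9 u' = G.coef (σ.nat 4) (σ.real 7) (σ.real 8) u' := by
          intro u' hu'
          rw [h9', Function.update_apply]
          split_ifs with e
          · rw [e]
          · exact hI1 u' (by omega)
        rw [hC₃]
        apply runs_of_wp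
        simp only [Program.wp, Test.Holds, NatExpr.eval, RealExpr.eval, h10'', Rat.cast_zero,
          Memory.setReal_real_self, Function.update_self, h22'', hnew u (Nat.lt_succ_self u),
          Memory.setReal_real_of_ne, ne_eq, Nat.reduceEqDiff, not_false_eq_true,
          Finset.sum_range_succ]
        constructor
        · intro hneg
          exact ⟨hnew, by rw [abs_of_neg hneg]; ring⟩
        · intro hpos
          exact ⟨hnew, by rw [abs_of_nonneg (not_lt.mp hpos)]; ring⟩
  have hinit : Runs (.writeReal 22 (.const 0) (.const 1)) σ 3 (fun σ' => σ'.real 22 0 = 1) :=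
    runs_of_wp (by simp [Program.wp, NatExpr.eval, RealExpr.eval])
  refine (hinit.seq fun σ₀ hA h => hloop σ₀ (hA.mono (by decide) (by decide)) h).mono ?_
    fun σ' _ h => h
  simp only [Finset.sum_const, Finset.card_range, smul_eq_mul]
  nlinarith [Nat.zero_le (G.nodes * n), Nat.zero_le (C₁ * n), Nat.zero_le (C₃ * n),
    Nat.zero_le (C₁ * G.nodes * n), Nat.zero_le (C₃ * G.nodes * n), Nat.zero_le (C₂ * n)]

/-- Computes the weight of one arc. -/
def arcWeightProgram : Program :=
  .cond (.conj (.neg (.natLT (.read 4 (.var 10)) (.read 4 (.var 11))))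
      (.neg (.natLT (.read 4 (.var 11)) (.read 4 (.var 10)))))
    (.cond (.conj (.neg (.natLT (.var 10) (.add (.var 11) (.const 1))))
        (.neg (.natLT (.add (.var 11) (.const 1)) (.var 10))))
      (.writeReal 10 (.add (.read 5 (.var 10)) (.var 11)) (.var 22))
      (.writeReal 10 (.add (.read 5 (.var 10)) (.var 11)) (.const 0)))
    (.cond (.realLT (.const 0) (matrixExpr (.read 4 (.var 10)) (.read 4 (.var 11))))
      (.writeReal 10 (.add (.read 5 (.var 10)) (.var 11)) (.sub (.sub (.add
        (pairExpr (matrixExpr (.read 4 (.var 10)) (.read 4 (.var 11)))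
          (.read 8 (.var 10)) (.read 7 (.var 11)))
        (pairExpr (matrixExpr (.read 4 (.var 10)) (.read 4 (.var 11)))
          (.read 7 (.var 10)) (.read 8 (.var 11))))
        (pairExpr (matrixExpr (.read 4 (.var 10)) (.read 4 (.var 11)))
          (.read 8 (.var 10)) (.read 8 (.var 11))))
        (pairExpr (matrixExpr (.read 4 (.var 10)) (.read 4 (.var 11)))
          (.read 7 (.var 10)) (.read 7 (.var 11)))))
      (.writeReal 10 (.add (.read 5 (.var 10)) (.var 11)) (.const 0)))

/-- Computes the weights of the arcs. -/
def arcProgram : Program :=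
  .forLoop 10 (.var 12) <| .forLoop 11 (.var 12) arcWeightProgram

lemma runs_arcProgram : ∃ C, ∀ {n m : ℕ} {M : BinaryMRF n m}, M.Attractive → ∀ {ε : ℝ}, 0 < ε →
    ∀ {σ : Memory}, Ready M ε σ →
    σ.real 22 0 = (M.gridProblem ε).bigWeight (σ.nat 4) (σ.real 7) (σ.real 8) →
    Runs arcProgram σ (C * (((M.gridProblem ε).nodes + 1) * ((M.gridProblem ε).nodes + 1)))
      (fun σ' => ∀ u < (M.gridProblem ε).nodes, ∀ v < (M.gridProblem ε).nodes,
        σ'.real 10 (u * (M.gridProblem ε).nodes + v) =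
          (M.gridProblem ε).weight (σ.nat 4) (σ.real 7) (σ.real 8) u v) := by
  refine ⟨arcWeightProgram.maxCost + 22, fun {n m M} hM {ε} hε {σ} hR h22 => ?_⟩
  set G := M.gridProblem ε with hG
  refine (runs_forLoop (c := 10) (N := G.nodes)
    (T := fun _ => (2 + 9 + arcWeightProgram.maxCost) * (G.nodes + 1)) (fun k σ' => ∀ u < k, ∀ v < G.nodes,
    σ'.real 10 (u * G.nodes + v) = G.weight (σ.nat 4) (σ.real 7) (σ.real 8) u v) (by decide)
    (fun _ _ _ h => h) (by simp) ?_ (fun u hu σ₁ hA₁ h10 hI => ?_)).mono ?_ fun σ' _ h => h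
  · intro σ' hA
    simp only [NatExpr.eval, hA.nat 12 (by decide), hR.nodes, hG]
  -- The inner invariant also keeps the finished rows, since all rows share one array; row-major
  -- indices do not collide.
  · refine (runs_forLoop_wp (c := 11) (N := G.nodes) (fun l σ' => ∀ u' v', v' < G.nodes →
      (u' < u ∨ (u' = u ∧ v' < l)) →
      σ'.real 10 (u' * G.nodes + v') = G.weight (σ.nat 4) (σ.real 7) (σ.real 8) u' v')
      (by decide) (fun _ _ _ h => h) (fun u' v' hv' h => hI u' (by omega) v' hv') ?_
      (fun v hv σ₂ hA₂ h11 hJ => ?_)).mono le_rfl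
      (fun σ' _ h u' hu' v' hv' => h u' v' hv' (by omega))
    · intro σ' hA
      simp only [NatExpr.eval, hA.nat 12 (by decide), hA₁.nat 12 (by decide), hR.nodes, hG]
    · have hA : Agree arcProgram σ σ₂ := hA₁.trans (hA₂.mono (by decide) (by decide))
      have hR₂ := hR.of_agree hA (by decide) (by decide)
      have h10' : σ₂.nat 10 0 = u := by rw [hA₂.nat 10 (by decide), h10]
      have hn4 := hA.nat 4 (by decide)
      have hr7 := hA.real 7 (by decide)
      have hr8 := hA.real 8 (by decide)
      have hr22 := hA.real 22 (by decide)
      obtain ⟨ho1, hl1, hh1⟩ := hR.node hM hε hu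
      obtain ⟨ho2, hl2, hh2⟩ := hR.node hM hε hv
      have hrow := hR₂.nodeRows u (show u ≤ G.nodes + 1 by omega)
      have hme := hR₂.eval_matrixExpr (i := .read 4 (.var 10)) (j := .read 4 (.var 11))
        (by simpa only [NatExpr.eval, h10', hn4] using ho1)
        (by simpa only [NatExpr.eval, h11, hn4] using ho2)
      simp only [NatExpr.eval, h10', h11, hn4] at hme
      have hfin : ∀ x, x = G.weight (σ.nat 4) (σ.real 7) (σ.real 8) u v →
          ∀ u' v', v' < G.nodes → (u' < u ∨ (u' = u ∧ v' < v + 1)) →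
          (σ₂.setReal 10 (u * G.nodes + v) x).real 10 (u' * G.nodes + v') =
            G.weight (σ.nat 4) (σ.real 7) (σ.real 8) u' v' := by
        intro x hx u' v' hv' h
        rw [Memory.setReal_real_self, Function.update_apply]
        simp only [rowMajor_inj hv' hv]
        split_ifs with e
        · rw [hx, e.1, e.2]
        · exact hJ u' v' hv' (by omega)
      have hpair : ∀ x y : RealExpr, 0 < M.weightMatrix (σ.nat 4 u) (σ.nat 4 v) →
          x.eval σ₂ ∈ Set.Icc (0 : ℝ) 1 → y.eval σ₂ ∈ Set.Icc (0 : ℝ) 1 →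
          (pairExpr (matrixExpr (.read 4 (.var 10)) (.read 4 (.var 11))) x y).eval σ₂ =
            G.f (σ.nat 4 u) (σ.nat 4 v) (x.eval σ₂) (y.eval σ₂) := by
        intro x y hw hx hy
        rw [eval_pairExpr σ₂ (by rw [hme]; exact hw) hx hy, hme]
        simp only [hG, gridProblem, matrixCost, if_pos hw]
      simp only [arcWeightProgram, Program.wp, Test.Holds, RealExpr.eval, NatExpr.eval, h10', h11, hn4, hme, hrow,
        Rat.cast_zero, not_lt]
      refine ⟨fun ho => ⟨fun he => hfin _ ?_, fun he => hfin _ ?_⟩,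
        fun ho => ⟨fun hw => hfin _ ?_, fun hw => hfin _ ?_⟩⟩
      · rw [GridProblem.weight, if_pos (le_antisymm ho.2 ho.1), if_pos (le_antisymm he.1 he.2),
          hr22, h22]
      · rw [GridProblem.weight, if_pos (le_antisymm ho.2 ho.1), if_neg (by omega)]
      · rw [GridProblem.weight, if_neg (by omega)]
        rw [hpair, hpair, hpair, hpair]
        all_goals first
          | assumption
          | simp only [RealExpr.eval, NatExpr.eval, h10', h11, hr7, hr8]
        all_goals assumption
      · rw [GridProblem.weight, if_neg (by omega)]
        simp only [hG, gridProblem, matrixCost, if_neg (not_lt.mpr hw)]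
        simp
  · simp only [Finset.sum_const, Finset.card_range, smul_eq_mul]
    have : (NatExpr.var 12).cost = 2 := rfl
    rw [this]
    generalize arcWeightProgram.maxCost = c
    nlinarith [Nat.zero_le (c * G.nodes)]

end BetheRAM

open PushRelabel

namespace BetheRAM

/-! #### The push-relabel method -/

/-- The current arc of the vertex in turn. -/
def curExpr : NatExpr := .read 7 (.var 14)

/-- The weight of an arc. -/
def arcExpr (u v : NatExpr) : RealExpr := .read 10 (.add (.read 5 u) v)

/-- Equality of natural numbers. -/
def natEqTest (x y : NatExpr) : Test := .conj (.neg (.natLT x y)) (.neg (.natLT y x))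

/-- Pushes the amount in array `24` along the current arc of the vertex in turn. -/
def pushProgram : Program :=
  .seq (.writeReal 10 (.add (.read 5 (.var 14)) curExpr) (.sub (arcExpr (.var 14) curExpr) (.var 24))) <|
  .seq (.writeReal 10 (.add (.read 5 curExpr) (.var 14)) (.add (arcExpr curExpr (.var 14)) (.var 24))) <|
  .seq (.writeReal 9 (.var 14) (.add (.read 9 (.var 14)) (.var 24)))
  (.writeReal 9 curExpr (.sub (.read 9 curExpr) (.var 24)))

/-- One step of the push-relabel method. -/
def stepProgram : Program :=
  .cond (.natLT (.var 14) (.var 12))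
    (.cond (.conj (.realLT (.read 9 (.var 14)) (.const 0))
        (.natLT (.read 6 (.var 14)) (.add (.var 12) (.const 1))))
      (.cond (.natLT curExpr (.var 12))
        (.cond (.conj (.realLT (.const 0) (arcExpr (.var 14) curExpr))
            (natEqTest (.read 6 (.var 14)) (.add (.read 6 curExpr) (.const 1))))
          (.cond (.realLT (.sub (.const 0) (.read 9 (.var 14))) (arcExpr (.var 14) curExpr))
            (.seq (.writeReal 24 (.const 0) (.sub (.const 0) (.read 9 (.var 14)))) <|
              .seq pushProgram (.writeNat 14 (.const 0) (.add (.var 14) (.const 1))))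
            (.seq (.writeReal 24 (.const 0) (arcExpr (.var 14) curExpr)) <|
              .seq pushProgram (.writeNat 7 (.var 14) (.add curExpr (.const 1)))))
          (.writeNat 7 (.var 14) (.add curExpr (.const 1))))
        (.seq (.writeNat 6 (.var 14) (.add (.read 6 (.var 14)) (.const 1)))
          (.writeNat 7 (.var 14) (.const 0))))
      (.writeNat 14 (.const 0) (.add (.var 14) (.const 1))))
    (.seq (.writeNat 14 (.const 0) (.const 0))
      (.writeNat 13 (.const 0) (.add (.var 13) (.const 1))))

/-- The push-relabel method. -/
def pushRelabelProgram : Program :=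
  .loop (.natLT (.var 13) (.add (.add (.const 1) (.read 5 (.add (.var 12) (.const 1))))
    (.read 5 (.add (.var 12) (.const 1))))) stepProgram

/-- The memory represents a state of the push-relabel method. -/
structure Represents (K : ℕ) (σ : Memory) (s : State) : Prop where
  w : ∀ u < K, ∀ v < K, σ.real 10 (u * K + v) = s.w u v
  c : ∀ u < K, σ.real 9 u = s.c u
  d : σ.nat 6 = s.d
  cur : σ.nat 7 = s.cur
  i : σ.nat 14 0 = s.i
  sweep : σ.nat 13 0 = s.sweep

variable {K : ℕ} {σ : Memory} {s : State}

/-- Since tail and head differ, the two arcs are different cells, and so are the two coefficients.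
The four successive writes thus act like the simultaneous update in `pushArc` and `pushNode`. -/
lemma wp_pushProgram (h : Represents K σ s) (hrow : ∀ i ≤ K + 1, σ.nat 5 i = i * K)
    (hi : s.i < K) (hv : s.cur s.i < K) (hne : s.i ≠ s.cur s.i) {Q : Memory → Prop}
    (hQ : ∀ σ' : Memory, σ'.nat = σ.nat → Represents K σ' { s with
      w := pushArc s.w s.i (s.cur s.i) (σ.real 24 0)
      c := pushNode s.c s.i (s.cur s.i) (σ.real 24 0) } → Q σ') : pushProgram.wp Q σ := by
  simp only [pushProgram, curExpr, arcExpr, Program.wp, NatExpr.eval, RealExpr.eval, h.i, h.cur,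
    hrow s.i (by omega), hrow (s.cur s.i) (by omega), Memory.setReal_nat, Memory.setReal_real_self,
    Memory.setReal_real_of_ne, ne_eq, Nat.reduceEqDiff, not_false_eq_true]
  set v := s.cur s.i
  set δ := σ.real 24 0
  apply hQ
  · rfl
  · refine ⟨fun a ha b hb => ?_, fun a ha => ?_, h.d, h.cur, h.i, h.sweep⟩
    · simp only [Memory.setReal_real_of_ne, ne_eq, Nat.reduceEqDiff, not_false_eq_true,
        Memory.setReal_real_self, Function.update_apply, rowMajor_inj hb hi, rowMajor_inj hb hv,
        rowMajor_inj hi hv, h.w _ hv _ hi, h.w _ hi _ hv, pushArc]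
      by_cases e1 : a = s.i ∧ b = v
      · have e2 : ¬(a = v ∧ b = s.i) := fun h => hne (e1.1.symm.trans h.1)
        simp [e1, hne]
      · by_cases e2 : a = v ∧ b = s.i
        · simp [e2, hne.symm]
        · simp [e1, e2, h.w a ha b hb]
    · simp only [Memory.setReal_real_self, Function.update_apply, h.c _ hi, h.c _ hv,
        hne.symm, if_false, pushNode]
      by_cases e1 : a = v
      · simp [e1, hne.symm]
      · by_cases e2 : a = s.i
        · simp [e2, hne]
        · simp [e1, e2, h.c a ha]

/-- The amount is saved first because the push overwrites the cells from which it is computed. -/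
lemma wp_loadPushProgram (h : Represents K σ s) (hrow : ∀ i ≤ K + 1, σ.nat 5 i = i * K)
    (hi : s.i < K) (hv : s.cur s.i < K) (hne : s.i ≠ s.cur s.i) {x : RealExpr} {δ : ℝ}
    (hx : x.eval σ = δ) {p : Program} {Q : Memory → Prop}
    (hQ : ∀ σ' : Memory, Represents K σ' { s with
      w := pushArc s.w s.i (s.cur s.i) δ
      c := pushNode s.c s.i (s.cur s.i) δ } → p.wp Q σ') :
    (Program.seq (.writeReal 24 (.const 0) x) (.seq pushProgram p)).wp Q σ := by
  have h' : Represents K (σ.setReal 24 0 δ) s := by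
    refine ⟨?_, ?_, h.d, h.cur, h.i, h.sweep⟩
    · rw [Memory.setReal_real_of_ne _ _ _ (by decide)]; exact h.w
    · rw [Memory.setReal_real_of_ne _ _ _ (by decide)]; exact h.c
  have h24 : (σ.setReal 24 0 δ).real 24 0 = δ := by simp
  have key := wp_pushProgram (Q := p.wp Q) h' hrow hi hv hne fun σ' _ hR => by
    rw [h24] at hR
    exact hQ σ' hR
  simp only [Program.wp, hx, NatExpr.eval]
  exact key

lemma holds_natEqTest {x y : NatExpr} : (natEqTest x y).Holds σ ↔ x.eval σ = y.eval σ := by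
  simp only [natEqTest, Test.Holds]
  omega

lemma Represents.eval_arcExpr (h : Represents K σ s) (hrow : ∀ i ≤ K + 1, σ.nat 5 i = i * K)
    {u v : NatExpr} (hu : u.eval σ < K) (hv : v.eval σ < K) :
    (arcExpr u v).eval σ = s.w (u.eval σ) (v.eval σ) := by
  simp only [arcExpr, RealExpr.eval, NatExpr.eval, hrow _ (show u.eval σ ≤ K + 1 by omega)]
  exact h.w _ hu _ hv

lemma wp_stepProgram (h : Represents K σ s) (hK : σ.nat 12 0 = K)
    (hrow : ∀ i ≤ K + 1, σ.nat 5 i = i * K) :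
    stepProgram.wp (fun σ' => Represents K σ' (step K s)) σ := by
  have hi14 : (NatExpr.var 14).eval σ = s.i := h.i
  have hcur : curExpr.eval σ = s.cur s.i := by
    simp only [curExpr, NatExpr.eval, h.i, h.cur]
  have hd : (NatExpr.read 6 (.var 14)).eval σ = s.d s.i := by
    simp only [NatExpr.eval, h.i, h.d]
  have hdc : (NatExpr.add (.read 6 curExpr) (.const 1)).eval σ = s.d (s.cur s.i) + 1 := by
    simp only [NatExpr.eval, hcur, h.d]
  have hK' : (NatExpr.var 12).eval σ = K := hK
  refine ⟨fun h1 => ?_, fun h1 => ?_⟩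
  · simp only [Test.Holds, hi14, hK'] at h1
    have hc : (RealExpr.read 9 (.var 14)).eval σ = s.c s.i := by
      simp only [RealExpr.eval, hi14]
      exact h.c _ h1
    have h0 : (RealExpr.const 0).eval σ = 0 := Rat.cast_zero
    have hneg : (RealExpr.sub (.const 0) (.read 9 (.var 14))).eval σ = -s.c s.i := by
      rw [← zero_sub, ← h0, ← hc]; rfl
    have hK1 : (NatExpr.add (.var 12) (.const 1)).eval σ = K + 1 := by rw [← hK]; rfl
    have hact_iff : (Test.conj (.realLT (.read 9 (.var 14)) (.const 0))
        (.natLT (.read 6 (.var 14)) (.add (.var 12) (.const 1)))).Holds σ ↔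
        Active K s.c s.d s.i := by
      simp only [Test.Holds]
      rw [hc, hd, hK1, h0]
      exact Iff.rfl
    refine ⟨fun h2 => ?_, fun h2 => ?_⟩
    · have hact : Active K s.c s.d s.i := hact_iff.mp h2
      refine ⟨fun h3 => ?_, fun h3 => ?_⟩
      · simp only [Test.Holds, hcur, hK'] at h3
        have harc : (arcExpr (.var 14) curExpr).eval σ = s.w s.i (s.cur s.i) := by
          rw [h.eval_arcExpr hrow (by rw [hi14]; exact h1) (by rw [hcur]; exact h3), hi14, hcur]
        refine ⟨fun h4 => ?_, fun h4 => ?_⟩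
        · have h4 : 0 < s.w s.i (s.cur s.i) ∧ s.d s.i = s.d (s.cur s.i) + 1 := by
            refine ⟨?_, ?_⟩
            · have := h4.1
              simp only [Test.Holds] at this
              rwa [harc, h0] at this
            · have := holds_natEqTest.mp h4.2
              rwa [hd, hdc] at this
          have hne : s.i ≠ s.cur s.i := fun e => by
            have := h4.2; rw [← e] at this; omega
          refine ⟨fun h5 => ?_, fun h5 => ?_⟩
          · simp only [Test.Holds] at h5
            rw [harc, hneg] at h5
            have hstep : step K s = { s with
                w := pushArc s.w s.i (s.cur s.i) (-s.c s.i)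
                c := pushNode s.c s.i (s.cur s.i) (-s.c s.i)
                i := s.i + 1 } := by
              unfold PushRelabel.step
              rw [if_pos h1, if_pos hact, if_pos h3, if_pos h4, if_pos h5]
            rw [hstep]
            refine wp_loadPushProgram h hrow h1 h3 hne hneg fun σ' hR => ?_
            refine ⟨hR.w, hR.c, hR.d, hR.cur, ?_, hR.sweep⟩
            simp only [NatExpr.eval, Memory.setNat_nat_self, Function.update_self, hR.i]
          · simp only [Test.Holds] at h5
            rw [harc, hneg] at h5
            have hstep : step K s = { s with
                w := pushArc s.w s.i (s.cur s.i) (s.w s.i (s.cur s.i))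
                c := pushNode s.c s.i (s.cur s.i) (s.w s.i (s.cur s.i))
                cur := Function.update s.cur s.i (s.cur s.i + 1) } := by
              unfold PushRelabel.step
              rw [if_pos h1, if_pos hact, if_pos h3, if_pos h4, if_neg h5]
            rw [hstep]
            refine wp_loadPushProgram h hrow h1 h3 hne harc fun σ' hR => ?_
            refine ⟨hR.w, hR.c, hR.d, ?_, hR.i, hR.sweep⟩
            simp only [curExpr, NatExpr.eval, Memory.setNat_nat_self, hR.i, hR.cur]
        · have h4 : ¬(0 < s.w s.i (s.cur s.i) ∧ s.d s.i = s.d (s.cur s.i) + 1) := by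
            intro h5
            apply h4
            refine ⟨?_, holds_natEqTest.mpr ?_⟩
            · simp only [Test.Holds]
              rw [harc, h0]
              exact h5.1
            · rw [hd, hdc]; exact h5.2
          have hstep : step K s = { s with
              cur := Function.update s.cur s.i (s.cur s.i + 1) } := by
            unfold PushRelabel.step
            rw [if_pos h1, if_pos hact, if_pos h3, if_neg h4]
          rw [hstep]
          refine ⟨h.w, h.c, h.d, ?_, h.i, h.sweep⟩
          simp only [curExpr, NatExpr.eval, Memory.setNat_nat_self, h.i, h.cur]
      · simp only [Test.Holds, hcur, hK'] at h3
        have hstep : step K s = { s with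
            d := Function.update s.d s.i (s.d s.i + 1)
            cur := Function.update s.cur s.i 0 } := by
          unfold PushRelabel.step
          rw [if_pos h1, if_pos hact, if_neg h3]
        rw [hstep]
        refine ⟨h.w, h.c, ?_, ?_, h.i, h.sweep⟩
        · simp [NatExpr.eval, h.i, h.d]
        · simp [NatExpr.eval, h.i, h.cur]
    · have hact : ¬ Active K s.c s.d s.i := fun h => h2 (hact_iff.mpr h)
      have hstep : step K s = { s with i := s.i + 1 } := by
        unfold PushRelabel.step
        rw [if_pos h1, if_neg hact]
      rw [hstep]
      refine ⟨h.w, h.c, h.d, h.cur, ?_, h.sweep⟩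
      simp [NatExpr.eval, h.i]
  · simp only [Test.Holds, hi14, hK'] at h1
    have hstep : step K s = { s with i := 0, sweep := s.sweep + 1 } := by
      unfold PushRelabel.step
      rw [if_neg h1]
    rw [hstep]
    refine ⟨h.w, h.c, h.d, h.cur, ?_, ?_⟩
    · simp [NatExpr.eval]
    · simp [NatExpr.eval, h.sweep]

/-- The loop variant is `potential`, initially at most 6 (K + 1)³, and each iteration has constant
cost. Termination of the loop is by the count of sweeps, after which `SweepInv` guarantees that no
vertex is active. -/
lemma runs_pushRelabelProgram : ∃ C, ∀ {K : ℕ} {w₀ : ℕ → ℕ → ℝ} {c₀ : ℕ → ℝ} {σ : Memory},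
    (∀ u < K, ∀ v < K, 0 ≤ w₀ u v) → Represents K σ (initial w₀ c₀) → σ.nat 12 0 = K →
    (∀ i ≤ K + 1, σ.nat 5 i = i * K) →
    Runs pushRelabelProgram σ (C * (K + 1) ^ 3) (fun σ' => ∃ s, Valid K w₀ c₀ s ∧
      (∀ u < K, ¬ Active K s.c s.d u) ∧ σ'.nat 6 = s.d) := by
  obtain ⟨B, hB⟩ : ∃ B, B = (Test.natLT (.var 13) (.add (.add (.const 1)
    (.read 5 (.add (.var 12) (.const 1)))) (.read 5 (.add (.var 12) (.const 1))))).cost := ⟨_, rfl⟩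
  obtain ⟨D, hD⟩ : ∃ D, D = stepProgram.maxCost := ⟨_, rfl⟩
  refine ⟨6 * (B + D) + B, fun {K w₀ c₀ σ} hw hR hK hrow => ?_⟩
  have hbound : ∀ σ', Agree stepProgram σ σ' → (NatExpr.add (.add (.const 1)
      (.read 5 (.add (.var 12) (.const 1)))) (.read 5 (.add (.var 12) (.const 1)))).eval σ' =
      sweepBound K := by
    intro σ' hA
    simp only [NatExpr.eval, hA.nat 12 (by decide), hA.nat 5 (by decide), hK, hrow _ le_rfl,
      sweepBound]
  refine (runs_loop_variant (k := potential K (initial w₀ c₀)) (fun k σ' => ∃ s, Represents K σ' s ∧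
    Valid K w₀ c₀ s ∧ SweepInv K s ∧ potential K s = k)
    ⟨_, hR, valid_initial hw, sweepInv_initial _ _, rfl⟩ (T := D) ?_).mono ?_ ?_
  · rintro k σ' hA ⟨s, hs, hval, hinv, rfl⟩ hb
    have hsweep : s.sweep < sweepBound K := by
      have := hb
      simp only [Test.Holds] at this
      rw [hbound σ' hA] at this
      simpa only [NatExpr.eval, hs.sweep] using this
    rw [hD]
    refine (runs_of_wp (wp_stepProgram hs (by rw [hA.nat 12 (by decide), hK])
      (by rw [hA.nat 5 (by decide)]; exact hrow))).mono le_rfl fun σ'' _ h => ?_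
    exact ⟨_, potential_step hval hsweep, _, h, hval.step, hinv.step hval.i_bound, rfl⟩
  · rw [← hB]
    have h1 := potential_initial_le (K := K) w₀ c₀
    have h2 : 1 ≤ (K + 1) ^ 3 := Nat.one_le_pow _ _ (by omega)
    calc potential K (initial w₀ c₀) * (B + D) + B
        ≤ 6 * (K + 1) ^ 3 * (B + D) + B * (K + 1) ^ 3 :=
          add_le_add (Nat.mul_le_mul_right _ h1) (Nat.le_mul_of_pos_right _ h2)
      _ = (6 * (B + D) + B) * (K + 1) ^ 3 := by ring
  · rintro σ' hA ⟨k, ⟨s, hs, hval, hinv, -⟩, hb⟩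
    refine ⟨s, hval, fun u hu => hinv.not_active ?_ hu, hs.d⟩
    simp only [Test.Holds] at hb
    rw [hbound σ' ⟨hA.nat, hA.real⟩] at hb
    simpa only [NatExpr.eval, hs.sweep, not_lt] using hb

end BetheRAM

namespace BetheRAM

/-! #### The output -/

/-- Marks the labels in use. -/
def markProgram : Program :=
  .forLoop 10 (.var 12) (.writeNat 8 (.read 6 (.var 10)) (.const 1))

/-- Finds the least positive label that is not in use. -/
def gapProgram : Program :=
  .seq markProgram <|
  .seq (.writeNat 15 (.const 0) (.const 1))
  (.loop (.natLT (.const 0) (.read 8 (.var 15)))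
    (.writeNat 15 (.const 0) (.add (.var 15) (.const 1))))

lemma runs_markProgram : ∃ C, ∀ {K : ℕ} {σ : Memory}, σ.nat 12 0 = K → σ.nat 8 = (fun _ => 0) →
    Runs markProgram σ (C * (K + 1)) (fun σ' =>
      ∀ x, 0 < σ'.nat 8 x ↔ ∃ u < K, σ.nat 6 u = x) := by
  refine ⟨_, fun {K σ} hK h8 => runs_forLoop_wp (N := K)
    (fun j σ' => ∀ x, 0 < σ'.nat 8 x ↔ ∃ u < j, σ.nat 6 u = x) (by decide)
    (fun _ _ _ h => h) (by simp [h8]) ?_ ?_⟩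
  · intro σ' hA
    simp only [NatExpr.eval, hA.nat 12 (by decide), hK]
  · intro j _ σ' hA hj hI x
    simp only [NatExpr.eval, hj, hA.nat 6 (by decide), Memory.setNat_nat_self,
      Function.update_apply]
    split_ifs with h
    · exact ⟨fun _ => ⟨j, by omega, h.symm⟩, fun _ => one_pos⟩
    · rw [hI x]
      constructor
      · rintro ⟨u, hu, e⟩
        exact ⟨u, by omega, e⟩
      · rintro ⟨u, hu, e⟩
        rcases Nat.lt_succ_iff_lt_or_eq.mp hu with hu | rfl
        · exact ⟨u, hu, e⟩
        · exact absurd e.symm h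

lemma runs_gapProgram : ∃ C, ∀ {K : ℕ} {σ : Memory}, σ.nat 12 0 = K → σ.nat 8 = (fun _ => 0) →
    Runs gapProgram σ (C * (K + 1)) (fun σ' =>
      1 ≤ σ'.nat 15 0 ∧ σ'.nat 15 0 ≤ K + 1 ∧ ∀ u < K, σ.nat 6 u ≠ σ'.nat 15 0) := by
  classical
  obtain ⟨C, hC⟩ := runs_markProgram
  refine ⟨C + 13, fun {K σ} hK h8 => ?_⟩
  have hex := exists_gap K (σ.nat 6)
  obtain ⟨h1, h2, h3⟩ := Nat.find_spec hex
  -- The search starts at label 1, so the least gap r + 1 ≤ K + 1 is reached after r increments.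
  obtain ⟨r, hr⟩ := Nat.exists_eq_add_of_le' h1
  refine ((hC hK h8).seq (T' := 3 + (∑ j ∈ Finset.range r, (5 + 6) + 5)) fun σ₁ hA₁ h₁ =>
    Runs.seq (Q := fun σ' => σ'.nat 15 0 = 1 ∧ σ'.nat 8 = σ₁.nat 8)
      (runs_of_wp (p := .writeNat 15 (.const 0) (.const 1)) ?_) fun σ₂ hA₂ h₂ => ?_).mono
    ?_ fun _ _ h => h
  · simp [Program.wp, NatExpr.eval]
  · refine (runs_loop_count (T := fun _ => 6) (N := r) (fun j σ' => σ'.nat 15 0 = j + 1) h₂.1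
      (fun j hj σ' hA hI => ⟨?_, runs_of_wp ?_⟩) (fun σ' hA hI => ?_)).mono le_rfl ?_
    · simp only [Test.Holds, NatExpr.eval, hI, hA.nat 8 (by decide), h₂.2, h₁]
      have := Nat.find_min hex (m := j + 1) (by omega)
      by_contra hne
      exact this ⟨by omega, by omega, fun u hu e => hne ⟨u, hu, e⟩⟩
    · simp [Program.wp, NatExpr.eval, hI]
    · simp only [Test.Holds, NatExpr.eval, hI, hA.nat 8 (by decide), h₂.2, h₁, ← hr]
      rintro ⟨u, hu, e⟩
      exact h3 u hu e
    · intro σ' _ h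
      rw [h, ← hr]
      exact ⟨h1, h2, h3⟩
  · simp only [Finset.sum_const, Finset.card_range, smul_eq_mul]
    nlinarith

/-- Reads the point off the labels. -/
def decodeProgram : Program :=
  .seq (.forLoop 10 (.read 0 (.const 0)) (.writeReal 11 (.var 10) (.read 5 (.var 10))))
  (.forLoop 10 (.var 12) (.cond (.natLT (.read 6 (.var 10)) (.var 15)) .skip
    (.writeReal 11 (.read 4 (.var 10)) (.add (.read 11 (.read 4 (.var 10)))
      (.sub (.read 8 (.var 10)) (.read 7 (.var 10)))))))

/-- The point is assembled in the form of `Encodes.point_eq`: start at the lower end and add the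
length of each interval whose node lies above the gap. -/
lemma runs_decodeProgram : ∃ C, ∀ {n K : ℕ} {σ : Memory}, σ.nat 0 0 = n → σ.nat 12 0 = K →
    Runs decodeProgram σ (C * (K + n + 1)) (fun σ' => ∀ i < n, σ'.real 11 i = σ.real 5 i +
      ∑ u ∈ Finset.range K, if σ.nat 4 u = i then
        (σ.real 8 u - σ.real 7 u) * (if σ.nat 15 0 ≤ σ.nat 6 u then 1 else 0) else 0) := by
  obtain ⟨B, hB⟩ : ∃ B, B = (NatExpr.read 0 (.const 0)).cost + 9 +
    Program.maxCost (.writeReal 11 (.var 10) (.read 5 (.var 10))) := ⟨_, rfl⟩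
  obtain ⟨D, hD⟩ : ∃ D, D = (NatExpr.var 12).cost + 9 +
    Program.maxCost (.cond (.natLT (.read 6 (.var 10)) (.var 15)) .skip
    (.writeReal 11 (.read 4 (.var 10)) (.add (.read 11 (.read 4 (.var 10)))
      (.sub (.read 8 (.var 10)) (.read 7 (.var 10)))))) := ⟨_, rfl⟩
  refine ⟨B + D, fun {n K σ} hn hK => ?_⟩
  refine ((runs_forLoop_wp (N := n) (fun j σ' => ∀ i < j, σ'.real 11 i = σ.real 5 i) (by decide)
    (fun _ _ _ h => h) (by simp) ?_ ?_).seq fun σ₁ hA₁ h₁ => runs_forLoop_wp (N := K)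
      (fun j σ' => ∀ i < n, σ'.real 11 i = σ.real 5 i +
        ∑ u ∈ Finset.range j, if σ.nat 4 u = i then
        (σ.real 8 u - σ.real 7 u) * (if σ.nat 15 0 ≤ σ.nat 6 u then 1 else 0) else 0) (by decide)
      (fun _ _ _ h => h) (by simpa using h₁) ?_ ?_).mono ?_ fun _ _ h => h
  · intro σ' hA
    simp only [NatExpr.eval, hA.nat 0 (by decide), hn]
  · intro j hj σ' hA h10 hI i hi
    simp only [NatExpr.eval, RealExpr.eval, h10, hA.real 5 (by decide), Memory.setReal_real_self,
      Function.update_apply]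
    split_ifs with h
    · rw [h]
    · exact hI i (by omega)
  · intro σ' hA
    simp only [NatExpr.eval, hA.nat 12 (by decide), hA₁.nat 12 (by decide), hK]
  · intro j hj σ' hA h10 hI
    simp only [Program.wp, Test.Holds, NatExpr.eval, RealExpr.eval, h10, hA.real 8 (by decide),
      hA₁.real 8 (by decide), hA.real 7 (by decide), hA₁.real 7 (by decide),
      hA.nat 4 (by decide), hA₁.nat 4 (by decide), hA.nat 6 (by decide), hA₁.nat 6 (by decide),
      hA.nat 15 (by decide), hA₁.nat 15 (by decide), Memory.setReal_real_self, not_lt]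
    refine ⟨fun h i hi => ?_, fun h i hi => ?_⟩
    · rw [hI i hi, Finset.sum_range_succ, if_neg (not_le.mpr h)]
      simp
    · rw [Finset.sum_range_succ, if_pos h, Function.update_apply, mul_one, ← add_assoc, ← hI i hi]
      split_ifs with e e' e'
      · rw [e]
      · exact absurd e.symm e'
      · exact absurd e'.symm e
      · rw [add_zero]
  · rw [← hB, ← hD]
    nlinarith [Nat.zero_le (B * K), Nat.zero_le (D * n)]

/-- Adds the cost of the pair in turn to the value. -/
def pairValueProgram : Program :=
  .cond (.realLT (.const 0) (matrixExpr (.var 10) (.var 11)))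
    (.writeReal 23 (.const 0) (.add (.var 23) (pairExpr (matrixExpr (.var 10) (.var 11))
      (.read 11 (.var 10)) (.read 11 (.var 11))))) .skip

/-- Adds the cost of the variable in turn to the value. -/
def unaryValueProgram : Program :=
  .writeReal 23 (.const 0)
    (.add (.var 23) (unaryExpr (.read 1 (.var 10)) (.read 11 (.var 10))))

/-- Computes the value of the objective function. -/
def valueProgram : Program :=
  .seq (.writeReal 23 (.const 0) (.const 0)) <|
  .forLoop 10 (.read 0 (.const 0)) <|
  .seq unaryValueProgram (.forLoop 11 (.read 0 (.const 0)) pairValueProgram)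

/-- The objective is evaluated directly over all n² ordered pairs, where only positive matrix
entries contribute. -/
lemma runs_valueProgram : ∃ C, ∀ {n m : ℕ} {M : BinaryMRF n m} {ε : ℝ} {σ : Memory},
    Ready M ε σ → (∀ i < n, σ.real 11 i ∈ Set.Icc (0 : ℝ) 1) →
    Runs valueProgram σ (C * ((n + 1) * (n + 1)))
      (fun σ' => σ'.real 23 0 = (M.gridProblem ε).cost (σ.real 11)) := by
  obtain ⟨B, hB⟩ : ∃ B, B = unaryValueProgram.maxCost := ⟨_, rfl⟩
  obtain ⟨D, hD⟩ : ∃ D, D = (NatExpr.read 0 (.const 0)).cost + 9 + pairValueProgram.maxCost :=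
    ⟨_, rfl⟩
  refine ⟨B + D + 14, fun {n m M ε σ} hR hq => ?_⟩
  set G := M.gridProblem ε with hG
  have hinit : Runs (.writeReal 23 (.const 0) (.const 0)) σ 3 (fun σ' => σ'.real 23 0 = 0) :=
    runs_of_wp (by simp [Program.wp, NatExpr.eval, RealExpr.eval])
  refine (hinit.seq fun σ₀ hA₀ h₀ => runs_forLoop (c := 10) (N := n)
    (T := fun _ => B + D * (n + 1)) (fun k σ' => σ'.real 23 0 = ∑ i ∈ Finset.range k,
      (G.φ i (σ.real 11 i) + ∑ j ∈ Finset.range n, G.f i j (σ.real 11 i) (σ.real 11 j)))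
    (by decide) (fun _ _ _ h => h) (by simpa using h₀) ?_ ?_).mono ?_ ?_
  · intro σ' hA
    simp only [NatExpr.eval, hA.nat 0 (by decide), hA₀.nat 0 (by decide), hR.size]
  · intro i hi σ₁ hA₁ h10 hI
    have hA : Agree valueProgram σ σ₁ :=
      (hA₀.mono (by decide) (by decide)).trans (hA₁.mono (by decide) (by decide))
    rw [hB, hD]
    refine Runs.seq (Q := fun σ' => σ'.real 23 0 = σ₁.real 23 0 + G.φ i (σ.real 11 i))
      (runs_of_wp ?_) fun σ₂ hA₂ h₂ => ?_
    · simp only [unaryValueProgram, Program.wp, NatExpr.eval, RealExpr.eval, eval_unaryExpr, h10,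
        Memory.setReal_real_self, Function.update_self, hA.real 11 (by decide),
        hA.real 1 (by decide), hR.field]
      rfl
    have hA' : Agree valueProgram σ σ₂ := hA.trans (hA₂.mono (by decide) (by decide))
    have h10' : σ₂.nat 10 0 = i := by rw [hA₂.nat 10 (by decide), h10]
    refine (runs_forLoop_wp (c := 11) (N := n) (fun j σ' => σ'.real 23 0 = σ₂.real 23 0 +
      ∑ j' ∈ Finset.range j, G.f i j' (σ.real 11 i) (σ.real 11 j')) (by decide)
      (fun _ _ _ h => h) (by simp) ?_ (fun j hj σ₃ hA₃ h11 hJ => ?_)).mono le_rfl ?_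
    · intro σ' hA
      simp only [NatExpr.eval, hA.nat 0 (by decide), hA'.nat 0 (by decide), hR.size]
    · have hA'' : Agree valueProgram σ σ₃ := hA'.trans (hA₃.mono (by decide) (by decide))
      have h10'' : σ₃.nat 10 0 = i := by rw [hA₃.nat 10 (by decide), h10']
      have h11' := hA''.real 11 (by decide)
      have hR₃ := hR.of_agree hA'' (by decide) (by decide)
      have hme := hR₃.eval_matrixExpr (i := .var 10) (j := .var 11)
        (by simpa only [NatExpr.eval, h10''] using hi) (by simpa only [NatExpr.eval, h11] using hj)
      simp only [NatExpr.eval, h10'', h11] at hme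
      have hx : (RealExpr.read 11 (.var 10)).eval σ₃ = σ.real 11 i := by
        simp only [RealExpr.eval, NatExpr.eval, h10'', h11']
      have hy : (RealExpr.read 11 (.var 11)).eval σ₃ = σ.real 11 j := by
        simp only [RealExpr.eval, NatExpr.eval, h11, h11']
      refine ⟨fun hw => ?_, fun hw => ?_⟩
      · simp only [Test.Holds] at hw
        have hw' : 0 < M.weightMatrix i j := by
          rw [hme] at hw
          simpa only [RealExpr.eval, Rat.cast_zero] using hw
        have hp := eval_pairExpr σ₃ (w := matrixExpr (.var 10) (.var 11))
          (x := .read 11 (.var 10)) (y := .read 11 (.var 11)) (by rw [hme]; exact hw')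
          (by rw [hx]; exact hq i hi) (by rw [hy]; exact hq j hj)
        rw [hme, hx, hy] at hp
        have hf : G.f i j (σ.real 11 i) (σ.real 11 j) =
            pairCost (M.weightMatrix i j) (σ.real 11 i) (σ.real 11 j) := if_pos hw'
        rw [Finset.sum_range_succ, ← add_assoc, ← hJ, hf, ← hp]
        simp only [Program.wp, NatExpr.eval, Memory.setReal_real_self, Function.update_self]
        rfl
      · simp only [Test.Holds] at hw
        rw [hme] at hw
        have hw' : ¬ 0 < M.weightMatrix i j := by
          simpa only [RealExpr.eval, Rat.cast_zero] using hw
        have hf : G.f i j (σ.real 11 i) (σ.real 11 j) = 0 := if_neg hw'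
        rw [Finset.sum_range_succ, hf, add_zero]
        exact hJ
    · intro σ' _ h
      rw [h, h₂, hI, Finset.sum_range_succ, add_assoc]
  · simp only [Finset.sum_const, Finset.card_range, smul_eq_mul]
    have : (NatExpr.read 0 (.const 0)).cost = 2 := rfl
    rw [this]
    nlinarith [Nat.zero_le (B * n), Nat.zero_le (B * n * n), Nat.zero_le (D * n)]
  · intro σ' _ h
    rw [h, GridProblem.cost, Finset.sum_add_distrib]
    rfl

/-- Writes the output. -/
def outputProgram : Program :=
  .seq (.forLoop 10 (.read 0 (.const 0)) (.writeReal 1 (.var 10) (.read 11 (.var 10))))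
  (.writeReal 0 (.const 0) (.sub (.const 0) (.var 23)))

/-- The output overwrites the input arrays for ε and θ, which is why this comes last. -/
lemma runs_outputProgram : ∃ C, ∀ {n : ℕ} {σ : Memory}, σ.nat 0 0 = n →
    Runs outputProgram σ (C * (n + 1)) (fun σ' =>
      outputPoint n σ' = (fun i : Fin n => σ.real 11 i) ∧ outputValue σ' = -σ.real 23 0) := by
  obtain ⟨B, hB⟩ : ∃ B, B = (NatExpr.read 0 (.const 0)).cost + 9 +
    Program.maxCost (.writeReal 1 (.var 10) (.read 11 (.var 10))) := ⟨_, rfl⟩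
  refine ⟨B + 6, fun {n σ} hn => ?_⟩
  refine ((runs_forLoop_wp (N := n) (fun j σ' => ∀ i < j, σ'.real 1 i = σ.real 11 i) (by decide)
    (fun _ _ _ h => h) (by simp) ?_ ?_).seq (T' := 6) fun σ₁ hA₁ h₁ => runs_of_wp ?_).mono ?_
    fun _ _ h => h
  · intro σ' hA
    simp only [NatExpr.eval, hA.nat 0 (by decide), hn]
  · intro j hj σ' hA h10 hI i hi
    simp only [NatExpr.eval, RealExpr.eval, h10, hA.real 11 (by decide), Memory.setReal_real_self,
      Function.update_apply]
    split_ifs with h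
    · rw [h]
    · exact hI i (by omega)
  · refine ⟨funext fun i => ?_, ?_⟩
    · simp only [outputPoint, ne_eq, one_ne_zero, not_false_eq_true, Memory.setReal_real_of_ne]
      exact h₁ i i.2
    · simp [outputValue, NatExpr.eval, RealExpr.eval, hA₁.real 23 (by decide)]
  · rw [← hB]
    nlinarith

end BetheRAM

/-! ### From optimal cuts to mesh minimizers, and bounds on the size of the input and the mesh -/

namespace BinaryMRF

variable {n m : ℕ} {M : BinaryMRF n m} {ε : ℝ}

/-- A minimizer of the energy of the cut problem yields a minimizer of the free energy. -/
lemma Attractive.isMeshMinimizer (hM : M.Attractive) (hε : 0 < ε) {own : ℕ → ℕ} {lo hi : ℕ → ℝ}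
    (hL : (M.gridProblem ε).IsLayout own lo hi) {y : ℕ → ℝ} (hy : ∀ u, y u = 0 ∨ y u = 1)
    (hmin : ∀ z : ℕ → ℝ, (∀ u, z u = 0 ∨ z u = 1) →
      (M.gridProblem ε).energy own lo hi y ≤ (M.gridProblem ε).energy own lo hi z) {q : ℕ → ℝ}
    (hq : ∀ i < n, q i = (M.gridProblem ε).pt i 0 + ∑ u ∈ Finset.range (M.gridProblem ε).nodes,
      if own u = i then (hi u - lo u) * y u else 0) :
    M.IsMeshMinimizer (M.simpleMesh ε) (fun i : Fin n => q i) := by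
  obtain ⟨a, ha⟩ := GridProblem.exists_encodes hL (hM.submodular hε) (fun u _ => hy u)
    (hmin (fun _ => 0) (by simp))
  have hqa : (fun i : Fin n => q i) = fun i : Fin n => (M.gridProblem ε).pt i (a i) :=
    funext fun i => (hq i i.2).trans (GridProblem.Encodes.point_eq hL ha (show (i : ℕ) < _ from i.2))
  rw [hqa]
  refine ⟨(hM.mem_meshPoints_iff hε).mpr ⟨a, fun i hi => (ha i hi).1, rfl⟩, fun q' hq' => ?_⟩
  obtain ⟨a', ha', rfl⟩ := (hM.mem_meshPoints_iff hε).mp hq'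
  have := GridProblem.encodes_isMin hL (hM.submodular hε) hmin ha ha'
  rwa [hM.cost_eq ε, hM.cost_eq ε] at this

/-- Lets the time for reading the m edges be absorbed in the cubic bound. -/
lemma card_edges_le (M : BinaryMRF n m) : m ≤ n * n := by
  simpa using Fintype.card_le_of_injective _ M.edge_injective

lemma abs_W_le_maxWeight (M : BinaryMRF n m) (e : Fin m) : |M.W e| ≤ M.maxWeight :=
  le_ciSup (f := fun e => |M.W e|) (Set.finite_range _).bddAbove e

lemma maxWeight_nonneg (M : BinaryMRF n m) : 0 ≤ M.maxWeight :=
  Real.iSup_nonneg fun _ => abs_nonneg _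

lemma Attractive.meshSize_le_maxWeight (hM : M.Attractive) (hε : 0 < ε) :
    (meshSize (M.simpleMesh ε) : ℝ) ≤ 2 * (n + n * m * M.maxWeight / ε) := by
  have h1 : ∑ e, |M.W e| ≤ m * M.maxWeight := by
    simpa using Finset.sum_le_sum fun e (_ : e ∈ Finset.univ) => M.abs_W_le_maxWeight e
  have h2 : (n : ℝ) / ε * ∑ e, |M.W e| ≤ n / ε * (m * M.maxWeight) :=
    mul_le_mul_of_nonneg_left h1 (by positivity)
  have h3 : (n : ℝ) / ε * (m * M.maxWeight) = n * m * M.maxWeight / ε := by ring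
  have h4 : 0 ≤ n * m * M.maxWeight / ε := by
    have := M.maxWeight_nonneg
    positivity
  linarith [hM.meshSize_le hε]

end BinaryMRF

/-! ### The complete program and its running time -/

namespace BetheRAM

/-- Sets up the discretized problem. -/
def setupProgram : Program :=
  .seq rowProgram <| .seq weightProgram <| .seq meshProgram nodeRowProgram

lemma runs_setupProgram : ∃ C, ∀ {n m : ℕ} {M : BinaryMRF n m}, M.Attractive → ∀ {ε : ℝ}, 0 < ε →
    Runs setupProgram (inputMemory M ε) (C * ((M.gridProblem ε).nodes + n + 1) ^ 3)
      (Ready M ε) := by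
  obtain ⟨C₁, h₁⟩ := runs_rowProgram
  obtain ⟨C₂, h₂⟩ := runs_weightProgram
  obtain ⟨C₃, h₃⟩ := runs_meshProgram
  obtain ⟨C₄, h₄⟩ := runs_nodeRowProgram
  refine ⟨C₁ + C₂ + C₃ + 2 * C₄, fun {n m M} hM {ε} hε => ?_⟩
  have hn : (inputMemory M ε).nat 0 0 = n := by simp [inputMemory, ofFin]
  refine ((h₁ hn rfl rfl).seq fun σ₁ hA₁ ⟨e20, erow⟩ => (h₂ M hM ?_ ?_ ?_ ?_ erow ?_ ?_).seq
    fun σ₂ hA₂ ⟨emat, eD⟩ => (h₃ hM hε ?_ ?_ ?_ ?_ eD ?_).seq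
    fun σ₃ hA₃ ⟨ebox, eK, hL⟩ => (h₄ eK ?_).mono le_rfl fun σ₄ hA₄ enode => ?_).mono ?_
    fun _ _ h => h
  · rw [hA₁.nat 0 (by decide)]; simp [inputMemory, ofFin]
  · rw [hA₁.nat 1 (by decide)]; rfl
  · rw [hA₁.nat 2 (by decide)]; rfl
  · rw [hA₁.real 2 (by decide)]; rfl
  · rw [hA₁.real 3 (by decide)]; rfl
  · rw [hA₁.real 4 (by decide)]; rfl
  · rw [hA₂.nat 0 (by decide), hA₁.nat 0 (by decide), hn]
  · rw [hA₂.real 0 (by decide), hA₁.real 0 (by decide)]; simp [inputMemory, ofFin]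
  · rw [hA₂.real 1 (by decide), hA₁.real 1 (by decide)]; rfl
  · rw [hA₂.real 20 (by decide), e20]
  · rw [hA₂.nat 12 (by decide), hA₁.nat 12 (by decide)]; rfl
  · rw [hA₃.nat 5 (by decide), hA₂.nat 5 (by decide), hA₁.nat 5 (by decide)]; rfl
  · constructor
    · rw [hA₄.nat 0 (by decide), hA₃.nat 0 (by decide), hA₂.nat 0 (by decide),
        hA₁.nat 0 (by decide), hn]
    · rw [hA₄.real 1 (by decide), hA₃.real 1 (by decide), hA₂.real 1 (by decide),
        hA₁.real 1 (by decide)]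
      rfl
    · rw [hA₄.nat 3 (by decide), hA₃.nat 3 (by decide), hA₂.nat 3 (by decide)]
      exact erow
    · rw [hA₄.real 3 (by decide), hA₃.real 3 (by decide)]
      exact emat
    · intro i hi
      rw [hA₄.real 5 (by decide), gridProblem_pt hi, hM.meshPoint_zero]
      exact (ebox ⟨i, hi⟩).1
    · intro i hi
      rw [hA₄.real 6 (by decide), gridProblem_pt hi, gridProblem_κ hi, hM.meshPoint_of_le hε le_rfl]
      exact (ebox ⟨i, hi⟩).2
    · rw [hA₄.nat 12 (by decide), eK]
    · rw [hA₄.nat 4 (by decide), hA₄.real 7 (by decide), hA₄.real 8 (by decide)]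
      exact hL
    · exact enode
  · set K := (M.gridProblem ε).nodes
    have hm := M.card_edges_le
    have e3 : K + n + 1 ≤ (K + n + 1) ^ 3 := Nat.le_self_pow (by norm_num) _
    have e1 : n + 1 ≤ (K + n + 1) ^ 3 := by omega
    have e2 : m + 1 ≤ (K + n + 1) ^ 3 := by
      calc m + 1 ≤ (n + 1) ^ 2 := by nlinarith
        _ ≤ (K + n + 1) ^ 2 := Nat.pow_le_pow_left (by omega) _
        _ ≤ (K + n + 1) ^ 3 := Nat.pow_le_pow_right (by omega) (by norm_num)
    have e4 : K + 1 + 1 ≤ 2 * (K + n + 1) ^ 3 := by omega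
    nlinarith [Nat.mul_le_mul_left C₁ e1, Nat.mul_le_mul_left C₂ e2, Nat.mul_le_mul_left C₃ e3,
      Nat.mul_le_mul_left C₄ e4]

/-- Solves the discretized problem. -/
def cutProgram : Program :=
  .seq coefProgram <| .seq arcProgram <| .seq pushRelabelProgram <| .seq gapProgram decodeProgram

lemma runs_cutProgram : ∃ C, ∀ {n m : ℕ} {M : BinaryMRF n m}, M.Attractive → ∀ {ε : ℝ}, 0 < ε →
    ∀ {σ : Memory}, Ready M ε σ → σ.nat 6 = (fun _ => 0) → σ.nat 7 = (fun _ => 0) →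
    σ.nat 8 = (fun _ => 0) → σ.nat 13 0 = 0 → σ.nat 14 0 = 0 →
    Runs cutProgram σ (C * ((M.gridProblem ε).nodes + n + 1) ^ 3)
      (fun σ' => M.IsMeshMinimizer (M.simpleMesh ε) (fun i : Fin n => σ'.real 11 i)) := by
  obtain ⟨C₁, h₁⟩ := runs_coefProgram
  obtain ⟨C₂, h₂⟩ := runs_arcProgram
  obtain ⟨C₃, h₃⟩ := runs_pushRelabelProgram
  obtain ⟨C₄, h₄⟩ := runs_gapProgram
  obtain ⟨C₅, h₅⟩ := runs_decodeProgram
  refine ⟨C₁ + C₂ + C₃ + C₄ + C₅, fun {n m M} hM {ε} hε {σ} hR z6 z7 z8 z13 z14 => ?_⟩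
  set G := M.gridProblem ε
  have hw := GridProblem.weight_nonneg hR.layout (hM.submodular hε)
  refine ((h₁ hM hε hR).seq fun σ₁ hA₁ ⟨ecoef, ebig⟩ => ?_).mono
    (T := C₁ * ((G.nodes + 1) * (n + 1)) + (C₂ * ((G.nodes + 1) * (G.nodes + 1)) +
      (C₃ * (G.nodes + 1) ^ 3 + (C₄ * (G.nodes + 1) + C₅ * (G.nodes + n + 1))))) ?_ fun _ _ h => h
  · have hR₁ := hR.of_agree hA₁ (by decide) (by decide)
    have e4 := hA₁.nat 4 (by decide)
    have e7 := hA₁.real 7 (by decide)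
    have e8 := hA₁.real 8 (by decide)
    refine (h₂ hM hε hR₁ (by rw [e4, e7, e8]; exact ebig)).seq fun σ₂ hA₂ earc => ?_
    rw [e4, e7, e8] at earc
    have hR₂ := hR₁.of_agree hA₂ (by decide) (by decide)
    have hrep : Represents G.nodes σ₂ (initial (G.weight (σ.nat 4) (σ.real 7) (σ.real 8))
        (G.coef (σ.nat 4) (σ.real 7) (σ.real 8))) := by
      refine ⟨earc, ?_, ?_, ?_, ?_, ?_⟩
      · rw [hA₂.real 9 (by decide)]; exact ecoef
      · rw [hA₂.nat 6 (by decide), hA₁.nat 6 (by decide), z6]; rfl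
      · rw [hA₂.nat 7 (by decide), hA₁.nat 7 (by decide), z7]; rfl
      · rw [hA₂.nat 14 (by decide), hA₁.nat 14 (by decide), z14]; rfl
      · rw [hA₂.nat 13 (by decide), hA₁.nat 13 (by decide), z13]; rfl
    refine (h₃ hw hrep hR₂.nodes hR₂.nodeRows).seq fun σ₃ hA₃ ⟨s, hval, hact, hd⟩ => ?_
    have hR₃ := hR₂.of_agree hA₃ (by decide) (by decide)
    have z8' : σ₃.nat 8 = fun _ => 0 := by
      rw [hA₃.nat 8 (by decide), hA₂.nat 8 (by decide), hA₁.nat 8 (by decide), z8]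
    refine (h₄ hR₃.nodes z8').seq fun σ₄ hA₄ ⟨hk1, hk2, hgap⟩ => ?_
    have hR₄ := hR₃.of_agree hA₄ (by decide) (by decide)
    refine (h₅ hR₄.size hR₄.nodes).mono le_rfl fun σ₅ hA₅ hq => ?_
    have f4 : σ₄.nat 4 = σ.nat 4 := by
      rw [hA₄.nat 4 (by decide), hA₃.nat 4 (by decide), hA₂.nat 4 (by decide), e4]
    have f7 : σ₄.real 7 = σ.real 7 := by
      rw [hA₄.real 7 (by decide), hA₃.real 7 (by decide), hA₂.real 7 (by decide), e7]
    have f8 : σ₄.real 8 = σ.real 8 := by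
      rw [hA₄.real 8 (by decide), hA₃.real 8 (by decide), hA₂.real 8 (by decide), e8]
    have f6 : σ₄.nat 6 = s.d := by rw [hA₄.nat 6 (by decide), hd]
    rw [hd] at hgap
    rw [f4, f7, f8, f6] at hq
    refine hM.isMeshMinimizer hε hR.layout (y := fun u => if σ₄.nat 15 0 ≤ s.d u then 1 else 0)
      (fun u => ?_) (fun z hz => hval.isMin hact hk1 hk2 hgap fun u _ => hz u) fun i hi => ?_
    · by_cases h : σ₄.nat 15 0 ≤ s.d u
      · exact .inr (if_pos h)
      · exact .inl (if_neg h)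
    · rw [hq i hi, hR₄.lower i hi]
  · generalize G.nodes = K
    have e1 : (K + 1) * (n + 1) ≤ (K + n + 1) ^ 3 := by
      calc (K + 1) * (n + 1) ≤ (K + n + 1) * (K + n + 1) := Nat.mul_le_mul (by omega) (by omega)
        _ = (K + n + 1) ^ 2 := (sq _).symm
        _ ≤ (K + n + 1) ^ 3 := Nat.pow_le_pow_right (by omega) (by norm_num)
    have e2 : (K + 1) * (K + 1) ≤ (K + n + 1) ^ 3 := by
      calc (K + 1) * (K + 1) ≤ (K + n + 1) * (K + n + 1) := Nat.mul_le_mul (by omega) (by omega)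
        _ = (K + n + 1) ^ 2 := (sq _).symm
        _ ≤ (K + n + 1) ^ 3 := Nat.pow_le_pow_right (by omega) (by norm_num)
    have e3 : (K + 1) ^ 3 ≤ (K + n + 1) ^ 3 := Nat.pow_le_pow_left (by omega) _
    have e5 : K + n + 1 ≤ (K + n + 1) ^ 3 := Nat.le_self_pow (by norm_num) _
    have e4 : K + 1 ≤ (K + n + 1) ^ 3 := by omega
    nlinarith [Nat.mul_le_mul_left C₁ e1, Nat.mul_le_mul_left C₂ e2, Nat.mul_le_mul_left C₃ e3,
      Nat.mul_le_mul_left C₄ e4, Nat.mul_le_mul_left C₅ e5]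

/-- Minimizes the free energy over the simple mesh. -/
def betheProgram : Program :=
  .seq setupProgram <| .seq cutProgram <| .seq valueProgram outputProgram

theorem runs_betheProgram : ∃ C, ∀ {n m : ℕ} {M : BinaryMRF n m}, M.Attractive →
    ∀ {ε : ℝ}, 0 < ε →
    Runs betheProgram (inputMemory M ε) (C * ((M.gridProblem ε).nodes + n + 1) ^ 3) (fun σ =>
      M.IsMeshMinimizer (M.simpleMesh ε) (outputPoint n σ) ∧
        outputValue σ = -M.freeEnergy (outputPoint n σ)) := by
  obtain ⟨C₁, h₁⟩ := runs_setupProgram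
  obtain ⟨C₂, h₂⟩ := runs_cutProgram
  obtain ⟨C₃, h₃⟩ := runs_valueProgram
  obtain ⟨C₄, h₄⟩ := runs_outputProgram
  refine ⟨C₁ + C₂ + C₃ + C₄, fun {n m M} hM {ε} hε => ?_⟩
  refine ((h₁ hM hε).seq fun σ₁ hA₁ hR₁ => (h₂ hM hε hR₁ ?_ ?_ ?_ ?_ ?_).seq fun σ₂ hA₂ hmin => ?_).mono
    (T := C₁ * ((M.gridProblem ε).nodes + n + 1) ^ 3 +
      (C₂ * ((M.gridProblem ε).nodes + n + 1) ^ 3 +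
        (C₃ * ((n + 1) * (n + 1)) + C₄ * (n + 1)))) ?_ fun _ _ h => h
  · rw [hA₁.nat 6 (by decide)]; rfl
  · rw [hA₁.nat 7 (by decide)]; rfl
  · rw [hA₁.nat 8 (by decide)]; rfl
  · rw [hA₁.nat 13 (by decide)]; rfl
  · rw [hA₁.nat 14 (by decide)]; rfl
  · have hR₂ := hR₁.of_agree hA₂ (by decide) (by decide)
    refine (h₃ hR₂ fun i hi => hM.simpleMesh_subset hε _ _ (hmin.1 ⟨i, hi⟩)).seq
      fun σ₃ hA₃ hv => ?_
    have hR₃ := hR₂.of_agree hA₃ (by decide) (by decide)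
    refine (h₄ hR₃.size).mono le_rfl fun σ₄ hA₄ ⟨hpt, hval⟩ => ?_
    rw [hpt, hval, hv, hM.cost_eq ε, hA₃.real 11 (by decide)]
    exact ⟨hmin, rfl⟩
  · generalize (M.gridProblem ε).nodes = K
    have e1 : (n + 1) * (n + 1) ≤ (K + n + 1) ^ 3 := by
      calc (n + 1) * (n + 1) ≤ (K + n + 1) * (K + n + 1) := Nat.mul_le_mul (by omega) (by omega)
        _ = (K + n + 1) ^ 2 := (sq _).symm
        _ ≤ (K + n + 1) ^ 3 := Nat.pow_le_pow_right (by omega) (by norm_num)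
    have e2 : K + n + 1 ≤ (K + n + 1) ^ 3 := Nat.le_self_pow (by norm_num) _
    have e3 : n + 1 ≤ (K + n + 1) ^ 3 := by omega
    nlinarith [Nat.mul_le_mul_left C₃ e1, Nat.mul_le_mul_left C₄ e3]

end BetheRAM

theorem mainTheorem3 :
    (∀ (n m : ℕ) (M : BinaryMRF n m), M.Attractive →
      (∀ 𝓜 : Fin n → Finset ℝ, (∀ i, ∀ x ∈ 𝓜 i, x ∈ Set.Icc (0 : ℝ) 1) → M.SubmodularMesh 𝓜) ∧
      ∀ ε : ℝ, 0 < ε →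
        M.SufficientMesh (M.simpleMesh ε) ε ∧
        M.SubmodularMesh (M.simpleMesh ε) ∧
        (BinaryMRF.meshSize (M.simpleMesh ε) : ℝ) ≤ 2 * n + n / ε * ∑ e, |M.W e| ∧
        GraphCutSolvable M.freeEnergy (BinaryMRF.meshPoints (M.simpleMesh ε))
          (BinaryMRF.meshSize (M.simpleMesh ε) + 2)) ∧
    ∃ (p : RealRAM.Program) (C : ℝ),
      ∀ (n m : ℕ) (M : BinaryMRF n m), 0 < n → M.Attractive → ∀ ε : ℝ, 0 < ε →
        ∃ (t : ℕ) (σ : RealRAM.Memory), RealRAM.Exec p (RealRAM.inputMemory M ε) t σ ∧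
          M.IsMeshMinimizer (M.simpleMesh ε) (RealRAM.outputPoint n σ) ∧
          RealRAM.outputValue σ = -M.freeEnergy (RealRAM.outputPoint n σ) ∧
          |RealRAM.outputValue σ - M.logZB| ≤ ε ∧
          (t : ℝ) ≤ C * (BinaryMRF.meshSize (M.simpleMesh ε) : ℝ) ^ 3 ∧
          (t : ℝ) ≤ C * (n + n * m * M.maxWeight / ε) ^ 3 ∧
          (ε ≤ m * M.maxWeight →
            (t : ℝ) ≤ C * (ε⁻¹ ^ 3 * n ^ 3 * m ^ 3 * M.maxWeight ^ 3)) := by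
  refine ⟨fun n m M hM => ⟨fun 𝓜 h𝓜 => hM.submodularMesh h𝓜, fun ε hε => ⟨hM.sufficientMesh hε,
    hM.submodularMesh (hM.simpleMesh_subset hε), hM.meshSize_le hε, hM.graphCutSolvable hε⟩⟩, ?_⟩
  obtain ⟨C, hC⟩ := BetheRAM.runs_betheProgram
  -- 512 = 2³ · 4³: a factor 2 from N + 1 ≤ 2 N, and a factor 4 from N ≤ 4 x, where x is the
  -- quantity cubed in each of the three bounds.
  refine ⟨BetheRAM.betheProgram, 512 * C, fun n m M hn hM ε hε => ?_⟩
  obtain ⟨t, σ, he, ht, hmin, hval⟩ := hC hM hε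
  have hlog := hmin.abs_sub_logZB_le hM hε
  rw [← hval] at hlog
  have hN := hM.nodes_add hε
  have hN2 := hM.meshSize_le_maxWeight hε
  rw [hN] at ht
  generalize meshSize (M.simpleMesh ε) = N at *
  have hW := M.maxWeight_nonneg
  have ht' : (t : ℝ) ≤ 8 * C * (N : ℝ) ^ 3 := by
    -- Every dimension has at least one mesh point, so N ≥ n ≥ 1.
    have h1 : N + 1 ≤ 2 * N := by omega
    have h2 : t ≤ C * (2 * N) ^ 3 := ht.trans (Nat.mul_le_mul_left _ (Nat.pow_le_pow_left h1 3))
    have h3 : (t : ℝ) ≤ C * (2 * N) ^ 3 := by exact_mod_cast h2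
    linarith [h3, show (C : ℝ) * (2 * N) ^ 3 = 8 * C * (N : ℝ) ^ 3 by ring]
  have hbound : ∀ x : ℝ, (N : ℝ) ≤ 4 * x → (t : ℝ) ≤ 512 * C * x ^ 3 := by
    intro x hx
    have h1 : (N : ℝ) ^ 3 ≤ (4 * x) ^ 3 := pow_le_pow_left₀ (Nat.cast_nonneg _) hx 3
    have h2 := mul_le_mul_of_nonneg_left h1 (show (0 : ℝ) ≤ 8 * C by positivity)
    linarith [h2, show 8 * (C : ℝ) * (4 * x) ^ 3 = 512 * C * x ^ 3 by ring]
  refine ⟨t, σ, he, hmin, hval, hlog, hbound _ ?_, hbound _ ?_, fun hεm => ?_⟩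
  · linarith [Nat.cast_nonneg (α := ℝ) N]
  · have : 0 ≤ n + n * m * M.maxWeight / ε := by positivity
    linarith
  -- For ε ≤ mW the summand n is dominated by nmW/ε, so N ≤ 2 (n + nmW/ε) is at most 4 nmW/ε.
  · have h1 : (n : ℝ) ≤ n * m * M.maxWeight / ε := by
      rw [le_div_iff₀ hε, mul_assoc]
      exact mul_le_mul_of_nonneg_left hεm (Nat.cast_nonneg _)
    have h2 := hbound (n * m * M.maxWeight / ε) (by linarith)
    refine h2.trans (le_of_eq ?_)
    rw [div_eq_mul_inv]
    ring
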